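/- Let $G = A_1 * \cdots * A_k * F_N$, where $A_1,\dots,A_k$ are countably infinite torsion-free groups and $F_N$ is a free group of rank $N$, and assume that $2k+3N-3 \ge 3$. A subgroup of $G$ is *peripheral* if it is conjugate into some $A_i$; an element is *peripheral* if it is trivial or lies in a peripheral subgroup. Write $\mathcal A=\{[A_1],\dots,[A_k]\}$. **Trees.** A *$(G,\mathcal A)$-tree* is a metric simplicial tree with a minimal cocompact action of $G$ by isometries without inversions in which every peripheral subgroup fixes a point, and in which every vertex of degree two is fixed by an element of $G$ that interchanges its two incident edges. It is a *Grushko tree* if edge stabilizers are trivial and every element fixing a point is peripheral. It is a *free splitting* if it is not a point, all edges have length one and edge stabilizers are trivial. A non-peripheral $g$ is *simple* if it fixes a point of some free splitting. **Decomposition space.** For a Grushko tree $T$ let $\partial T = V_\infty(T)\cup\partial_\infty T$, where $V_\infty(T)$ is the set of vertices with non-trivial stabilizer and $\partial_\infty T$ is the Gromov boundary, with the observers topology, i.e. the topology generated by the traces on $\partial T$ of the directions (the connected components of complements of points of $T\cup\partial_\infty T$). This space does not depend on $T$ up to canonical $G$-homeomorphism, and is denoted $\partial(G,\mathcal A)$.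 A non-peripheral $g$ has an axis $T_g\subset T$, with endpoints $g^{\infty},g^{-\infty}\in\partial(G,\mathcal A)$. Put $\mathcal L_g=\{\{a g^\infty,a g^{-\infty}\}: a\in G\}$. A *periodic line collection* is $\mathcal L=\mathcal L_{g_1}\cup\dots\cup\mathcal L_{g_m}$ with all $g_j$ non-peripheral. The *decomposition space* $\mathcal D(\mathcal L)$ is the quotient space of $\partial(G,\mathcal A)$ obtained by identifying the two points of each $\ell\in\mathcal L$. For $\ell=\{ag_j^\infty,ag_j^{-\infty}\}$, let $\ell_T$ be the axis of $ag_ja^{-1}$ in $T$. **Whitehead graphs.** Let $v$ be a vertex of a Grushko tree $T$. The vertices of $\mathrm{Wh}_T(\mathcal L,v)$ are the $\mathrm{Stab}(v)$-orbits of directions at $v$, with a preferred direction $Y_i$ chosen in each. There is an oriented edge from $[Y_i]$ to $[Y_j]$ labelled $a\in\mathrm{Stab}(v)$ for each $\ell\in\mathcal L$ such that $\ell_T$ meets the two distinct directions $Y_i$ and $aY_j$; with the opposite orientation it is the edge from $[Y_j]$ to $[Y_i]$ labelled $a^{-1}$ given by $a^{-1}\ell$. For a connected subgraph $U$, $\mathrm{Mon}(U)\le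 \mathrm{Stab}(v)$ is the subgroup, defined up to conjugacy, generated by the products of labels along closed paths in $U$ based at a vertex. The graph has an *admissible cut* if either * (type i) it is a disjoint union $U\sqcup W$ of subgraphs with $U$ connected (in particular non-empty), $\mathrm{Mon}(U)=\{1\}$, and $W\neq\emptyset$ if $\mathrm{Stab}(v)=\{1\}$; or * (type ii) it is a union $U\cup W$ of subgraphs with $U\cap W$ a single vertex $x$, $U$ connected, $\mathrm{Mon}(U)=\{1\}$, $U$ containing a vertex other than $x$, and $W$ containing a vertex other than $x$ if $\mathrm{Stab}(v)=\{1\}$. $T$ is *Whitehead reduced for $\mathcal L$* if $\mathrm{Wh}_T(\mathcal L,v)$ has no admissible cut for any vertex $v$ of $T$. **Statement.** 1. For every periodic line collection $\mathcal L$, there is a Grushko tree that is Whitehead reduced for $\mathcal L$ if and only if $\mathcal D(\mathcal L)$ is connected. 2. A non-peripheral element $g\in G$ is not simple if and only if $\mathcal D(\mathcal L_g)$ is connected. -/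

import Mathlib

universe u

namespace Grushko

section FreeProducts

variable {G : Type u} [Group G] {k : ℕ}

/-- `G = A₁ * ⋯ * A_k * F_N` (internal free product), where the `A i` are countably infinite
torsion-free subgroups of `G` and `F_N` is free of rank `N`. -/
structure IsTorsionFreeFreeProduct (A : Fin k → Subgroup G) (N : ℕ) : Prop where
  countable : ∀ i, Countable (A i)
  infinite : ∀ i, Infinite (A i)
  torsionFree : ∀ i, ∀ a ∈ A i, a ≠ 1 → ¬ IsOfFinOrder a
  freeProduct : ∃ φ : FreeGroup (Fin N) →* G,
    Function.Bijective (Monoid.Coprod.lift (Monoid.CoprodI.lift fun i => (A i).subtype) φ)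

/-- The complexity `ξ(G, 𝒜) = 2k + 3N - 3`; the free product is non-sporadic when this is at
least `3`. -/
def complexity (k N : ℕ) : ℤ := 2 * k + 3 * N - 3

/-- A subgroup that is conjugate into one of the `A i`. -/
def IsPeripheralSubgroup (A : Fin k → Subgroup G) (H : Subgroup G) : Prop :=
  ∃ i, ∃ a : G, ∀ h ∈ H, a⁻¹ * h * a ∈ A i

/-- An element that lies in a peripheral subgroup. The identity counts as peripheral, also when
there are no factors `A i`. -/
def IsPeripheral (A : Fin k → Subgroup G) (g : G) : Prop :=
  g = 1 ∨ ∃ H : Subgroup G, IsPeripheralSubgroup A H ∧ g ∈ H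

end FreeProducts

/-- A `(G, 𝒜)`-tree: a metric simplicial tree, given by its vertices, its edges and the lengths of
its edges, with a minimal cocompact action of `G` by isometries without inversions for which each
peripheral subgroup fixes a point. -/
structure GATree {G : Type u} [Group G] {k : ℕ} (A : Fin k → Subgroup G) where
  /-- the vertices -/
  V : Type u
  /-- the action of the group on the vertices -/
  act : MulAction G V
  /-- the underlying graph -/
  graph : SimpleGraph V
  isTree : graph.IsTree
  /-- the lengths of the edges (values at pairs that are not edges are irrelevant) -/
  len : Sym2 V → ℝ
  len_pos : ∀ e ∈ graph.edgeSet, 0 < len e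
  adj_smul : ∀ (g : G) (v w : V), graph.Adj v w → graph.Adj (g • v) (g • w)
  len_smul : ∀ (g : G) (v w : V), graph.Adj v w → len s(g • v, g • w) = len s(v, w)
  no_inversion : ∀ (g : G) (v w : V), graph.Adj v w → ¬ (g • v = w ∧ g • w = v)
  /-- there is no proper invariant subtree -/
  minimal : ∀ S : Set V, (∀ g : G, ∀ v ∈ S, g • v ∈ S) → (graph.induce S).Connected → S = Set.univ
  /-- finitely many orbits of vertices -/
  finite_vertices : ∃ F : Set V, F.Finite ∧ ∀ v, ∃ g : G, g • v ∈ F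
  /-- finitely many orbits of edges -/
  finite_edges : ∃ F : Set (V × V), F.Finite ∧
    ∀ v w, graph.Adj v w → ∃ g : G, (g • v, g • w) ∈ F
  peripheral_fixes : ∀ H : Subgroup G, IsPeripheralSubgroup A H → ∃ v : V, ∀ h ∈ H, h • v = v
  /-- the incident edges of a vertex of degree two are interchanged by an element fixing it -/
  degree_two : ∀ v w₁ w₂ : V, w₁ ≠ w₂ → graph.neighborSet v = {w₁, w₂} →
    ∃ g : G, g • v = v ∧ g • w₁ = w₂ ∧ g • w₂ = w₁

namespace GATree

variable {G : Type u} [Group G] {k : ℕ} {A : Fin k → Subgroup G}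

instance (T : GATree A) : MulAction G T.V := T.act

/-- Some point of the tree is fixed. -/
def IsElliptic (T : GATree A) (g : G) : Prop := ∃ v : T.V, g • v = v

/-- The stabilizer of every edge is trivial. As there are no inversions, an element that leaves an
edge invariant fixes both of its ends. -/
def TrivialEdgeStabilizers (T : GATree A) : Prop :=
  ∀ (g : G) (v w : T.V), T.graph.Adj v w → g • v = v → g • w = w → g = 1

/-- Grushko trees, the points of the relative outer space. -/
structure IsGrushko (T : GATree A) : Prop where
  elliptic : ∀ g : G, T.IsElliptic g → IsPeripheral A g
  edges : T.TrivialEdgeStabilizers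

/-- Free splittings: not a single point, all edges of length one and with trivial stabilizer. -/
structure IsFreeSplitting (T : GATree A) : Prop where
  nontrivial : ∃ v w, T.graph.Adj v w
  len_one : ∀ e ∈ T.graph.edgeSet, T.len e = 1
  edges : T.TrivialEdgeStabilizers

/-! ### The boundary -/

/-- The direction at `v` that contains `w`: the vertices of the connected component of `w` in the
complement of `v`. -/
def direction (T : GATree A) (v w : T.V) : Set T.V :=
  {x | ∃ p : T.graph.Walk w x, v ∉ p.support}

/-- Geodesic rays along vertices. -/
structure Ray (T : GATree A) where
  /-- the `n`-th vertex -/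
  pt : ℕ → T.V
  adj : ∀ n, T.graph.Adj (pt n) (pt (n + 1))
  inj : Function.Injective pt

/-- Two rays are equivalent when they have a common subray. -/
def raySetoid (T : GATree A) : Setoid T.Ray where
  r r s := ∃ m n, ∀ i, r.pt (m + i) = s.pt (n + i)
  iseqv := by
    refine ⟨fun r => ⟨0, 0, fun _ => rfl⟩, ?_, ?_⟩
    · rintro r s ⟨m, n, h⟩
      exact ⟨n, m, fun i => (h i).symm⟩
    · rintro r s t ⟨m, n, h⟩ ⟨p, q, h'⟩
      refine ⟨m + p, q + n, fun i => ?_⟩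
      have h1 := h (p + i)
      have h2 := h' (n + i)
      rw [show m + p + i = m + (p + i) by ring, h1, show n + (p + i) = p + (n + i) by ring, h2,
        show q + n + i = q + (n + i) by ring]

/-- The Gromov boundary `∂_∞ T`. -/
def Ends (T : GATree A) : Type u := Quotient T.raySetoid

/-- The point of the Gromov boundary that a ray converges to. -/
def Ray.limit {T : GATree A} (r : T.Ray) : T.Ends := Quotient.mk T.raySetoid r

/-- `∂T = V_∞(T) ∪ ∂_∞ T`, where `V_∞(T)` is the set of vertices with non-trivial stabilizer. -/
def Boundary (T : GATree A) : Type u :=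
  {v : T.V // MulAction.stabilizer G v ≠ ⊥} ⊕ T.Ends

/-- The boundary points in the closure of the direction at `v` that contains the neighbour `w`
(other than `v` itself). -/
def boundaryDirection (T : GATree A) (v w : T.V) : Set T.Boundary :=
  {x | (∃ y, x = Sum.inl y ∧ y.1 ∈ T.direction v w) ∨
    ∃ r : T.Ray, x = Sum.inr r.limit ∧ ∀ n, r.pt n ∈ T.direction v w}

/-- The observers topology, restricted to `∂T`. Its basis consists of the finite intersections of
directions. A direction at an interior point of an edge has the same trace on `∂T` as the
direction, at one of the two ends of this edge, that contains the other end; and the complement of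
a point of `∂_∞ T` is a union of directions. So the directions at vertices generate it. -/
instance (T : GATree A) : TopologicalSpace T.Boundary :=
  TopologicalSpace.generateFrom
    {B | ∃ v w, T.graph.Adj v w ∧ B = T.boundaryDirection v w}

/-! ### Periodic lines and the decomposition space -/

/-- Bi-infinite geodesics along vertices. -/
structure Line (T : GATree A) where
  /-- the `n`-th vertex -/
  pt : ℤ → T.V
  adj : ∀ n, T.graph.Adj (pt n) (pt (n + 1))
  inj : Function.Injective pt

/-- The half of a line towards `+∞`. -/
def Line.posRay {T : GATree A} (l : T.Line) : T.Ray where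
  pt n := l.pt n
  adj n := by
    have h := l.adj n
    exact_mod_cast h
  inj m n h := by exact_mod_cast l.inj h

/-- The half of a line towards `-∞`. -/
def Line.negRay {T : GATree A} (l : T.Line) : T.Ray where
  pt n := l.pt (-n)
  adj n := by
    have h := (l.adj (-(n : ℤ) - 1)).symm
    rw [sub_add_cancel] at h
    rwa [show (-((n + 1 : ℕ) : ℤ)) = -(n : ℤ) - 1 by push_cast; ring]
  inj m n h := by
    have h' := l.inj h
    omega

/-- `l` is the axis `T_g` of `g`, parametrized so that `g` translates it in the positive
direction. Its ends are then `g^∞` (positive) and `g^{-∞}` (negative). -/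
def IsAxis (T : GATree A) (g : G) (l : T.Line) : Prop :=
  ∃ t : ℕ, 0 < t ∧ ∀ n, g • l.pt n = l.pt (n + t)

/-- The periodic line collection `ℒ = ℒ_{g₁} ∪ ⋯ ∪ ℒ_{g_m}`, realised in `T`: the set of the axes
(as sets of vertices) of all conjugates of the generators. -/
def lines (T : GATree A) {m : ℕ} (g : Fin m → G) : Set (Set T.V) :=
  {X | ∃ (a : G) (j : Fin m) (l : T.Line), T.IsAxis (a * g j * a⁻¹) l ∧ X = Set.range l.pt}

/-- The pairs of boundary points that are identified: the two ends `a g_j^∞` and `a g_j^{-∞}` of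
the axis of `a g_j a⁻¹`. -/
def lineRel (T : GATree A) {m : ℕ} (g : Fin m → G) (x y : T.Boundary) : Prop :=
  ∃ (a : G) (j : Fin m) (l : T.Line), T.IsAxis (a * g j * a⁻¹) l ∧
    x = Sum.inr l.negRay.limit ∧ y = Sum.inr l.posRay.limit

/-- The decomposition space `𝒟(ℒ)`: the quotient of `∂(G, 𝒜)`, computed as `∂T`, by `ℒ`. -/
def DecompositionSpace (T : GATree A) {m : ℕ} (g : Fin m → G) : Type u := Quot (T.lineRel g)

instance (T : GATree A) {m : ℕ} (g : Fin m → G) : TopologicalSpace (T.DecompositionSpace g) :=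
  inferInstanceAs (TopologicalSpace (Quot (T.lineRel g)))

/-! ### Whitehead graphs -/

/-- Directions at `v`, each given by the neighbour of `v` that it contains, up to the action of the
stabilizer of `v`. -/
def directionSetoid (T : GATree A) (v : T.V) : Setoid (T.graph.neighborSet v) where
  r w w' := ∃ a : MulAction.stabilizer G v, (a : G) • w.1 = w'.1
  iseqv := by
    refine ⟨fun w => ⟨1, one_smul _ _⟩, ?_, ?_⟩
    · rintro w w' ⟨a, h⟩
      exact ⟨a⁻¹, by rw [← h]; exact inv_smul_smul (a : G) w.1⟩
    · rintro w w' w'' ⟨a, h⟩ ⟨b, h'⟩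
      exact ⟨b * a, by rw [← h', ← h]; exact mul_smul (b : G) (a : G) w.1⟩

/-- The vertices of the Whitehead graph at `v`. -/
def WhVertex (T : GATree A) (v : T.V) : Type u := Quotient (T.directionSetoid v)

/-- The chosen neighbour of `v` in a class; the preferred direction is the one containing it. -/
noncomputable def WhVertex.pref {T : GATree A} {v : T.V} (x : T.WhVertex v) : T.V :=
  (Quotient.out (s := T.directionSetoid v) x).1

/-- An oriented edge of the Whitehead graph at `v`, from `[Y_i]` to `[Y_j]` with label `a` in the
stabilizer of `v`: a line of the collection that meets the distinct directions `Y_i` and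
`a Y_j`. -/
structure WhEdge (T : GATree A) {m : ℕ} (g : Fin m → G) (v : T.V) where
  /-- the initial vertex -/
  src : T.WhVertex v
  /-- the terminal vertex -/
  tgt : T.WhVertex v
  /-- the label -/
  label : MulAction.stabilizer G v
  /-- the line -/
  line : Set T.V
  line_mem : line ∈ T.lines g
  meets_src : (line ∩ T.direction v src.pref).Nonempty
  meets_tgt : (line ∩ T.direction v ((label : G) • tgt.pref)).Nonempty
  distinct : src.pref ≠ (label : G) • tgt.pref

/-- `e'` is the edge `e` with the opposite orientation: a line `ℓ` that meets `Y_i` and `a Y_j`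
gives an edge labelled `a`, and `a⁻¹ ℓ` meets `Y_j` and `a⁻¹ Y_i`. -/
def WhEdge.IsReverse {T : GATree A} {m : ℕ} {g : Fin m → G} {v : T.V}
    (e e' : T.WhEdge g v) : Prop :=
  e'.src = e.tgt ∧ e'.tgt = e.src ∧ e'.label = e.label⁻¹ ∧
    e'.line = (fun x => (e.label : G)⁻¹ • x) '' e.line

/-- Subgraphs of the Whitehead graph. -/
structure WhSubgraph (T : GATree A) {m : ℕ} (g : Fin m → G) (v : T.V) where
  /-- the vertices of the subgraph -/
  verts : Set (T.WhVertex v)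
  /-- the oriented edges of the subgraph -/
  edges : Set (T.WhEdge g v)
  src_mem : ∀ e ∈ edges, e.src ∈ verts
  tgt_mem : ∀ e ∈ edges, e.tgt ∈ verts
  reverse_mem : ∀ e ∈ edges, ∀ e', e.IsReverse e' → e' ∈ edges

namespace WhSubgraph

variable {T : GATree A} {m : ℕ} {g : Fin m → G} {v : T.V}

/-- There is an edge path in `U` from `x` to `y` whose product of labels is `a`. -/
inductive Path (U : T.WhSubgraph g v) :
    T.WhVertex v → T.WhVertex v → MulAction.stabilizer G v → Prop
  | nil (x : T.WhVertex v) (hx : x ∈ U.verts) : Path U x x 1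
  | cons (e : T.WhEdge g v) (he : e ∈ U.edges) (y : T.WhVertex v) (a : MulAction.stabilizer G v)
      (h : Path U e.tgt y a) : Path U e.src y (e.label * a)

/-- Connected (in particular non-empty) subgraphs. -/
def IsConnected (U : T.WhSubgraph g v) : Prop :=
  U.verts.Nonempty ∧ ∀ x ∈ U.verts, ∀ y ∈ U.verts, ∃ a, U.Path x y a

/-- The monodromy subgroup `Mon(U, x)`, generated by the products of the labels along the closed
paths based at `x`. -/
def monodromy (U : T.WhSubgraph g v) (x : T.WhVertex v) : Subgroup (MulAction.stabilizer G v) :=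
  Subgroup.closure {a | U.Path x x a}

/-- `Mon(U) = {1}`. -/
def TrivialMonodromy (U : T.WhSubgraph g v) : Prop := ∀ x ∈ U.verts, U.monodromy x = ⊥

/-- The Whitehead graph is the union of the two subgraphs. -/
def Covers (U W : T.WhSubgraph g v) : Prop :=
  U.verts ∪ W.verts = Set.univ ∧ U.edges ∪ W.edges = Set.univ

end WhSubgraph

/-- Admissible cuts of type i: the Whitehead graph is a disjoint union `U ⊔ W`, where `U` is
connected with trivial monodromy, and `W` is not empty if the stabilizer of `v` is trivial. -/
def HasTypeOneCut (T : GATree A) {m : ℕ} (g : Fin m → G) (v : T.V) : Prop :=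
  ∃ U W : T.WhSubgraph g v, U.Covers W ∧ Disjoint U.verts W.verts ∧ Disjoint U.edges W.edges ∧
    U.IsConnected ∧ U.TrivialMonodromy ∧
    (MulAction.stabilizer G v = ⊥ → W.verts.Nonempty)

/-- Admissible cuts of type ii: the Whitehead graph is a union `U ∪ W`, where `U ∩ W` is a single
vertex `x` and `U` is connected with trivial monodromy. The degenerate decompositions, which exist
in every Whitehead graph, are excluded: `U` has a vertex besides `x`, and so has `W` if the
stabilizer of `v` is trivial. -/
def HasTypeTwoCut (T : GATree A) {m : ℕ} (g : Fin m → G) (v : T.V) : Prop :=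
  ∃ (U W : T.WhSubgraph g v) (x : T.WhVertex v), U.Covers W ∧ U.verts ∩ W.verts = {x} ∧
    Disjoint U.edges W.edges ∧ U.IsConnected ∧ U.TrivialMonodromy ∧ U.verts ≠ {x} ∧
    (MulAction.stabilizer G v = ⊥ → W.verts ≠ {x})

/-- No Whitehead graph of the collection generated by `g` has an admissible cut. -/
def IsWhiteheadReduced (T : GATree A) {m : ℕ} (g : Fin m → G) : Prop :=
  ∀ v : T.V, ¬ (T.HasTypeOneCut g v ∨ T.HasTypeTwoCut g v)

end GATree

/-- Simple elements (for non-peripheral `g`): elliptic in some free splitting of `(G, 𝒜)`. -/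
def IsSimple {G : Type u} [Group G] {k : ℕ} (A : Fin k → Subgroup G) (g : G) : Prop :=
  ∃ S : GATree A, S.IsFreeSplitting ∧ S.IsElliptic g

end Grushko

/-! For generators `g` three conditions are equivalent: (1) some Grushko tree is Whitehead reduced,
(2) the decomposition space is connected, (3) no free splitting makes all generators elliptic at
once. For one generator, (3) says that it is not simple.

The mediator is a set `P` of vertices with finite coboundary, infinite and co-infinite, such that
every axis has both ends in `P` or both outside (`Separates`). It is the combinatorial form of a
clopen partition of the decomposition space: a finite coboundary makes `P` cut out a clopen set of
boundary points, and every clopen set arises in this way (`isTame_univ`). Preimages under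
equivariant maps are again separating (`Separates.comap`), so the notion passes from tree to tree
and boundaries of different trees need not be compared.

(1) ⇒ (2). If `P` separates in a tree, there is a vertex `v` at which all directions but at most one
are pure, that is, meet `P` or its complement in a finite set only. Finitely many of the pure
directions have the colour opposite to `v`. An axis through `v` cannot join pure directions of
different colours, so turns leave this finite set through the exceptional direction only. This
produces an admissible cut (`hasCut_of_finite`).

(2) ⇒ (3). If the generators are elliptic in a free splitting, a half-tree of the splitting
separates, and so does its preimage in a Grushko tree.

(3) ⇒ (1). Among all models of Grushko trees, take one that minimises the total translation length
of the generators and then the number of vertex orbits. A type i cut would give a free splitting: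
pull the cut directions apart from their vertex and collapse all old edges, so that every axis
becomes a point (`IsTypeOneSet.exists_isFreeSplitting`). A type ii cut would allow a slide of edges
that shortens the generators, unless it yields a type i cut (`IsTypeTwoSet.exists_cost_lt`). So the
optimal model is reduced. Models are not required to be minimal or free of superfluous vertices of
degree two; optimality supplies both.

Torsion-freeness makes non-trivial vertex stabilizers move neighbours in infinite orbits. The
complexity bound excludes the trivial group and the integers acting on a line. -/

namespace Grushko

open SimpleGraph

/-! ### Half-trees and geodesics in trees -/

section Sides

variable {V : Type*} {Γ : SimpleGraph V}

/-- The half-tree at `v` that contains `w`. -/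
def side (Γ : SimpleGraph V) (v w : V) : Set V := {x | ∃ p : Γ.Walk w x, v ∉ p.support}

lemma mem_side_self {v w : V} (h : v ≠ w) : w ∈ side Γ v w := ⟨.nil, by simpa using h⟩

lemma not_mem_side (v w : V) : v ∉ side Γ v w := fun ⟨p, hp⟩ => hp p.end_mem_support

lemma side_adj {v w a b : V} (hab : Γ.Adj a b) (ha : a ∈ side Γ v w) (hb : b ≠ v) :
    b ∈ side Γ v w := by
  obtain ⟨p, hp⟩ := ha
  refine ⟨p.concat hab, ?_⟩
  rw [Walk.support_concat]
  simp [hp, hb.symm]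

lemma side_walk {v w a b : V} (p : Γ.Walk a b) (ha : a ∈ side Γ v w) (hp : v ∉ p.support) :
    b ∈ side Γ v w := by
  obtain ⟨q, hq⟩ := ha
  exact ⟨q.append p, by rw [Walk.mem_support_append_iff]; tauto⟩

/-- Otherwise the edge from `v` to `a` and the path through `w` would be two different paths with
the same ends. -/
lemma eq_of_mem_side (hT : Γ.IsTree) {v w a : V} (hvw : Γ.Adj v w) (hva : Γ.Adj v a)
    (ha : a ∈ side Γ v w) : a = w := by
  classical
  obtain ⟨p, hp⟩ := ha
  have hp' : v ∉ p.toPath.1.support := fun h => hp (p.support_toPath_subset_support h)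
  have h1 : (Walk.cons hvw p.toPath.1).IsPath := p.toPath.2.cons hp'
  have h2 : (Walk.cons hva Walk.nil).IsPath := by simp [hva.ne]
  have := hT.existsUnique_path v a |>.unique h1 h2
  have h3 := congrArg Walk.snd this
  simpa using h3.symm

lemma exists_side (hT : Γ.IsTree) {v x : V} (h : x ≠ v) : ∃ w, Γ.Adj v w ∧ x ∈ side Γ v w := by
  obtain ⟨p, hp, -⟩ := hT.existsUnique_path v x
  cases p with
  | nil => exact absurd rfl h
  | cons hvw q => exact ⟨_, hvw, q, ((Walk.cons_isPath_iff _ _).1 hp).2⟩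

lemma side_unique (hT : Γ.IsTree) {v w w' x : V} (hw : Γ.Adj v w) (hw' : Γ.Adj v w')
    (h : x ∈ side Γ v w) (h' : x ∈ side Γ v w') : w = w' := by
  obtain ⟨p, hp⟩ := h
  refine eq_of_mem_side hT hw' hw ?_
  exact side_walk p.reverse h' (by simpa using hp)

/-- An edge that avoids `v` cannot leave the half-tree, and `w` is the only neighbour of `v` in it.
-/
lemma cross_side (hT : Γ.IsTree) {v w a b : V} (hvw : Γ.Adj v w) (hab : Γ.Adj a b)
    (ha : a ∉ side Γ v w) (hb : b ∈ side Γ v w) : a = v ∧ b = w := by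
  have : a = v := by
    by_contra h
    exact ha (side_adj hab.symm hb h)
  subst this
  exact ⟨rfl, eq_of_mem_side hT hvw hab hb⟩

lemma not_mem_side_iff (hT : Γ.IsTree) {v w x : V} (hvw : Γ.Adj v w) :
    x ∉ side Γ v w ↔ x ∈ side Γ w v := by
  constructor
  · intro h
    by_cases hx : x = v
    · subst hx; exact mem_side_self hvw.ne'
    obtain ⟨w', hw', p, hp⟩ := exists_side hT hx
    have hww : w' ≠ w := by rintro rfl; exact h ⟨p, hp⟩
    refine ⟨Walk.cons hw' p, ?_⟩
    classical
    simp only [Walk.support_cons, List.mem_cons, not_or]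
    refine ⟨hvw.ne', fun hw => hww ?_⟩
    refine (eq_of_mem_side hT hw' hvw ⟨p.takeUntil w hw, fun hv => hp ?_⟩).symm
    exact p.support_takeUntil_subset_support hw hv
  · rintro ⟨p, hp⟩ hx
    obtain ⟨d, hd, h1, h2⟩ := p.exists_boundary_dart (side Γ v w)ᶜ (not_mem_side v w)
      (by simpa using hx)
    obtain ⟨-, h4⟩ := cross_side hT hvw d.adj h1 (by simpa using h2)
    exact hp (h4 ▸ p.dart_snd_mem_support_of_mem_darts hd)

/-- A walk from `y` that avoids `x` can leave the larger half-tree only through `a`, and then `a`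
would lie beyond the edge from `x` to `y`. -/
lemma side_subset {a b x y : V} (hxy : Γ.Adj x y) (hx : x ∈ side Γ a b)
    (ha : a ∉ side Γ x y) : side Γ x y ⊆ side Γ a b := by
  have hax : a ≠ x := by rintro rfl; exact not_mem_side _ _ hx
  have hy : y ∈ side Γ a b := by
    refine side_adj hxy hx ?_
    rintro rfl; exact ha (mem_side_self hxy.ne)
  rintro z ⟨p, hp⟩
  refine side_walk p hy fun hap => ha ?_
  classical
  exact ⟨p.takeUntil a hap, fun h => hp (p.support_takeUntil_subset_support hap h)⟩

lemma dist_of_mem_side (hT : Γ.IsTree) {v w x : V} (hvw : Γ.Adj v w) (h : x ∈ side Γ w v) :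
    Γ.dist x w = Γ.dist x v + 1 := by
  classical
  obtain ⟨p, hp⟩ := hT.1.exists_walk_length_eq_dist x w
  have h1 : Γ.dist x w ≤ Γ.dist x v + 1 := by
    have := hT.1.dist_triangle (u := x) (v := v) (w := w)
    rwa [dist_eq_one_iff_adj.2 hvw] at this
  have hv : v ∈ p.support := by
    obtain ⟨d, hd, h1, h2⟩ := p.exists_boundary_dart (side Γ w v) h (not_mem_side _ _)
    have := cross_side hT hvw.symm d.adj.symm h2 h1
    exact this.2 ▸ p.dart_fst_mem_support_of_mem_darts hd
  have h2 : p.length = (p.takeUntil v hv).length + (p.dropUntil v hv).length := by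
    rw [← Walk.length_append, Walk.take_spec]
  have h3 := dist_le (p.takeUntil v hv)
  have h4 : 1 ≤ (p.dropUntil v hv).length := by
    by_contra h5
    have : (p.dropUntil v hv).length = 0 := by omega
    exact hvw.ne (Walk.eq_of_length_eq_zero this)
  omega

/-- Locally injective sequences of vertices. -/
lemma mem_side_of_locally_injective (hT : Γ.IsTree) (r : ℕ → V) (hr : ∀ n, Γ.Adj (r n) (r (n + 1)))
    (h2 : ∀ n, r n ≠ r (n + 2)) (n : ℕ) : r 0 ∈ side Γ (r (n + 1)) (r n) := by
  induction n with
  | zero => exact mem_side_self (hr 0).ne'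
  | succ n ih =>
    rw [← not_mem_side_iff hT (hr (n + 1))]
    intro h
    exact h2 n (side_unique hT (hr n).symm (hr (n + 1)) ih h)

lemma dist_of_locally_injective (hT : Γ.IsTree) (r : ℕ → V) (hr : ∀ n, Γ.Adj (r n) (r (n + 1)))
    (h2 : ∀ n, r n ≠ r (n + 2)) (n : ℕ) : Γ.dist (r 0) (r n) = n := by
  induction n with
  | zero => simp
  | succ n ih =>
    rw [dist_of_mem_side hT (hr n) (mem_side_of_locally_injective hT r hr h2 n), ih]

lemma dist_of_locally_injective_int (hT : Γ.IsTree) (l : ℤ → V)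
    (hl : ∀ n, Γ.Adj (l n) (l (n + 1))) (h2 : ∀ n, l n ≠ l (n + 2)) (m : ℤ) (n : ℕ) :
    Γ.dist (l m) (l (m + n)) = n := by
  have := dist_of_locally_injective hT (fun i : ℕ => l (m + i))
    (fun i => by have := hl (m + i); push_cast; rwa [← add_assoc])
    (fun i => by have := h2 (m + i); push_cast; rwa [← add_assoc]) n
  simpa using this

lemma injective_of_locally_injective_int (hΓ : Γ.IsTree) {l : ℤ → V}
    (hl : ∀ n, Γ.Adj (l n) (l (n + 1))) (hl2 : ∀ n, l n ≠ l (n + 2)) : Function.Injective l := by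
  have key : ∀ (i : ℤ) (n : ℕ), l i = l (i + n) → n = 0 := by
    intro i n hin
    have := dist_of_locally_injective_int hΓ l hl hl2 i n
    rw [← hin, SimpleGraph.dist_self] at this
    exact this.symm
  intro i i' hii
  rcases le_total i i' with h | h
  · obtain ⟨n, rfl⟩ := Int.le.dest h
    simp [key i n hii]
  · obtain ⟨n, rfl⟩ := Int.le.dest h
    simp [key i' n hii.symm]

lemma ray_not_mem_side (hT : Γ.IsTree) (r : ℕ → V) (hr : ∀ n, Γ.Adj (r n) (r (n + 1)))
    (h2 : ∀ n, r n ≠ r (n + 2)) (m n : ℕ) (h : m ≤ n) : r m ∉ side Γ (r n) (r (n + 1)) := by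
  obtain ⟨k, rfl⟩ := Nat.exists_eq_add_of_le h
  have := mem_side_of_locally_injective hT (fun i => r (m + i)) (fun i => hr (m + i))
    (fun i => h2 (m + i)) k
  rw [not_mem_side_iff hT (hr _)]
  exact this

/-- Half-trees that point along a ray eventually avoid each given vertex. -/
lemma eventually_not_mem_side (hT : Γ.IsTree) (r : ℕ → V) (hr : ∀ n, Γ.Adj (r n) (r (n + 1)))
    (h2 : ∀ n, r n ≠ r (n + 2)) (a : V) : ∃ m, ∀ n ≥ m, a ∉ side Γ (r n) (r (n + 1)) := by
  -- A vertex beyond the `n`-th edge of the ray sees the whole initial segment on its way to `r 0`,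
  -- so its distance to `r 0` bounds `n`.
  have key : ∀ n, a ∈ side Γ (r n) (r (n + 1)) →
      Γ.dist a (r 0) = Γ.dist a (r (n + 1)) + (n + 1) := by
    intro n
    induction n with
    | zero =>
      intro h
      rw [dist_of_mem_side hT (hr 0).symm h]
    | succ n ih =>
      intro h
      have h' : a ∈ side Γ (r n) (r (n + 1)) :=
        side_subset (hr (n + 1)) (mem_side_self (hr n).ne)
          (ray_not_mem_side hT r hr h2 n (n + 1) (by omega)) h
      rw [ih h', dist_of_mem_side hT (hr (n + 1)).symm h]
      ring
  refine ⟨Γ.dist a (r 0), fun n hn h => ?_⟩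
  have := key n h
  omega

/-- A ray eventually stays on one side of every edge. -/
lemma ray_eventually_side (hT : Γ.IsTree) (r : ℕ → V) (hr : ∀ n, Γ.Adj (r n) (r (n + 1)))
    (h2 : ∀ n, r n ≠ r (n + 2)) {a b : V} (hab : Γ.Adj a b) :
    (∀ᶠ n in Filter.atTop, r n ∈ side Γ a b) ∨ (∀ᶠ n in Filter.atTop, r n ∉ side Γ a b) := by
  obtain ⟨m, hm⟩ := eventually_not_mem_side hT r hr h2 a
  obtain ⟨m', hm'⟩ := eventually_not_mem_side hT r hr h2 b
  -- Once `a` and `b` both lie behind the ray, the ray can no longer cross the edge between them.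
  have step : ∀ n ≥ max m m', (r (n + 1) ∈ side Γ a b ↔ r (n + 1 + 1) ∈ side Γ a b) := by
    intro n hn
    have ha := hm n (le_trans (le_max_left _ _) hn)
    have hb := hm' n (le_trans (le_max_right _ _) hn)
    have n1 : r (n + 1) ≠ a := by
      rintro rfl; exact ha (mem_side_self (hr n).ne)
    have n2 : r (n + 1) ≠ b := by
      rintro rfl; exact hb (mem_side_self (hr n).ne)
    constructor
    · intro h
      by_contra h'
      exact n2 (cross_side hT hab (hr (n + 1)).symm h' h).2
    · intro h
      by_contra h'
      exact n1 (cross_side hT hab (hr (n + 1)) h' h).1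
  have key : ∀ n ≥ max m m' + 1, (r n ∈ side Γ a b ↔ r (max m m' + 1) ∈ side Γ a b) := by
    intro n hn
    induction n, hn using Nat.le_induction with
    | base => rfl
    | succ n hn ih =>
      rw [← ih]
      obtain ⟨k, rfl⟩ := Nat.exists_eq_add_of_le' (show 1 ≤ n by omega)
      exact (step k (by omega)).symm
  by_cases h : r (max m m' + 1) ∈ side Γ a b
  · exact .inl (Filter.eventually_atTop.2 ⟨_, fun n hn => (key n hn).2 h⟩)
  · exact .inr (Filter.eventually_atTop.2 ⟨_, fun n hn => fun h' => h ((key n hn).1 h')⟩)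

/-- A graph in which each edge has a two-colouring of the vertices that separates only its ends is
acyclic. -/
lemma isAcyclic_of_colourings (h : ∀ v w, Γ.Adj v w → ∃ Q : Set V, v ∉ Q ∧ w ∈ Q ∧
    ∀ a b, Γ.Adj a b → a ∉ Q → b ∈ Q → a = v ∧ b = w) : Γ.IsAcyclic := by
  rw [isAcyclic_iff_forall_adj_isBridge]
  intro v w hvw
  obtain ⟨Q, hv, hw, hQ⟩ := h v w hvw
  rw [isBridge_iff]
  rintro ⟨p⟩
  obtain ⟨d, hd, h1, h2⟩ := p.exists_boundary_dart Qᶜ hv (by simpa using hw)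
  have h3 := d.adj
  rw [deleteEdges_adj] at h3
  obtain ⟨e1, e2⟩ := hQ _ _ h3.1 h1 (by simpa using h2)
  exact h3.2 (by rw [e1, e2]; rfl)

end Sides

section Actions

variable {G : Type*} [Group G] {V : Type*} [MulAction G V]

/-- A tree with a cocompact action without inversions and with trivial edge stabilizers. -/
structure IsFreeGTree (G : Type*) [Group G] {V : Type*} [MulAction G V] (Γ : SimpleGraph V) :
    Prop where
  isTree : Γ.IsTree
  smul : ∀ (g : G) (v w : V), Γ.Adj v w → Γ.Adj (g • v) (g • w)
  free : ∀ (g : G) (v w : V), Γ.Adj v w → g • v = v → g • w = w → g = 1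
  no_inversion : ∀ (g : G) (v w : V), Γ.Adj v w → ¬ (g • v = w ∧ g • w = v)
  finite_vertices : ∃ F : Set V, F.Finite ∧ ∀ v, ∃ g : G, g • v ∈ F
  finite_edges : ∃ F : Set (V × V), F.Finite ∧ ∀ v w, Γ.Adj v w → ∃ g : G, (g • v, g • w) ∈ F

end Actions

end Grushko

namespace Grushko

open SimpleGraph

/-! ### Distances and coboundaries -/

section Distances

variable {V : Type*} {Γ : SimpleGraph V}

lemma dist_eq_add (hT : Γ.IsTree) {x y v : V} (hv : ∀ p : Γ.Walk x y, v ∈ p.support) :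
    Γ.dist x y = Γ.dist x v + Γ.dist v y := by
  classical
  refine le_antisymm (hT.1.dist_triangle) ?_
  obtain ⟨p, hp⟩ := hT.1.exists_walk_length_eq_dist x y
  have h2 : p.length = (p.takeUntil v (hv p)).length + (p.dropUntil v (hv p)).length := by
    rw [← Walk.length_append, Walk.take_spec]
  have h3 := dist_le (p.takeUntil v (hv p))
  have h4 := dist_le (p.dropUntil v (hv p))
  omega

lemma dist_eq_add_of_side (hT : Γ.IsTree) {v w x y : V} (hx : x ∈ side Γ v w)
    (hy : y ∉ side Γ v w) : Γ.dist x y = Γ.dist x v + Γ.dist v y :=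
  dist_eq_add hT fun p => by
    by_contra hp
    exact hy (side_walk p hx hp)

lemma dist_lt_of_side (hT : Γ.IsTree) {v w x y : V} (hx : x ∉ side Γ v w)
    (hy : y ∈ side Γ v w) : Γ.dist x v < Γ.dist x y := by
  have h1 := dist_eq_add_of_side hT hy hx
  have h2 : Γ.dist y v ≠ 0 := by
    intro h
    have := hT.1.dist_eq_zero_iff.1 h
    subst this
    exact not_mem_side _ _ hy
  rw [Γ.dist_comm (u := x) (v := v), Γ.dist_comm (u := x) (v := y)]
  omega

/-- Seen from `z`, everything on the other side of `v` lies in the direction of `v`. This is the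
geometric input of the ping-pong argument below. -/
lemma mem_side_of_mem_side (hT : Γ.IsTree) {v w w' x z : V} (hw : Γ.Adj v w)
    (hz : z ∈ side Γ v w) (hv : v ∈ side Γ z w') (hx : x ∉ side Γ v w) : x ∈ side Γ z w' := by
  rw [not_mem_side_iff hT hw] at hx
  obtain ⟨p, hp⟩ := hx
  by_contra hc
  have hzp : z ∈ p.support := by
    by_contra hzp
    exact hc (side_walk p hv hzp)
  classical
  exact (not_mem_side_iff hT hw).2 ⟨p.takeUntil z hzp,
    fun h => hp (p.support_takeUntil_subset_support hzp h)⟩ hz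

end Distances

section Coboundary

variable {V : Type*}

/-- The oriented edges that leave a set of vertices. -/
def coboundary (Γ : SimpleGraph V) (P : Set V) : Set (V × V) :=
  {e | Γ.Adj e.1 e.2 ∧ e.1 ∈ P ∧ e.2 ∉ P}

lemma coboundary_side {Γ : SimpleGraph V} (hT : Γ.IsTree) {v w : V} (hvw : Γ.Adj v w) :
    (coboundary Γ (side Γ v w)).Finite := by
  refine (Set.finite_singleton (w, v)).subset ?_
  rintro ⟨a, b⟩ ⟨hab, ha, hb⟩
  obtain ⟨h1, h2⟩ := cross_side hT hvw hab.symm hb ha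
  simp_all

lemma coboundary_compl {Γ : SimpleGraph V} {P : Set V} (h : (coboundary Γ P).Finite) :
    (coboundary Γ Pᶜ).Finite := by
  refine (h.image Prod.swap).subset ?_
  rintro ⟨a, b⟩ ⟨hab, ha, hb⟩
  exact ⟨(b, a), ⟨hab.symm, by simpa using hb, ha⟩, rfl⟩

end Coboundary

/-- There is no proper invariant subtree. -/
def IsMinimalGTree (G : Type*) [Group G] {V : Type*} [MulAction G V]
    (Γ : SimpleGraph V) : Prop :=
  ∀ S : Set V, (∀ g : G, ∀ v ∈ S, g • v ∈ S) → (Γ.induce S).Connected → S = Set.univ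

lemma axis_zpow {G : Type*} [Group G] {V : Type*} [MulAction G V] {g : G} {l : ℤ → V} {t : ℕ}
    (hg : ∀ n, g • l n = l (n + t)) (k m : ℤ) :
    g ^ k • l m = l (m + k * t) := by
  induction k using Int.induction_on with
  | zero => simp
  | succ k ih =>
    rw [add_comm, zpow_add, zpow_one, mul_smul, ih, hg]; congr 1; ring
  | pred k ih =>
    rw [sub_eq_neg_add, zpow_add, mul_smul, ih, zpow_neg_one, inv_smul_eq_iff, hg]; congr 1; ring

/-! ### Actions with trivial edge stabilizers: fixed points, axes, minimality -/

namespace IsFreeGTree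

variable {G : Type*} [Group G] {V : Type*} [MulAction G V]
variable {Γ : SimpleGraph V} (h : IsFreeGTree G Γ)

include h

lemma smul_mem_side (g : G) {v w x : V} :
    g • x ∈ side Γ (g • v) (g • w) ↔ x ∈ side Γ v w := by
  have key : ∀ (g : G) {v w x : V}, x ∈ side Γ v w → g • x ∈ side Γ (g • v) (g • w) := by
    rintro g v w x ⟨p, hp⟩
    refine ⟨p.map (⟨fun y => g • y, fun {a b} => h.smul g a b⟩ : Γ →g Γ), ?_⟩
    simpa [Walk.support_map] using hp
  exact ⟨fun hx => by simpa using key g⁻¹ hx, key g⟩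

lemma dist_smul (g : G) (x y : V) : Γ.dist (g • x) (g • y) = Γ.dist x y := by
  have key : ∀ (g : G) (x y : V), Γ.dist (g • x) (g • y) ≤ Γ.dist x y := by
    intro g x y
    obtain ⟨p, hp⟩ := h.isTree.1.exists_walk_length_eq_dist x y
    rw [← hp, ← Walk.length_map (⟨fun y => g • y, fun {a b} => h.smul g a b⟩ : Γ →g Γ) p]
    exact dist_le _
  exact le_antisymm (key g x y) (by simpa using key g⁻¹ (g • x) (g • y))

/-- The path between two fixed vertices is fixed, in particular its first edge. -/
lemma eq_one_of_fixes {g : G} {x y : V} (hx : g • x = x) (hy : g • y = y) (hxy : x ≠ y) :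
    g = 1 := by
  obtain ⟨w, hw, hyw⟩ := exists_side h.isTree hxy.symm
  have h1 := (h.smul_mem_side g).2 hyw
  rw [hx, hy] at h1
  have hw' := h.smul g _ _ hw
  rw [hx] at hw'
  exact h.free g x w hw hx (side_unique h.isTree hw' hw h1 hyw)

/-- If `g` puts `x` and `y` on different sides of `P`, it carries some edge of the path from `x` to
`y` into the finite coboundary; as edge stabilizers are trivial, an oriented edge is carried to a
given one by at most one element. -/
lemma finite_coboundary_orbit {P : Set V} (hP : (coboundary Γ P).Finite) (x y : V) :
    {g : G | g • x ∈ P ∧ g • y ∉ P}.Finite := by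
  obtain ⟨p⟩ := h.isTree.1.preconnected x y
  induction p with
  | nil => convert Set.finite_empty (α := G); ext; simp
  | @cons x z y hxz p ih =>
    have h1 : {g : G | g • x ∈ P ∧ g • z ∉ P}.Finite := by
      refine Set.Finite.of_finite_image (f := fun g => (g • x, g • z)) (hP.subset ?_) ?_
      · rintro _ ⟨g, hg, rfl⟩
        exact ⟨h.smul g _ _ hxz, hg.1, hg.2⟩
      · intro g _ g' _ hgg
        simp only [Prod.mk.injEq] at hgg
        have := h.free (g'⁻¹ * g) x z hxz (by rw [mul_smul, hgg.1, inv_smul_smul])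
          (by rw [mul_smul, hgg.2, inv_smul_smul])
        rw [inv_mul_eq_one] at this
        exact this.symm
    refine (h1.union ih).subset ?_
    rintro g ⟨h1, h2⟩
    by_cases hz : g • z ∈ P
    · exact .inr ⟨hz, h2⟩
    · exact .inl ⟨h1, hz⟩

/-- Two elliptic elements with different fixed vertices have a product without fixed vertex. -/
lemma mul_smul_ne {a b : G} {p q z : V} (ha : a ≠ 1) (hb : b ≠ 1) (hap : a • p = p)
    (hbq : b • q = q) (hpq : p ≠ q) : (a * b) • z ≠ z := by
  have hT := h.isTree
  obtain ⟨w, hw, hqw⟩ := exists_side hT hpq.symm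
  obtain ⟨w', hw', hpw'⟩ := exists_side hT hpq
  -- Ping-pong: for `z` outside the direction of `q` at `p`, applying `b` and then `a` raises the
  -- distance to `p` by twice the distance between `p` and `q`. The remaining `z` are treated by
  -- passing to `b • z` and the inverse elements.
  have key : ∀ {a b : G}, b ≠ 1 → a • p = p → b • q = q → ∀ z, z ∉ side Γ p w →
      (a * b) • z ≠ z := by
    intro a b hb hap hbq z hz hfix
    have h1 := dist_eq_add_of_side hT hqw hz
    have h2 : z ∈ side Γ q w' := mem_side_of_mem_side hT hw hqw hpw' hz
    have h3 : b • z ∉ side Γ q w' := by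
      intro h3
      have h4 := (h.smul_mem_side b).2 h2
      rw [hbq] at h4
      have h5 := h.smul b _ _ hw'
      rw [hbq] at h5
      exact hb (h.free b q w' hw' hbq (side_unique hT h5 hw' h4 h3))
    have h4 := dist_eq_add_of_side hT hpw' h3
    have h5 := h.dist_smul b q z
    rw [hbq] at h5
    have h6 := h.dist_smul a p (b • z)
    rw [hap, ← mul_smul, hfix] at h6
    have h7 : Γ.dist p q ≠ 0 := fun h0 => hpq (hT.1.dist_eq_zero_iff.1 h0)
    have h8 := Γ.dist_comm (u := p) (v := q)
    omega
  by_cases hz : z ∈ side Γ p w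
  · intro hfix
    have h1 : b • z = a⁻¹ • z := by rw [eq_inv_smul_iff, ← mul_smul, hfix]
    have h2 : b • z ∉ side Γ p w := by
      rw [h1]
      intro h3
      have h4 := (h.smul_mem_side a).2 h3
      rw [smul_inv_smul, hap] at h4
      have h5 := h.smul a _ _ hw
      rw [hap] at h5
      exact ha (h.free a p w hw hap (side_unique hT h5 hw h4 hz))
    refine key (a := a⁻¹) (b := b⁻¹) (inv_ne_one.2 hb) ?_ ?_ (b • z) h2 ?_
    · rw [inv_smul_eq_iff, hap]
    · rw [inv_smul_eq_iff, hbq]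
    · rw [mul_smul, inv_smul_smul, h1]
  · exact key hb hap hbq z hz

/-- A group all of whose elements are elliptic fixes a vertex. -/
lemma exists_fixed (H : Subgroup G) (hH : ∀ a ∈ H, ∃ v : V, a • v = v) :
    ∃ v : V, ∀ a ∈ H, a • v = v := by
  obtain ⟨v₀⟩ := h.isTree.1.nonempty
  by_cases hbot : ∀ a ∈ H, a = 1
  · exact ⟨v₀, fun a ha => by rw [hbot a ha, one_smul]⟩
  push Not at hbot
  obtain ⟨a, ha, ha1⟩ := hbot
  -- A vertex fixed by one non-trivial element is fixed by all: an element fixing only other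
  -- vertices would have a product with `a` without fixed vertex.
  obtain ⟨p, hp⟩ := hH a ha
  refine ⟨p, fun b hb => ?_⟩
  by_cases hb1 : b = 1
  · rw [hb1, one_smul]
  obtain ⟨q, hq⟩ := hH b hb
  by_cases hpq : p = q
  · rw [hpq, hq]
  obtain ⟨z, hz⟩ := hH (a * b) (H.mul_mem ha hb)
  exact absurd hz (h.mul_smul_ne ha1 hb1 hp hq hpq)

/-! ### Axes -/

/-- Translates of a geodesic from `x` to `g • x` are concatenated, where `x` has minimal
displacement; minimality prevents backtracking at the joints. -/
lemma exists_axis {g : G} (hg : ∀ v : V, g • v ≠ v) :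
    ∃ (l : ℤ → V) (t : ℕ), 0 < t ∧ (∀ n, Γ.Adj (l n) (l (n + 1))) ∧ (∀ n, l n ≠ l (n + 2)) ∧
      ∀ n, g • l n = l (n + t) := by
  classical
  have hT := h.isTree
  have := hT.1.nonempty
  obtain ⟨x, hx⟩ : ∃ x : V, ∀ y : V, Γ.dist x (g • x) ≤ Γ.dist y (g • y) := by
    exact ⟨Function.argmin (fun y : V => Γ.dist y (g • y)),
      fun y => Function.argmin_le (fun y : V => Γ.dist y (g • y)) y⟩
  obtain ⟨p, hp, hlen⟩ := hT.1.exists_path_of_dist x (g • x)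
  set t := Γ.dist x (g • x) with ht
  have ht0 : 0 < t := by
    rcases Nat.eq_zero_or_pos t with h0 | h0
    · exact absurd (hT.1.dist_eq_zero_iff.1 h0).symm (hg x)
    · exact h0
  set s : ℕ → V := p.getVert with hs
  have s0 : s 0 = x := p.getVert_zero
  have st : s t = g • x := by rw [← hlen]; exact p.getVert_length
  have sadj : ∀ i < t, Γ.Adj (s i) (s (i + 1)) := fun i hi => p.adj_getVert_succ (by omega)
  have sinj : ∀ i j, i ≤ t → j ≤ t → s i = s j → i = j := fun i j hi hj hij =>
    hp.getVert_injOn (by simp; omega) (by simp; omega) hij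
  set l : ℤ → V := fun n => g ^ (n / t) • s (n % t).toNat with hl
  have hln : ∀ (q : ℤ) (i : ℕ), i ≤ t → l (q * t + i) = g ^ q • s i := by
    intro q i hi
    rcases Nat.lt_or_eq_of_le hi with hi | hi
    · have h1 : (q * t + i) / (t : ℤ) = q := by
        rw [add_comm, Int.add_mul_ediv_right _ _ (by omega), Int.ediv_eq_zero_of_lt (by omega)
          (by omega)]; simp
      have h2 : (q * t + i) % (t : ℤ) = i := by
        rw [add_comm, Int.add_mul_emod_self_right, Int.emod_eq_of_lt (by omega) (by omega)]
      simp only [hl, h1, h2, Int.toNat_natCast]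
    · subst hi
      have h1 : (q * t + t) / (t : ℤ) = q + 1 := by
        rw [show q * (t : ℤ) + t = (q + 1) * t by ring, Int.mul_ediv_cancel _ (by omega)]
      have h2 : (q * t + t) % (t : ℤ) = 0 := by
        rw [show q * (t : ℤ) + t = (q + 1) * t by ring, Int.mul_emod_left]
      simp only [hl, h1, h2, Int.toNat_zero, s0, st]
      rw [zpow_add_one, mul_smul]
  have hdec : ∀ n : ℤ, ∃ (q : ℤ) (i : ℕ), i < t ∧ n = q * t + i := by
    intro n
    refine ⟨n / t, (n % t).toNat, ?_, ?_⟩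
    · have := Int.emod_lt_of_pos n (show (0 : ℤ) < t by omega)
      have := Int.emod_nonneg n (show (t : ℤ) ≠ 0 by omega)
      omega
    · have := Int.emod_nonneg n (show (t : ℤ) ≠ 0 by omega)
      rw [Int.toNat_of_nonneg this, mul_comm]
      exact (Int.mul_ediv_add_emod n t).symm
  refine ⟨l, t, ht0, ?_, ?_, ?_⟩
  · intro n
    obtain ⟨q, i, hi, rfl⟩ := hdec n
    have e1 := hln q (i + 1) (by omega)
    push_cast at e1
    rw [hln q i hi.le, add_assoc, e1]
    exact h.smul _ _ _ (sadj i hi)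
  · intro n
    obtain ⟨q, i, hi, rfl⟩ := hdec n
    rw [hln q i hi.le]
    by_cases hi2 : i + 2 ≤ t
    · have e1 := hln q (i + 2) hi2
      push_cast at e1
      rw [add_assoc, e1]
      intro h1
      have := sinj _ _ hi.le hi2 (smul_left_cancel _ h1)
      omega
    -- At a joint: backtracking would give `s 1` a displacement of at most `t - 2`, or, if `t = 1`,
    -- would make `g` invert an edge.
    · have hit : i + 1 = t := by omega
      have e1 := hln (q + 1) 1 (by omega)
      rw [show (q : ℤ) * t + i + 2 = (q + 1) * t + (1 : ℕ) by rw [← hit]; push_cast; ring, e1,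
        zpow_add_one, mul_smul]
      intro h1
      have h2 := smul_left_cancel _ h1
      rcases Nat.lt_or_ge 1 t with h1t | h1t
      · have h3 := hx (s 1)
        rw [← h2] at h3
        have h4 : ∀ j, j + 1 ≤ t → Γ.dist (s 1) (s (1 + j)) ≤ j := by
          intro j
          induction j with
          | zero => simp
          | succ j ih =>
            intro hj
            refine (hT.1.dist_triangle (v := s (1 + j))).trans ?_
            have := ih (by omega)
            have h5 : Γ.dist (s (1 + j)) (s (1 + (j + 1))) = 1 :=
              dist_eq_one_iff_adj.2 (sadj (1 + j) (by omega))
            omega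
        have h5 := h4 (t - 2) (by omega)
        rw [show 1 + (t - 2) = i by omega] at h5
        omega
      · have : t = 1 := by omega
        have hi0 : i = 0 := by omega
        subst hi0
        rw [this] at st
        rw [s0, st] at h2
        have := sadj 0 (by omega)
        rw [s0, zero_add, st] at this
        exact h.no_inversion g _ _ this ⟨rfl, h2.symm⟩
  · intro n
    obtain ⟨q, i, hi, rfl⟩ := hdec n
    rw [hln q i hi.le, show q * (t : ℤ) + i + t = (q + 1) * t + i by ring, hln _ i hi.le, add_comm,
      zpow_add, zpow_one, mul_smul]

/-- The displacement of `x` under `g ^ n` is at most `n` times that under `g`, and it differs from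
`n * t` by at most twice the distance of `x` to `l 0`. Taking `n` large gives the bound. -/
lemma axis_le_dist {g : G} {l : ℤ → V} {t : ℕ} (hadj : ∀ n, Γ.Adj (l n) (l (n + 1)))
    (hl : ∀ n, l n ≠ l (n + 2)) (hg : ∀ n, g • l n = l (n + t)) (x : V) :
    t ≤ Γ.dist x (g • x) := by
  have hT := h.isTree
  have h1 : ∀ n : ℕ, Γ.dist x (g ^ n • x) ≤ n * Γ.dist x (g • x) := by
    intro n
    induction n with
    | zero => simp
    | succ n ih =>
      have h2 := h.dist_smul (g ^ n) x (g • x)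
      rw [← mul_smul, ← pow_succ] at h2
      calc _ ≤ _ := hT.1.dist_triangle (v := g ^ n • x)
        _ ≤ _ := by rw [h2]; linarith
  have h2 : ∀ n : ℕ, n * t ≤ n * Γ.dist x (g • x) + 2 * Γ.dist x (l 0) := by
    intro n
    have h3 := axis_zpow hg n 0
    rw [zpow_natCast] at h3
    have h4 := dist_of_locally_injective_int hT l hadj hl 0 (n * t)
    push_cast at h4
    rw [← h3] at h4
    have h5 := hT.1.dist_triangle (u := l 0) (v := x) (w := g ^ n • l 0)
    have h6 := hT.1.dist_triangle (u := x) (v := g ^ n • x) (w := g ^ n • l 0)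
    rw [h.dist_smul] at h6
    have h7 := h1 n
    rw [Γ.dist_comm (u := l 0) (v := x)] at h5
    omega
  by_contra hlt
  push Not at hlt
  have h3 := h2 (2 * Γ.dist x (l 0) + 1)
  nlinarith

lemma pow_ne_one {g : G} (hg : ∀ v : V, g • v ≠ v) {n : ℤ} (hn : n ≠ 0) : g ^ n ≠ 1 := by
  obtain ⟨l, t, ht, hadj, hl, hgl⟩ := h.exists_axis hg
  have key : ∀ k : ℕ, k ≠ 0 → g ^ (k : ℤ) ≠ 1 := by
    intro k hk h1
    have h2 := axis_zpow hgl k 0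
    rw [h1, one_smul] at h2
    have h3 := dist_of_locally_injective_int h.isTree l hadj hl 0 (k * t)
    push_cast at h3
    rw [← h2] at h3
    simp at h3
    omega
  rcases Int.natAbs_eq n with h1 | h1
  · rw [h1]; exact key _ (by omega)
  · rw [h1, zpow_neg, inv_ne_one]; exact key _ (by omega)

/-! ### Minimal trees -/

/-- Otherwise the vertices whose whole orbit misses the half-tree form a proper invariant subtree.
Connectedness: stepping from such a vertex towards `x` could only enter the half-tree along a
translate of its edge, and this would bring a translate of `x` along. -/
lemma exists_smul_mem_side (hmin : IsMinimalGTree G Γ) {p q : V} (hpq : Γ.Adj p q) (x : V) :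
    ∃ g : G, g • x ∈ side Γ p q := by
  by_contra! hx
  have hT := h.isTree
  set S : Set V := {y | ∀ g : G, g • y ∉ side Γ p q} with hS
  have hxS : x ∈ S := hx
  have hS1 : S = Set.univ := by
    refine hmin S (fun g v hv g' => by rw [← mul_smul]; exact hv _) ?_
    have key : ∀ (n : ℕ) (y : V) (hy : y ∈ S), Γ.dist x y = n →
        (Γ.induce S).Reachable ⟨x, hxS⟩ ⟨y, hy⟩ := by
      intro n
      induction n with
      | zero =>
        intro y hy h0
        have := hT.1.dist_eq_zero_iff.1 h0
        subst this
        rfl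
      | succ n ih =>
        intro y hy hn
        have hxy : x ≠ y := by rintro rfl; simp at hn
        obtain ⟨y', hy', hxy'⟩ := exists_side hT hxy
        have hd := dist_of_mem_side hT hy'.symm hxy'
        have hy'S : y' ∈ S := by
          intro g hg
          obtain ⟨h1, h2⟩ := cross_side hT hpq (h.smul g _ _ hy') (hy g) hg
          rw [← h1, ← h2] at hx
          exact hx g ((h.smul_mem_side g).2 hxy')
        refine (ih y' hy'S (by omega)).trans ?_
        exact SimpleGraph.Adj.reachable (by simpa using hy'.symm)
    have : Nonempty S := ⟨⟨x, hxS⟩⟩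
    exact ⟨fun a b => (key _ a.1 a.2 rfl).symm.trans (key _ b.1 b.2 rfl)⟩
  have hq : q ∈ S := hS1 ▸ Set.mem_univ q
  have := hq 1
  rw [one_smul] at this
  exact this (mem_side_self hpq.ne)

/-- Minimal trees have no leaves: if the half-tree were the single vertex `q`, an element moving `p`
into it would invert the edge. -/
lemma exists_adj_ne (hmin : IsMinimalGTree G Γ) {p q : V} (hpq : Γ.Adj p q) :
    ∃ z, Γ.Adj q z ∧ z ≠ p := by
  by_contra! hz
  have hT := h.isTree
  have hside : ∀ x ∈ side Γ p q, x = q := by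
    intro x hx
    by_contra hxq
    obtain ⟨w, hw, hxw⟩ := exists_side hT hxq
    rw [hz w hw] at hxw
    exact (not_mem_side_iff hT hpq).2 hxw hx
  obtain ⟨g, hg⟩ := h.exists_smul_mem_side hmin hpq p
  have h1 := hside _ hg
  have h2 := h.smul g _ _ hpq
  rw [h1] at h2
  exact h.no_inversion g p q hpq ⟨h1, hz _ h2⟩

/-- There is no orbit point in the half-tree that is farthest from `p`: behind it starts another
half-tree, which again contains an orbit point. -/
lemma infinite_orbit_inter_side (hmin : IsMinimalGTree G Γ) {p q : V} (hpq : Γ.Adj p q) (x : V) :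
    {y | y ∈ side Γ p q ∧ ∃ g : G, g • x = y}.Infinite := by
  have hT := h.isTree
  intro hfin
  obtain ⟨g, hg⟩ := h.exists_smul_mem_side hmin hpq x
  obtain ⟨y, ⟨hy, g', rfl⟩, hmax⟩ := hfin.exists_maximalFor (fun y => Γ.dist p y) _
    ⟨g • x, hg, g, rfl⟩
  have hpy : p ≠ g' • x := by intro h0; rw [← h0] at hy; exact not_mem_side _ _ hy
  obtain ⟨y', hy', hpy'⟩ := exists_side hT hpy
  obtain ⟨z, hz, hzy⟩ := h.exists_adj_ne hmin hy'.symm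
  have hpz : p ∉ side Γ (g' • x) z := fun h0 => hzy (side_unique hT hz hy' h0 hpy')
  obtain ⟨g'', hg''⟩ := h.exists_smul_mem_side hmin hz x
  have h1 := dist_lt_of_side hT hpz hg''
  have h2 := hmax ⟨side_subset hz hy hpz hg'', g'', rfl⟩ h1.le
  simp only at h2
  omega

end IsFreeGTree

end Grushko

namespace Grushko

open SimpleGraph

/-! ### Separating vertex sets and their transport between trees -/

section Separation

/-- A set of vertices with finite coboundary that separates the boundary of the tree, but not the
two ends of any line of the periodic line collection. -/
structure Separates {G : Type*} [Group G] {V : Type*} [MulAction G V] (Γ : SimpleGraph V) {m : ℕ}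
    (g : Fin m → G) (P : Set V) : Prop where
  infinite : P.Infinite
  infinite_compl : Pᶜ.Infinite
  finite_coboundary : (coboundary Γ P).Finite
  lines : ∀ (a : G) (j : Fin m) (x : V), {n : ℤ | (a * g j * a⁻¹) ^ n • x ∈ P}.Finite ∨
    {n : ℤ | (a * g j * a⁻¹) ^ n • x ∉ P}.Finite

lemma Separates.compl {G : Type*} [Group G] {V : Type*} [MulAction G V] {Γ : SimpleGraph V} {m : ℕ}
    {g : Fin m → G} {P : Set V} (h : Separates Γ g P) : Separates Γ g Pᶜ where
  infinite := h.infinite_compl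
  infinite_compl := by rw [compl_compl]; exact h.infinite
  finite_coboundary := coboundary_compl h.finite_coboundary
  lines a j x := by
    have := h.lines a j x
    simp only [Set.mem_compl_iff, not_not]
    exact this.symm

/-- Take a vertex of `P` off the finitely many paths that join a base vertex to coboundary edges.
The half-tree beyond it contains no initial vertex of a coboundary edge. -/
lemma exists_side_subset {V : Type*} {Γ : SimpleGraph V} (hT : Γ.IsTree) {P : Set V}
    (hP : P.Infinite) (hc : (coboundary Γ P).Finite) : ∃ p q, Γ.Adj p q ∧ side Γ p q ⊆ P := by
  classical
  obtain ⟨x₀⟩ := hT.1.nonempty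
  choose w hw using fun x => (hT.existsUnique_path x₀ x).exists
  have hF : ({x₀} ∪ ⋃ e ∈ coboundary Γ P, {y | y ∈ (w e.1).support}).Finite :=
    (Set.finite_singleton x₀).union (hc.biUnion fun e _ => List.finite_toSet _)
  obtain ⟨y, hyP, hyF⟩ := hP.exists_notMem_finite hF
  simp only [Set.mem_union, Set.mem_singleton_iff, Set.mem_iUnion, not_or, not_exists] at hyF
  obtain ⟨y', hy', hx₀⟩ := exists_side hT (Ne.symm hyF.1)
  refine ⟨y', y, hy'.symm, ?_⟩
  rintro z ⟨p, hp⟩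
  by_contra hz
  obtain ⟨d, hd, h1, h2⟩ := p.exists_boundary_dart P hyP hz
  have hd1 := p.dart_fst_mem_support_of_mem_darts hd
  have h3 : d.fst ∈ side Γ y' y :=
    ⟨p.takeUntil _ hd1, fun h => hp (p.support_takeUntil_subset_support hd1 h)⟩
  obtain ⟨d', hd', h4, h5⟩ := (w d.fst).exists_boundary_dart (side Γ y y') hx₀
    (fun h => (not_mem_side_iff hT hy').2 h3 h)
  have h6 := cross_side hT hy' d'.adj.symm h5 h4
  refine hyF.2 (d.fst, d.snd) ⟨d.adj, h1, h2⟩ ?_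
  have := (w d.fst).dart_snd_mem_support_of_mem_darts hd'
  rwa [h6.1] at this

variable {G : Type*} [Group G] {V W : Type*} [MulAction G V] [MulAction G W]
variable {Γ : SimpleGraph V} {Γ' : SimpleGraph W} {m : ℕ} {g : Fin m → G}

/-- The preimage is infinite because `P` contains a half-tree, and half-trees of a minimal tree
contain infinitely many points of each orbit. Its coboundary is finite by `finite_coboundary_orbit`,
applied to the images of finitely many edge representatives. -/
lemma Separates.comap (h : IsFreeGTree G Γ) (h' : IsFreeGTree G Γ') (hmin : IsMinimalGTree G Γ')
    (f : V → W) (hf : ∀ (a : G) v, f (a • v) = a • f v) {P : Set W} (hP : Separates Γ' g P) :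
    Separates Γ g (f ⁻¹' P) := by
  obtain ⟨v₀⟩ := h.isTree.1.nonempty
  have inf : ∀ {P : Set W}, Separates Γ' g P → (f ⁻¹' P).Infinite := by
    intro P hP hfin
    obtain ⟨p, q, hpq, hsub⟩ := exists_side_subset h'.isTree hP.infinite hP.finite_coboundary
    refine h'.infinite_orbit_inter_side hmin hpq (f v₀) ((hfin.image f).subset ?_)
    rintro _ ⟨hy, a, rfl⟩
    exact ⟨a • v₀, by rw [Set.mem_preimage, hf]; exact hsub hy, hf _ _⟩
  refine ⟨inf hP, inf hP.compl, ?_, fun a j x => ?_⟩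
  · obtain ⟨F, hF, hF'⟩ := h.finite_edges
    have hfin : (⋃ e ∈ F, (fun a : G => (a • e.1, a • e.2)) ''
        {a : G | a • f e.1 ∈ P ∧ a • f e.2 ∉ P}).Finite :=
      hF.biUnion fun e _ => (h'.finite_coboundary_orbit hP.finite_coboundary _ _).image _
    refine hfin.subset ?_
    rintro ⟨x, y⟩ ⟨hxy, hx, hy⟩
    obtain ⟨a, ha⟩ := hF' x y hxy
    simp only [Set.mem_iUnion]
    refine ⟨_, ha, a⁻¹, ⟨?_, ?_⟩, by simp⟩
    · simpa [← hf] using hx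
    · simpa [← hf] using hy
  · have := hP.lines a j (f x)
    simpa only [Set.mem_preimage, hf] using this

/-- The two sets of exponents for `x` and `y` differ by finitely many elements, so the condition on
lines needs to be checked at one vertex only. -/
lemma IsFreeGTree.lines_of_one (h : IsFreeGTree G Γ) {P : Set V} (hc : (coboundary Γ P).Finite)
    {b : G} (hb : ∀ n : ℤ, n ≠ 0 → b ^ n ≠ 1) (y : V)
    (hy : {n : ℤ | b ^ n • y ∈ P}.Finite ∨ {n : ℤ | b ^ n • y ∉ P}.Finite) (x : V) :
    {n : ℤ | b ^ n • x ∈ P}.Finite ∨ {n : ℤ | b ^ n • x ∉ P}.Finite := by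
  have hinj : Function.Injective fun n : ℤ => b ^ n := by
    intro n n' hn
    by_contra hne
    refine hb (n - n') (sub_ne_zero.2 hne) ?_
    rw [zpow_sub]
    simp only at hn
    rw [hn, mul_inv_cancel]
  have h1 := (h.finite_coboundary_orbit hc x y).preimage (f := fun n : ℤ => b ^ n) hinj.injOn
  have h2 := (h.finite_coboundary_orbit hc y x).preimage (f := fun n : ℤ => b ^ n) hinj.injOn
  simp only [Set.preimage_ofPred_eq] at h1 h2
  rcases hy with hy | hy
  · left
    refine (hy.union h1).subset fun n hn => ?_
    by_cases hm : b ^ n • y ∈ P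
    · exact .inl hm
    · exact .inr ⟨hn, hm⟩
  · right
    refine (hy.union h2).subset fun n hn => ?_
    by_cases hm : b ^ n • y ∈ P
    · exact .inr ⟨hm, hn⟩
    · exact .inl hm

/-- An elliptic element has a constant orbit at its fixed vertex, which lies entirely on one side of
the edge. -/
lemma IsFreeGTree.separates_side (h : IsFreeGTree G Γ) (hmin : IsMinimalGTree G Γ)
    {p q : V} (hpq : Γ.Adj p q) (hg : ∀ j, ∃ v : V, g j • v = v)
    (hg' : ∀ j (n : ℤ), n ≠ 0 → g j ^ n ≠ 1) : Separates Γ g (side Γ p q) := by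
  have hT := h.isTree
  have hc := coboundary_side hT hpq
  refine ⟨fun hf => ?_, fun hf => ?_, hc, fun a j x => ?_⟩
  · exact h.infinite_orbit_inter_side hmin hpq p (hf.subset fun y hy => hy.1)
  · refine h.infinite_orbit_inter_side hmin hpq.symm p (hf.subset fun y hy => ?_)
    exact (not_mem_side_iff hT hpq).2 hy.1
  · obtain ⟨s, hs⟩ := hg j
    set b := a * g j * a⁻¹ with hb
    have hbs : ∀ n : ℤ, b ^ n • (a • s) = a • s := by
      intro n
      have h1 : b ∈ MulAction.stabilizer G (a • s) := by
        rw [MulAction.mem_stabilizer_iff, hb, mul_smul, inv_smul_smul, mul_smul, hs]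
      exact Subgroup.zpow_mem _ h1 n
    refine h.lines_of_one hc (fun n hn h1 => hg' j n hn ?_) (a • s) ?_ x
    · rw [hb, conj_zpow] at h1
      simpa using h1
    · simp only [hbs]
      by_cases hm : a • s ∈ side Γ p q
      · right; simp [hm]
      · left; simp [hm]

/-- Equivariant maps exist when each stabilizer fixes a point of the target. -/
lemma exists_equivariant (hfix : ∀ v : V, ∃ w : W, ∀ a : G, a • v = v → a • w = w) :
    ∃ f : V → W, ∀ (a : G) v, f (a • v) = a • f v := by
  choose φ hφ using hfix
  -- The map is prescribed on orbit representatives. The choice of `γ v` does not matter, as two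
  -- choices differ by an element fixing `rep v`, hence also `φ (rep v)`.
  let rep : V → V := fun v => Quotient.out (s := MulAction.orbitRel G V) ⟦v⟧
  have hrep : ∀ v, ∃ a : G, a • rep v = v := fun v => by
    have := Quotient.exact (s := MulAction.orbitRel G V) (Quotient.out_eq _ : ⟦rep v⟧ = ⟦v⟧)
    obtain ⟨a, ha⟩ := MulAction.orbitRel_apply.1 this
    exact ⟨a⁻¹, inv_smul_eq_iff.2 ha.symm⟩
  choose γ hγ using hrep
  refine ⟨fun v => γ v • φ (rep v), fun a v => ?_⟩
  have h1 : rep (a • v) = rep v := by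
    have : (Quotient.mk (MulAction.orbitRel G V) (a • v)) = Quotient.mk _ v :=
      Quotient.sound (MulAction.orbitRel_apply.2 ⟨a, rfl⟩)
    exact congrArg (Quotient.out (s := MulAction.orbitRel G V)) this
  simp only [h1]
  have h2 := hγ (a • v)
  rw [h1] at h2
  have h3 := hφ (rep v) ((a * γ v)⁻¹ * γ (a • v)) (by
    rw [mul_smul, h2, inv_smul_eq_iff, mul_smul, hγ])
  rw [mul_smul, inv_smul_eq_iff] at h3
  rw [h3, mul_smul]

end Separation

namespace GATree

variable {G : Type u} [Group G] {k : ℕ} {A : Fin k → Subgroup G}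

lemma isFreeGTree (T : GATree A) (hT : T.TrivialEdgeStabilizers) : IsFreeGTree G T.graph where
  isTree := T.isTree
  smul := T.adj_smul
  free := hT
  no_inversion := T.no_inversion
  finite_vertices := T.finite_vertices
  finite_edges := T.finite_edges

lemma isMinimalGTree (T : GATree A) : IsMinimalGTree G T.graph := T.minimal

lemma isElliptic_of_isPeripheral (S : GATree A) {a : G} (ha : IsPeripheral A a) :
    S.IsElliptic a := by
  rcases ha with rfl | ⟨H, hH, haH⟩
  · obtain ⟨v⟩ := S.isTree.1.nonempty
    exact ⟨v, one_smul _ _⟩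
  · obtain ⟨v, hv⟩ := S.peripheral_fixes H hH
    exact ⟨v, hv a haH⟩

/-- Vertex stabilizers of a Grushko tree consist of peripheral elements. These are elliptic in `S`,
so each stabilizer has a common fixed vertex there. -/
lemma IsGrushko.exists_equivariant {T : GATree A} (hT : T.IsGrushko) (S : GATree A)
    (hS : S.TrivialEdgeStabilizers) : ∃ f : T.V → S.V, ∀ (a : G) v, f (a • v) = a • f v := by
  refine Grushko.exists_equivariant fun v => ?_
  exact (S.isFreeGTree hS).exists_fixed (MulAction.stabilizer G v)
    fun a ha => S.isElliptic_of_isPeripheral (hT.elliptic a ⟨v, ha⟩)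

lemma IsGrushko.smul_ne {T : GATree A} (hT : T.IsGrushko) {a : G} (ha : ¬ IsPeripheral A a)
    (v : T.V) : a • v ≠ v := fun h => ha (hT.elliptic a ⟨v, h⟩)

/-- If the generators are elliptic in a free splitting, their lines are separated in every Grushko
tree. -/
lemma IsGrushko.exists_separates {T S : GATree A} (hT : T.IsGrushko) (hS : S.IsFreeSplitting)
    {m : ℕ} {g : Fin m → G} (hg : ∀ j, ¬ IsPeripheral A (g j)) (hgS : ∀ j, S.IsElliptic (g j)) :
    ∃ P, Separates T.graph g P := by
  obtain ⟨f, hf⟩ := hT.exists_equivariant S hS.edges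
  obtain ⟨p, q, hpq⟩ := hS.nontrivial
  have h := T.isFreeGTree hT.edges
  exact ⟨_, Separates.comap h (S.isFreeGTree hS.edges) S.isMinimalGTree f hf
    ((S.isFreeGTree hS.edges).separates_side S.isMinimalGTree hpq hgS
      fun j n hn => h.pow_ne_one (hT.smul_ne (hg j)) hn)⟩

lemma IsGrushko.exists_separates_of_separates {T T' : GATree A} (hT : T.IsGrushko)
    (hT' : T'.IsGrushko) {m : ℕ} {g : Fin m → G} {P : Set T'.V} (hP : Separates T'.graph g P) :
    ∃ P, Separates T.graph g P := by
  obtain ⟨f, hf⟩ := hT.exists_equivariant T' hT'.edges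
  exact ⟨_, Separates.comap (T.isFreeGTree hT.edges) (T'.isFreeGTree hT'.edges) T'.isMinimalGTree
    f hf hP⟩

end GATree

end Grushko

namespace Grushko

open SimpleGraph Filter

/-! ### A separating set disconnects the decomposition space -/

section Rays

variable {V : Type*} {Γ : SimpleGraph V}

/-- Rays are built edge by edge. -/
lemma exists_ray {R : V → V → Prop}
    (hR : ∀ a b, Γ.Adj a b → R a b → ∃ c, Γ.Adj b c ∧ c ≠ a ∧ R b c) {a b : V} (hab : Γ.Adj a b)
    (h : R a b) : ∃ r : ℕ → V, r 0 = a ∧ r 1 = b ∧ (∀ n, Γ.Adj (r n) (r (n + 1))) ∧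
      (∀ n, r n ≠ r (n + 2)) ∧ ∀ n, R (r n) (r (n + 1)) := by
  choose f hf1 hf2 hf3 using hR
  let next : {e : V × V // Γ.Adj e.1 e.2 ∧ R e.1 e.2} → {e : V × V // Γ.Adj e.1 e.2 ∧ R e.1 e.2} :=
    fun e => ⟨(e.1.2, f e.1.1 e.1.2 e.2.1 e.2.2), hf1 _ _ _ _, hf3 _ _ _ _⟩
  let s : ℕ → {e : V × V // Γ.Adj e.1 e.2 ∧ R e.1 e.2} := fun n => next^[n] ⟨(a, b), hab, h⟩
  have hs : ∀ n, s (n + 1) = next (s n) := fun n => Function.iterate_succ_apply' _ _ _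
  have hs1 : ∀ n, (s (n + 1)).1.1 = (s n).1.2 := fun n => by rw [hs]
  refine ⟨fun n => (s n).1.1, rfl, hs1 0, fun n => ?_, fun n => ?_, fun n => ?_⟩
  · simp only [hs1]; exact (s n).2.1
  · have h1 := hf2 (s n).1.1 (s n).1.2 (s n).2.1 (s n).2.2
    simp only [hs1]
    rw [hs]
    exact h1.symm
  · simp only [hs1]; exact (s n).2.2

lemma injective_of_locally_injective (hT : Γ.IsTree) (r : ℕ → V)
    (hr : ∀ n, Γ.Adj (r n) (r (n + 1))) (h2 : ∀ n, r n ≠ r (n + 2)) : Function.Injective r := by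
  have key : ∀ m k : ℕ, r m = r (m + k) → k = 0 := by
    intro m k h
    have := dist_of_locally_injective hT (fun i => r (m + i)) (fun i => hr (m + i))
      (fun i => h2 (m + i)) k
    simp only [add_zero, ← h, dist_self] at this
    exact this.symm
  intro m n h
  rcases le_total m n with hmn | hmn
  · obtain ⟨k, rfl⟩ := Nat.exists_eq_add_of_le hmn
    rw [key m k h, add_zero]
  · obtain ⟨k, rfl⟩ := Nat.exists_eq_add_of_le hmn
    rw [key n k h.symm, add_zero]

/-- Two vertices on the same side of all edges of the coboundary. -/
lemma mem_of_same_sides (hT : Γ.IsTree) {P : Set V} {p : V} (hp : p ∈ P) (z : V)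
    (h : ∀ e ∈ coboundary Γ P, (p ∈ side Γ e.1 e.2 ↔ z ∈ side Γ e.1 e.2)) : z ∈ P := by
  obtain ⟨n, hn⟩ : ∃ n, Γ.dist p z = n := ⟨_, rfl⟩
  induction n generalizing z with
  | zero => rwa [← hT.1.dist_eq_zero_iff.1 hn]
  | succ n ih =>
    have hpz : p ≠ z := by rintro rfl; simp at hn
    obtain ⟨z', hz', hpz'⟩ := exists_side hT hpz
    have hd := dist_of_mem_side hT hz'.symm hpz'
    have hz'P : z' ∈ P := by
      refine ih z' (fun e he => ?_) (by omega)
      rw [h e he]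
      by_contra hc
      have h3 : (z' = e.1 ∧ z = e.2) ∨ (z = e.1 ∧ z' = e.2) := by
        by_cases hz : z ∈ side Γ e.1 e.2
        · left; exact cross_side hT he.1 hz'.symm (by tauto) hz
        · right; exact cross_side hT he.1 hz' hz (by tauto)
      have h1 := h e he
      rcases h3 with ⟨h3, h4⟩ | ⟨h3, h4⟩
      · rw [← h3, ← h4] at h1
        exact (not_mem_side_iff hT hz').2 (h1.2 (mem_side_self hz'.ne')) hpz'
      · rw [← h3, ← h4] at h1
        exact not_mem_side _ _ (h1.1 hpz')
    by_contra hz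
    have h1 := h (z', z) ⟨hz'.symm, hz'P, hz⟩
    exact (not_mem_side_iff hT hz').2 (h1.2 (mem_side_self hz'.ne')) hpz'

/-- The ray finally stays on one side of each of the finitely many coboundary edges, and these sides
decide membership in `P`. -/
lemma ray_eventually_const (hT : Γ.IsTree) {P : Set V} (hP : (coboundary Γ P).Finite) {r : ℕ → V}
    (hr : Function.Injective r) (ha : ∀ n, Γ.Adj (r n) (r (n + 1))) :
    (∀ᶠ n in atTop, r n ∈ P) ∨ (∀ᶠ n in atTop, r n ∉ P) := by
  have h2 : ∀ n, r n ≠ r (n + 2) := fun n h => by have := hr h; omega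
  have h1 : ∀ e ∈ coboundary Γ P, ∃ c : Prop, ∀ᶠ n in atTop, (r n ∈ side Γ e.1 e.2 ↔ c) := by
    intro e he
    rcases ray_eventually_side hT r ha h2 he.1 with h | h
    · exact ⟨True, h.mono fun n hn => by simp [hn]⟩
    · exact ⟨False, h.mono fun n hn => by simp [hn]⟩
  choose! c hc using h1
  have h3 := (Set.Finite.eventually_all hP).2 hc
  obtain ⟨n₀, hn₀⟩ := h3.exists
  by_cases h4 : r n₀ ∈ P
  · left
    filter_upwards [h3] with n hn
    exact mem_of_same_sides hT h4 _ fun e he => by rw [hn₀ e he, hn e he]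
  · right
    filter_upwards [h3] with n hn h5
    exact h4 (mem_of_same_sides hT h5 _ fun e he => by rw [hn₀ e he, hn e he])

end Rays

namespace GATree

variable {G : Type u} [Group G] {k : ℕ} {A : Fin k → Subgroup G} {T : GATree A}

lemma Ray.ne_add_two (r : T.Ray) (n : ℕ) : r.pt n ≠ r.pt (n + 2) := fun h => by
  have := r.inj h; omega

/-- The filter of sets of vertices that contain the given boundary point. -/
noncomputable def Boundary.filter (x : T.Boundary) : Filter T.V :=
  Sum.elim (fun v => pure v.1) (Quotient.lift (fun r : T.Ray => map r.pt atTop) (by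
    rintro r s ⟨m, n, h⟩
    have e : ∀ (r : T.Ray) (m : ℕ), map r.pt atTop = map (fun i => r.pt (m + i)) atTop := by
      intro r m
      conv_lhs => rw [← map_add_atTop_eq_nat m, Filter.map_map]
      congr 1
      ext i
      simp [add_comm]
    simp only [e r m, e s n, h])) x

@[simp] lemma eventually_inl {v : {v : T.V // MulAction.stabilizer G v ≠ ⊥}} {Q : T.V → Prop} :
    (∀ᶠ y in Boundary.filter (T := T) (Sum.inl v), Q y) ↔ Q v.1 := eventually_pure

@[simp] lemma eventually_inr {r : T.Ray} {Q : T.V → Prop} :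
    (∀ᶠ y in Boundary.filter (T := T) (Sum.inr r.limit), Q y) ↔ ∀ᶠ n in atTop, Q (r.pt n) :=
  eventually_map

lemma Boundary.cases {motive : T.Boundary → Prop} (inl : ∀ v, motive (Sum.inl v))
    (inr : ∀ r : T.Ray, motive (Sum.inr r.limit)) (x : T.Boundary) : motive x := by
  rcases x with v | ξ
  · exact inl v
  · induction ξ using Quotient.inductionOn with
    | h r => exact inr r

instance Boundary.filter_neBot (x : T.Boundary) : x.filter.NeBot := by
  induction x using Boundary.cases with
  | inl v => exact pure_neBot
  | inr r => exact map_neBot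

lemma mem_boundaryDirection {v w : T.V} {x : T.Boundary} :
    x ∈ T.boundaryDirection v w ↔ ∀ᶠ y in x.filter, y ∈ side T.graph v w := by
  induction x using Boundary.cases with
  | inl u =>
    rw [eventually_inl]
    constructor
    · rintro (⟨y, hy, hy'⟩ | ⟨r, hr, -⟩)
      · rw [Sum.inl.inj hy]; exact hy'
      · exact absurd hr (by simp)
    · intro h
      exact .inl ⟨u, rfl, h⟩
  | inr r =>
    constructor
    · rintro (⟨y, hy, -⟩ | ⟨s, hs, hs'⟩)
      · exact absurd hy (by simp)
      · rw [hs, eventually_inr]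
        exact Eventually.of_forall hs'
    · rw [eventually_inr]
      intro h
      -- A tail of the ray lies entirely in the direction and represents the same end.
      obtain ⟨m, hm⟩ := eventually_atTop.1 h
      refine .inr ⟨⟨fun n => r.pt (m + n), fun n => r.adj (m + n), fun i j hij => by
        have := r.inj hij; omega⟩, ?_, fun n => hm _ (by omega)⟩
      congr 1
      exact Quotient.sound ⟨m, 0, fun i => by simp⟩

lemma eventually_const (x : T.Boundary) {P : Set T.V} (hP : (coboundary T.graph P).Finite) :
    (∀ᶠ y in x.filter, y ∈ P) ∨ (∀ᶠ y in x.filter, y ∉ P) := by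
  induction x using Boundary.cases with
  | inl v => simp only [eventually_inl]; exact em _
  | inr r => simp only [eventually_inr]; exact ray_eventually_const T.isTree hP r.inj r.adj

lemma isOpen_side {v w : T.V} (hvw : T.graph.Adj v w) :
    IsOpen {x : T.Boundary | ∀ᶠ y in x.filter, y ∈ side T.graph v w} := by
  refine TopologicalSpace.isOpen_generateFrom_of_mem ⟨v, w, hvw, ?_⟩
  ext x
  exact (mem_boundaryDirection).symm

/-- Near a boundary point the sides of the finitely many coboundary edges are constant, so
membership in `P` is locally constant. -/
lemma isOpen_of_coboundary {P : Set T.V} (hP : (coboundary T.graph P).Finite) :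
    IsOpen {x : T.Boundary | ∀ᶠ y in x.filter, y ∈ P} := by
  rw [isOpen_iff_forall_mem_open]
  intro x hx
  have h1 : ∀ e ∈ coboundary T.graph P, ∃ U : Set T.Boundary, IsOpen U ∧ x ∈ U ∧ ∃ c : Prop,
      ∀ z ∈ U, ∀ᶠ y in z.filter, (y ∈ side T.graph e.1 e.2 ↔ c) := by
    intro e he
    rcases eventually_const x (coboundary_side T.isTree he.1) with h | h
    · exact ⟨_, isOpen_side he.1, h, True, fun z hz => hz.mono fun y hy => by simp [hy]⟩
    · simp only [not_mem_side_iff T.isTree he.1] at h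
      refine ⟨_, isOpen_side he.1.symm, h, False, fun z hz => hz.mono fun y hy => ?_⟩
      simpa using (not_mem_side_iff T.isTree he.1).2 hy
  choose! U hU hxU c hc using h1
  refine ⟨⋂ e ∈ coboundary T.graph P, U e, fun z hz => ?_, hP.isOpen_biInter hU,
    Set.mem_iInter₂.2 hxU⟩
  simp only [Set.mem_iInter₂] at hz
  have h2 := (Set.Finite.eventually_all hP).2 fun e he => hc e he x (hxU e he)
  have h3 := (Set.Finite.eventually_all hP).2 fun e he => hc e he z (hz e he)
  obtain ⟨p, hp, hp'⟩ := (h2.and hx).exists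
  exact h3.mono fun y hy => mem_of_same_sides T.isTree hp' _ fun e he => by rw [hp e he, hy e he]

/-- `P` contains a half-tree, and in the absence of leaves a ray can be continued inside it. -/
lemma exists_eventually {P : Set T.V} (hT : T.TrivialEdgeStabilizers) (hP : P.Infinite)
    (hc : (coboundary T.graph P).Finite) : ∃ x : T.Boundary, ∀ᶠ y in x.filter, y ∈ P := by
  have h := T.isFreeGTree hT
  obtain ⟨p, q, hpq, hsub⟩ := exists_side_subset T.isTree hP hc
  obtain ⟨r, r0, r1, hr, h2, -⟩ := exists_ray (Γ := T.graph) (R := fun _ _ => True)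
    (fun a b hab _ => by
      obtain ⟨z, hz, hz'⟩ := h.exists_adj_ne T.isMinimalGTree hab
      exact ⟨z, hz, hz', trivial⟩) hpq trivial
  have hinj := injective_of_locally_injective T.isTree r hr h2
  refine ⟨Sum.inr (Ray.limit ⟨r, hr, hinj⟩), ?_⟩
  rw [eventually_inr]
  refine eventually_atTop.2 ⟨1, fun n hn => hsub ?_⟩
  change r n ∈ _
  induction n, hn using Nat.le_induction with
  | base => rw [r1]; exact mem_side_self hpq.ne
  | succ n hn ih =>
    refine side_adj (hr n) ih fun h0 => ?_
    rw [← r0] at h0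
    have := hinj h0
    omega

/-- A separating set of vertices disconnects the decomposition space. -/
theorem not_connectedSpace_of_separates (hT : T.TrivialEdgeStabilizers) {m : ℕ} {g : Fin m → G}
    {P : Set T.V} (hP : Separates T.graph g P) : ¬ ConnectedSpace (T.DecompositionSpace g) := by
  intro hconn
  have hsat : ∀ x y : T.Boundary, T.lineRel g x y →
      ((∀ᶠ z in x.filter, z ∈ P) ↔ ∀ᶠ z in y.filter, z ∈ P) := by
    -- A line with its negative end in `P` and its positive end outside would have infinitely many
    -- orbit points of both kinds, against the condition on lines.
    have key : ∀ {P : Set T.V}, Separates T.graph g P → ∀ (a : G) (j : Fin m) (l : T.Line),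
        T.IsAxis (a * g j * a⁻¹) l → (∀ᶠ n in atTop, l.negRay.pt n ∈ P) →
        (∀ᶠ n in atTop, l.posRay.pt n ∉ P) → False := by
      intro P hP a j l ⟨t, ht, hl⟩ hn hp
      obtain ⟨N, hN⟩ := eventually_atTop.1 (hn.and hp)
      have hz : ∀ k : ℤ, (a * g j * a⁻¹) ^ k • l.pt 0 = l.pt (k * t) := fun k => by
        rw [axis_zpow hl, zero_add]
      rcases hP.lines a j (l.pt 0) with hf | hf
      · refine Set.infinite_of_injective_forall_mem (f := fun n : ℕ => -((N + n : ℕ) : ℤ))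
          (fun i i' hi => by simp only at hi; omega) (fun n => ?_) hf
        have h1 := (hN ((N + n) * t) (by nlinarith)).1
        simp only [Set.mem_ofPred_eq, hz]
        change l.pt (-(((N + n) * t : ℕ) : ℤ)) ∈ P at h1
        convert h1 using 2
        push_cast; ring
      · refine Set.infinite_of_injective_forall_mem (f := fun n : ℕ => ((N + n : ℕ) : ℤ))
          (fun i i' hi => by simp only at hi; omega) (fun n => ?_) hf
        have h1 := (hN ((N + n) * t) (by nlinarith)).2
        simp only [Set.mem_ofPred_eq, hz]
        change l.pt (((N + n) * t : ℕ) : ℤ) ∉ P at h1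
        rwa [Nat.cast_mul] at h1
    rintro x y ⟨a, j, l, hl, rfl, rfl⟩
    rw [eventually_inr, eventually_inr]
    have h1 := ray_eventually_const T.isTree hP.finite_coboundary l.negRay.inj l.negRay.adj
    have h2 := ray_eventually_const T.isTree hP.finite_coboundary l.posRay.inj l.posRay.adj
    rcases h1 with h1 | h1 <;> rcases h2 with h2 | h2
    · exact iff_of_true h1 h2
    · exact (key hP a j l hl h1 h2).elim
    · exact (key hP.compl a j l hl h1 (by simpa using h2)).elim
    · refine iff_of_false (fun h => ?_) (fun h => ?_)
      · obtain ⟨n, h3, h4⟩ := (h.and h1).exists; exact h4 h3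
      · obtain ⟨n, h3, h4⟩ := (h.and h2).exists; exact h4 h3
  let B : Set (T.DecompositionSpace g) :=
    {q | Quot.lift (fun x : T.Boundary => ∀ᶠ z in x.filter, z ∈ P)
      (fun x y hxy => propext (hsat x y hxy)) q}
  have hB : IsClopen B := by
    constructor
    · rw [← isOpen_compl_iff]
      refine isOpen_coinduced.2 ?_
      convert isOpen_of_coboundary (coboundary_compl hP.finite_coboundary) using 1
      ext x
      change ¬ (∀ᶠ z in x.filter, z ∈ P) ↔ (∀ᶠ z in x.filter, z ∈ Pᶜ)
      constructor
      · intro h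
        exact (eventually_const x hP.finite_coboundary).resolve_left h
      · intro h h'
        obtain ⟨z, hz, hz'⟩ := (h.and h').exists
        exact hz hz'
    · exact isOpen_coinduced.2 (isOpen_of_coboundary hP.finite_coboundary)
  obtain ⟨x, hx⟩ := exists_eventually hT hP.infinite hP.finite_coboundary
  obtain ⟨y, hy⟩ := exists_eventually hT hP.infinite_compl (coboundary_compl hP.finite_coboundary)
  rcases isClopen_iff.1 hB with h | h
  · have : Quot.mk _ x ∈ B := hx
    rw [h] at this
    exact this
  · have : Quot.mk _ y ∈ B := by rw [h]; trivial
    obtain ⟨z, hz, hz'⟩ := (hy.and (show ∀ᶠ z in y.filter, z ∈ P from this)).exists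
    exact hz hz'

end GATree

end Grushko

/-! ### Clopen sets of boundary points come from vertex sets -/

namespace Grushko

open SimpleGraph Filter

/-- With trivial stabilizer, each orbit of oriented edges has at most one member starting at `v`. -/
lemma IsFreeGTree.finite_neighbors {G : Type*} [Group G] {V : Type*} [MulAction G V]
    {Γ : SimpleGraph V} (h : IsFreeGTree G Γ) {v : V} (hv : ∀ a : G, a • v = v → a = 1) :
    {w | Γ.Adj v w}.Finite := by
  obtain ⟨F, hF, hF'⟩ := h.finite_edges
  have h1 : (⋃ e ∈ F, {w | ∃ a : G, a • v = e.1 ∧ a • w = e.2}).Finite := by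
    refine hF.biUnion fun e _ => Set.Subsingleton.finite ?_
    rintro w ⟨a, ha, ha'⟩ w' ⟨b, hb, hb'⟩
    have : a⁻¹ * b = 1 := hv _ (by rw [mul_smul, hb, ← ha, inv_smul_smul])
    rw [inv_mul_eq_one] at this
    subst this
    rw [← hb'] at ha'
    exact smul_left_cancel _ ha'
  refine h1.subset fun w hw => ?_
  obtain ⟨a, ha⟩ := hF' v w hw
  exact Set.mem_iUnion₂.2 ⟨_, ha, a, rfl, rfl⟩

lemma IsFreeGTree.infinite_neighbors {G : Type*} [Group G] {V : Type*} [MulAction G V]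
    {Γ : SimpleGraph V} (h : IsFreeGTree G Γ) (htf : ∀ a : G, a ≠ 1 → ∀ n : ℤ, n ≠ 0 → a ^ n ≠ 1)
    {v w : V} (hvw : Γ.Adj v w) {a : G} (ha : a ≠ 1) (hav : a • v = v) :
    {w | Γ.Adj v w}.Infinite := by
  have hz : ∀ n : ℤ, a ^ n • v = v := fun n =>
    Subgroup.zpow_mem (MulAction.stabilizer G v) hav n
  refine Set.infinite_of_injective_forall_mem (f := fun n : ℤ => a ^ n • w) ?_ ?_
  · intro n n' hn
    by_contra hne
    refine htf a ha (n - n') (sub_ne_zero.2 hne) (h.free _ v w hvw (hz _) ?_)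
    simp only at hn
    rw [sub_eq_neg_add, zpow_add, mul_smul, hn, zpow_neg, inv_smul_smul]
  · intro n
    have := h.smul (a ^ n) _ _ hvw
    rwa [hz] at this

namespace GATree

variable {G : Type u} [Group G] {k : ℕ} {A : Fin k → Subgroup G} {T : GATree A}

/-- On the boundary points in `Q`, the set `B` is given by a set of vertices with finite
coboundary. -/
def IsTame (B : Set T.Boundary) (Q : Set T.V) : Prop :=
  ∃ P : Set T.V, (coboundary T.graph P).Finite ∧
    ∀ x : T.Boundary, (∀ᶠ y in x.filter, y ∈ Q) → (x ∈ B ↔ ∀ᶠ y in x.filter, y ∈ P)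

lemma IsTame.anti {B : Set T.Boundary} {Q Q' : Set T.V} (h : IsTame B Q) (hQ : Q' ⊆ Q) :
    IsTame B Q' := by
  obtain ⟨P, hP, hP'⟩ := h
  exact ⟨P, hP, fun x hx => hP' x (hx.mono fun y hy => hQ hy)⟩

lemma isTame_of_pure {B : Set T.Boundary} {Q : Set T.V} (c : Prop)
    (h : ∀ x : T.Boundary, (∀ᶠ y in x.filter, y ∈ Q) → (x ∈ B ↔ c)) : IsTame B Q := by
  refine ⟨{_y | c}, ?_, fun x hx => ?_⟩
  · convert Set.finite_empty (α := T.V × T.V)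
    ext e
    simp [coboundary]
  · rw [h x hx]
    simp

/-- An open set contains a finite intersection of directions around each of its points. -/
lemma exists_directions {B : Set T.Boundary} (hB : IsOpen B) {x : T.Boundary} (hx : x ∈ B) :
    ∃ F : Set (T.V × T.V), F.Finite ∧ (∀ e ∈ F, ∀ᶠ y in x.filter, y ∈ side T.graph e.1 e.2) ∧
      ∀ z : T.Boundary, (∀ e ∈ F, ∀ᶠ y in z.filter, y ∈ side T.graph e.1 e.2) → z ∈ B := by
  have hbasis := TopologicalSpace.isTopologicalBasis_of_subbasis
    (s := {B | ∃ v w, T.graph.Adj v w ∧ B = T.boundaryDirection v w})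
    (t := (inferInstance : TopologicalSpace T.Boundary)) rfl
  obtain ⟨_, ⟨f, ⟨hf, hf'⟩, rfl⟩, hxf, hfB⟩ := hbasis.isOpen_iff.1 hB x hx
  have hf2 : ∀ D ∈ f, ∃ e : T.V × T.V, D = T.boundaryDirection e.1 e.2 := fun D hD => by
    obtain ⟨v, w, -, h⟩ := hf' hD
    exact ⟨(v, w), h⟩
  have := T.isTree.1.nonempty
  choose! ε hε using hf2
  refine ⟨ε '' f, hf.image _, ?_, ?_⟩
  · rintro _ ⟨D, hD, rfl⟩
    have := hxf D hD
    rw [hε D hD] at this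
    exact mem_boundaryDirection.1 this
  · intro z hz
    refine hfB fun D hD => ?_
    rw [hε D hD]
    exact mem_boundaryDirection.2 (hz _ ⟨D, hD, rfl⟩)

/-- Far out, the half-trees along the ray are contained in each of the finitely many directions that
define a neighbourhood of its end. -/
lemma exists_pure_of_ray {B : Set T.Boundary} (hB : IsOpen B) (r : T.Ray)
    (hr : (Sum.inr r.limit : T.Boundary) ∈ B) : ∃ n, ∀ x : T.Boundary,
      (∀ᶠ y in x.filter, y ∈ side T.graph (r.pt n) (r.pt (n + 1))) → x ∈ B := by
  obtain ⟨F, hF, hF1, hF2⟩ := exists_directions hB hr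
  simp only [eventually_inr] at hF1
  have h1 := (Set.Finite.eventually_all hF).2 hF1
  have h2 : ∀ᶠ n in atTop, ∀ e ∈ F, e.1 ∉ side T.graph (r.pt n) (r.pt (n + 1)) := by
    refine (Set.Finite.eventually_all hF).2 fun e _ => eventually_atTop.2 ?_
    exact eventually_not_mem_side T.isTree r.pt r.adj r.ne_add_two e.1
  obtain ⟨n, hn1, hn2⟩ := (h1.and h2).exists
  refine ⟨n, fun x hx => hF2 x fun e he => hx.mono fun y hy => ?_⟩
  exact side_subset (r.adj n) (hn1 e he) (hn2 e he) hy

/-- A direction at `v` can leave `B` only if it contains the base vertex of one of the finitely many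
directions defining a neighbourhood of `v`. -/
lemma finite_impure {B : Set T.Boundary} (hB : IsOpen B)
    {v : {v : T.V // MulAction.stabilizer G v ≠ ⊥}} (hv : (Sum.inl v : T.Boundary) ∈ B) :
    {w | T.graph.Adj v.1 w ∧ ¬ ∀ x : T.Boundary,
      (∀ᶠ y in x.filter, y ∈ side T.graph v.1 w) → x ∈ B}.Finite := by
  obtain ⟨F, hF, hF1, hF2⟩ := exists_directions hB hv
  simp only [eventually_inl] at hF1
  have h1 : (⋃ e ∈ F, {w | T.graph.Adj v.1 w ∧ e.1 ∈ side T.graph v.1 w}).Finite := by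
    refine hF.biUnion fun e _ => Set.Subsingleton.finite ?_
    rintro w ⟨hw, hw'⟩ z ⟨hz, hz'⟩
    exact side_unique T.isTree hw hz hw' hz'
  refine h1.subset ?_
  rintro w ⟨hw, hw'⟩
  by_contra hc
  simp only [Set.mem_iUnion₂, Set.mem_ofPred_eq, not_exists, not_and] at hc
  exact hw' fun x hx => hF2 x fun e he => hx.mono fun y hy =>
    side_subset hw (hF1 e he) (hc e he hw) hy

lemma eventually_vertex (x : T.Boundary) (w : T.V) : (∃ h, x = Sum.inl ⟨w, h⟩) ∨
    ∃ z, T.graph.Adj w z ∧ ∀ᶠ y in x.filter, y ∈ side T.graph w z := by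
  induction x using Boundary.cases with
  | inl v =>
    by_cases hv : v.1 = w
    · left; subst hv; exact ⟨v.2, rfl⟩
    · right
      simp only [eventually_inl]
      exact exists_side T.isTree hv
  | inr r =>
    right
    simp only [eventually_inr]
    obtain ⟨n₀, hn₀⟩ : ∃ n₀, ∀ n ≥ n₀, r.pt n ≠ w := by
      by_cases hw : ∃ n, r.pt n = w
      · obtain ⟨n, rfl⟩ := hw
        exact ⟨n + 1, fun i hi h => by have := r.inj h; omega⟩
      · push Not at hw
        exact ⟨0, fun n _ => hw n⟩
    obtain ⟨z, hz, hz'⟩ := exists_side T.isTree (hn₀ n₀ le_rfl)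
    refine ⟨z, hz, eventually_atTop.2 ⟨n₀, fun n hn => ?_⟩⟩
    induction n, hn using Nat.le_induction with
    | base => exact hz'
    | succ n hn ih => exact side_adj (r.adj n) ih (hn₀ _ (by omega))

/-- All but finitely many directions at `w` have one and the same colour; finite coboundary
therefore survives when the vertex sets for the finitely many others are glued together. -/
lemma isTame_join (hT : T.TrivialEdgeStabilizers) {B : Set T.Boundary} (hB : IsOpen B)
    (hB' : IsOpen Bᶜ) (w : T.V) (M : Set T.V) (hM : ∀ x ∈ M, T.graph.Adj w x)
    (hM' : ∀ x ∈ M, IsTame B (side T.graph w x)) :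
    IsTame B ({w} ∪ ⋃ x ∈ M, side T.graph w x) := by
  classical
  -- `c` is the colour of `w` as a boundary point. If `w` has trivial stabilizer it is no boundary
  -- point and has finite valence, so the value `True` is arbitrary.
  obtain ⟨c, hc, hfin⟩ : ∃ c : Prop, (∀ h, (Sum.inl ⟨w, h⟩ : T.Boundary) ∈ B ↔ c) ∧
      {x | T.graph.Adj w x ∧ ¬ ∀ z : T.Boundary,
        (∀ᶠ y in z.filter, y ∈ side T.graph w x) → (z ∈ B ↔ c)}.Finite := by
    by_cases hw : MulAction.stabilizer G w = ⊥
    · refine ⟨True, fun h => absurd hw h, ?_⟩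
      refine ((T.isFreeGTree hT).finite_neighbors (v := w) fun a ha => ?_).subset fun x hx => hx.1
      have : a ∈ MulAction.stabilizer G w := ha
      rwa [hw, Subgroup.mem_bot] at this
    · by_cases hwB : (Sum.inl ⟨w, hw⟩ : T.Boundary) ∈ B
      · refine ⟨True, fun _ => by simpa using hwB, ?_⟩
        simpa using finite_impure hB hwB
      · refine ⟨False, fun _ => by simpa using hwB, ?_⟩
        simpa using finite_impure hB' (v := ⟨w, hw⟩) hwB
  set bad := {x | T.graph.Adj w x ∧ ¬ ∀ z : T.Boundary,
        (∀ᶠ y in z.filter, y ∈ side T.graph w x) → (z ∈ B ↔ c)} with hbad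
  choose! P hP hP' using hM'
  -- `Q` follows `P x` in the exceptional directions and has the colour `c` everywhere else.
  let Q : Set T.V := {y | (y = w ∧ c) ∨ ∃ x, T.graph.Adj w x ∧ y ∈ side T.graph w x ∧
    ((x ∈ M ∩ bad ∧ y ∈ P x) ∨ (x ∉ M ∩ bad ∧ c))}
  have hQw : w ∈ Q ↔ c := by
    constructor
    · rintro (h | ⟨x, -, h, -⟩)
      · exact h.2
      · exact absurd h (not_mem_side _ _)
    · exact fun h => .inl ⟨rfl, h⟩
  have hQx : ∀ x y, T.graph.Adj w x → y ∈ side T.graph w x →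
      (y ∈ Q ↔ if x ∈ M ∩ bad then y ∈ P x else c) := by
    intro x y hx hy
    have hyw : y ≠ w := by rintro rfl; exact not_mem_side _ _ hy
    constructor
    · rintro (h | ⟨x', hx', hy', h⟩)
      · exact absurd h.1 hyw
      · have := side_unique T.isTree hx hx' hy hy'
        subst this
        split_ifs with hm <;> tauto
    · intro h
      refine .inr ⟨x, hx, hy, ?_⟩
      split_ifs at h with hm <;> tauto
  refine ⟨Q, ?_, fun z hz => ?_⟩
  · have h1 : ((⋃ x ∈ bad ∩ M, coboundary T.graph (P x)) ∪
        ((fun x => (w, x)) '' bad ∪ (fun x => (x, w)) '' bad)).Finite :=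
      ((hfin.inter_of_left _).biUnion fun x hx => hP x hx.2).union
        ((hfin.image _).union (hfin.image _))
    refine h1.subset ?_
    rintro ⟨a, b⟩ ⟨hab, ha, hb⟩
    simp only at hab ha hb
    by_cases haw : a = w
    · subst haw
      right; left
      refine ⟨b, ?_, rfl⟩
      rw [hQx b b hab (mem_side_self hab.ne)] at hb
      rw [hQw] at ha
      by_contra hbb
      rw [if_neg (fun h => hbb h.2)] at hb
      exact hb ha
    by_cases hbw : b = w
    · subst hbw
      right; right
      refine ⟨a, ?_, rfl⟩
      rw [hQx a a hab.symm (mem_side_self hab.ne')] at ha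
      rw [hQw] at hb
      by_contra hbb
      rw [if_neg (fun h => hbb h.2)] at ha
      exact hb ha
    left
    obtain ⟨x, hx, hax⟩ := exists_side T.isTree haw
    have hbx := side_adj hab hax hbw
    rw [hQx x _ hx hax] at ha
    rw [hQx x _ hx hbx] at hb
    by_cases hm : x ∈ M ∩ bad
    · rw [if_pos hm] at ha hb
      exact Set.mem_iUnion₂.2 ⟨x, hm.symm, hab, ha, hb⟩
    · rw [if_neg hm] at ha hb
      exact absurd ha hb
  · rcases eventually_vertex z w with ⟨h, rfl⟩ | ⟨x, hx, hzx⟩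
    · exact (hc h).trans (hQw.symm.trans
        (eventually_inl (T := T) (v := ⟨w, h⟩) (Q := fun y => y ∈ Q)).symm)
    · have hxM : x ∈ M := by
        obtain ⟨y, hy, hy'⟩ := (hz.and hzx).exists
        rcases hy with hy | hy
        · rw [Set.mem_singleton_iff] at hy
          subst hy
          exact absurd hy' (not_mem_side _ _)
        · obtain ⟨x', hx', hyx'⟩ := Set.mem_iUnion₂.1 hy
          rwa [side_unique T.isTree hx (hM x' hx') hy' hyx']
      have h1 : (∀ᶠ y in z.filter, y ∈ Q) ↔
          ∀ᶠ y in z.filter, if x ∈ M ∩ bad then y ∈ P x else c :=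
        eventually_congr (hzx.mono fun y hy => hQx x y hx hy)
      rw [h1]
      by_cases hm : x ∈ bad
      · simp only [if_pos (show x ∈ M ∩ bad from ⟨hxM, hm⟩)]
        exact hP' x hxM z hzx
      · have hm' : x ∉ M ∩ bad := fun h => hm h.2
        simp only [if_neg hm']
        by_contra hcon
        exact hm ⟨hx, fun hall => hcon (by rw [hall z hzx, Filter.eventually_const])⟩

/-- Clopen sets of boundary points come from sets of vertices with finite coboundary. -/
lemma isTame_univ (hT : T.TrivialEdgeStabilizers) {B : Set T.Boundary} (hB : IsOpen B)
    (hB' : IsOpen Bᶜ) : IsTame B Set.univ := by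
  by_contra hbad
  obtain ⟨a⟩ := T.isTree.1.nonempty
  have h1 : ∃ b, T.graph.Adj a b ∧ ¬ IsTame B (side T.graph a b) := by
    by_contra! h
    refine hbad ((isTame_join hT hB hB' a {b | T.graph.Adj a b} (fun _ hx => hx) h).anti ?_)
    intro y _
    by_cases hy : y = a
    · exact .inl hy
    · obtain ⟨b, hb, hyb⟩ := exists_side T.isTree hy
      exact .inr (Set.mem_iUnion₂.2 ⟨b, hb, hyb⟩)
  -- A half-tree that is not tame contains a smaller one behind it. The resulting ray ends in `B` or
  -- in its complement, both open, so some half-tree along it is monochromatic after all.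
  have h2 : ∀ a b, T.graph.Adj a b → ¬ IsTame B (side T.graph a b) →
      ∃ c, T.graph.Adj b c ∧ c ≠ a ∧ ¬ IsTame B (side T.graph b c) := by
    intro a b hab h
    by_contra! h'
    refine h ((isTame_join hT hB hB' b {c | T.graph.Adj b c ∧ c ≠ a} (fun _ hx => hx.1)
      fun c hc => h' c hc.1 hc.2).anti ?_)
    intro y hya
    by_cases hy : y = b
    · exact .inl hy
    · obtain ⟨c, hc, hyc⟩ := exists_side T.isTree hy
      refine .inr (Set.mem_iUnion₂.2 ⟨c, ⟨hc, ?_⟩, hyc⟩)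
      rintro rfl
      exact (not_mem_side_iff T.isTree hab).2 hyc hya
  obtain ⟨b, hab, h3⟩ := h1
  obtain ⟨r, -, -, hr, hr2, hR⟩ := exists_ray h2 hab h3
  let ρ : T.Ray := ⟨r, hr, injective_of_locally_injective T.isTree r hr hr2⟩
  by_cases hρ : (Sum.inr ρ.limit : T.Boundary) ∈ B
  · obtain ⟨n, hn⟩ := exists_pure_of_ray hB ρ hρ
    exact hR n (isTame_of_pure True fun x hx => by simpa using hn x hx)
  · obtain ⟨n, hn⟩ := exists_pure_of_ray hB' ρ hρ
    exact hR n (isTame_of_pure False fun x hx => by simpa using hn x hx)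

/-- A boundary vertex has infinitely many neighbours, only finitely many of which are cut off by the
coboundary; a ray has infinitely many vertices. -/
lemma infinite_of_eventually (hT : T.TrivialEdgeStabilizers)
    (htf : ∀ a : G, a ≠ 1 → ∀ n : ℤ, n ≠ 0 → a ^ n ≠ 1) (hadj : ∀ v, ∃ w, T.graph.Adj v w)
    {P : Set T.V} (hP : (coboundary T.graph P).Finite) {x : T.Boundary}
    (hx : ∀ᶠ y in x.filter, y ∈ P) : P.Infinite := by
  induction x using Boundary.cases with
  | inl v =>
    rw [eventually_inl] at hx
    obtain ⟨⟨a, ha⟩, ha1⟩ := Subgroup.ne_bot_iff_exists_ne_one.1 v.2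
    obtain ⟨w, hw⟩ := hadj v.1
    have h1 := (T.isFreeGTree hT).infinite_neighbors htf hw (fun h0 => ha1 (Subtype.ext h0)) ha
    intro hfin
    refine h1 ((hfin.union (hP.image Prod.snd)).subset fun z hz => ?_)
    by_cases hzP : z ∈ P
    · exact .inl hzP
    · exact .inr ⟨(v.1, z), ⟨hz, hx, hzP⟩, rfl⟩
  | inr r =>
    rw [eventually_inr] at hx
    obtain ⟨n₀, hn⟩ := eventually_atTop.1 hx
    exact Set.infinite_of_injective_forall_mem (f := fun n => r.pt (n₀ + n))
      (fun i j hij => by have := r.inj hij; omega) fun n => hn _ (by omega)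

lemma nonempty_boundary [Nontrivial G] (hT : T.TrivialEdgeStabilizers) : Nonempty T.Boundary := by
  obtain ⟨v⟩ := T.isTree.1.nonempty
  by_cases hv : MulAction.stabilizer G v = ⊥
  · obtain ⟨a, ha⟩ := exists_ne (1 : G)
    have hav : a • v ≠ v := fun h => ha (by
      have : a ∈ MulAction.stabilizer G v := h
      rwa [hv, Subgroup.mem_bot] at this)
    obtain ⟨w, hw, -⟩ := exists_side T.isTree hav
    have h := T.isFreeGTree hT
    obtain ⟨x, -⟩ := exists_eventually hT (P := Set.univ)
      ((h.infinite_orbit_inter_side T.isMinimalGTree hw v).mono (Set.subset_univ _))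
      (by convert Set.finite_empty (α := T.V × T.V); ext; simp [coboundary])
    exact ⟨x⟩
  · exact ⟨Sum.inl ⟨v, hv⟩⟩

/-- If the decomposition space is not connected, then the lines are separated. -/
theorem exists_separates_of_not_connectedSpace [Nontrivial G] (hT : T.TrivialEdgeStabilizers)
    (htf : ∀ a : G, a ≠ 1 → ∀ n : ℤ, n ≠ 0 → a ^ n ≠ 1) {m : ℕ} {g : Fin m → G}
    (hg : ∀ j (v : T.V), g j • v ≠ v) (hcon : ¬ ConnectedSpace (T.DecompositionSpace g)) :
    ∃ P, Separates T.graph g P := by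
  have h := T.isFreeGTree hT
  obtain ⟨x₀⟩ := nonempty_boundary hT
  have hne : Nonempty (T.DecompositionSpace g) := ⟨Quot.mk _ x₀⟩
  have hpre : ¬ PreconnectedSpace (T.DecompositionSpace g) := fun hp => hcon ⟨hne⟩
  rw [preconnectedSpace_iff_clopen] at hpre
  push Not at hpre
  obtain ⟨s, hs, hs0, hs1⟩ := hpre
  set B : Set T.Boundary := Quot.mk _ ⁻¹' s with hB
  have hBo : IsOpen B := hs.isOpen.preimage continuous_coinduced_rng
  have hBo' : IsOpen Bᶜ := hs.compl.isOpen.preimage continuous_coinduced_rng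
  obtain ⟨P, hP, hPB⟩ := isTame_univ hT hBo hBo'
  simp only [eventually_true, forall_const, Set.mem_univ] at hPB
  obtain ⟨q, hq⟩ := hs0
  obtain ⟨q', hq'⟩ := (Set.ne_univ_iff_exists_notMem s).1 hs1
  obtain ⟨x, rfl⟩ := Quot.exists_rep q
  obtain ⟨x', rfl⟩ := Quot.exists_rep q'
  have hx : x ∈ B := hq
  have hx' : x' ∉ B := hq'
  have hxx : x ≠ x' := fun h0 => hx' (h0 ▸ hx)
  have hadj : ∀ v, ∃ w, T.graph.Adj v w := by
    intro v
    rcases eventually_vertex x v with ⟨hv, hxv⟩ | ⟨w, hw, -⟩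
    · rcases eventually_vertex x' v with ⟨hv', hxv'⟩ | ⟨w, hw, -⟩
      · exact absurd (hxv.trans hxv'.symm) hxx
      · exact ⟨w, hw⟩
    · exact ⟨w, hw⟩
  have hPx' : ∀ᶠ y in x'.filter, y ∈ Pᶜ :=
    (eventually_const x' hP).resolve_left fun h0 => hx' ((hPB x').2 h0)
  refine ⟨P, infinite_of_eventually hT htf hadj hP ((hPB x).1 hx),
    infinite_of_eventually hT htf hadj (coboundary_compl hP) hPx', hP, fun a j y => ?_⟩
  have hb : ∀ v : T.V, (a * g j * a⁻¹) • v ≠ v := by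
    intro v hv
    refine hg j (a⁻¹ • v) ?_
    rw [mul_smul, mul_smul] at hv
    rw [eq_inv_smul_iff, hv]
  obtain ⟨l, t, ht, hl, hl2, hlt⟩ := h.exists_axis hb
  let L : T.Line := ⟨l, hl, injective_of_locally_injective_int T.isTree hl hl2⟩
  have hrel : T.lineRel g (Sum.inr L.negRay.limit) (Sum.inr L.posRay.limit) :=
    ⟨a, j, L, ⟨t, ht, hlt⟩, rfl, rfl⟩
  have hsat₀ : Sum.inr L.negRay.limit ∈ B ↔ Sum.inr L.posRay.limit ∈ B := by
    change Quot.mk (T.lineRel g) _ ∈ s ↔ Quot.mk (T.lineRel g) _ ∈ s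
    exact iff_of_eq (congrArg (· ∈ s) (Quot.sound hrel))
  have hsat : (∀ᶠ n in atTop, L.negRay.pt n ∈ P) ↔ ∀ᶠ n in atTop, L.posRay.pt n ∈ P :=
    eventually_inr.symm.trans ((hPB _).symm.trans (hsat₀.trans ((hPB _).trans eventually_inr)))
  refine h.lines_of_one hP (fun n hn => h.pow_ne_one hb hn) (l 0) ?_ y
  have hz : ∀ k : ℤ, (a * g j * a⁻¹) ^ k • l 0 = l (k * t) := fun k => by
    rw [axis_zpow hlt, zero_add]
  -- If both ends of the axis lie in `Q`, only bounded powers can move `l 0` outside `Q`.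
  have key : ∀ Q : Set T.V, (∀ᶠ n in atTop, L.negRay.pt n ∈ Q) →
      (∀ᶠ n in atTop, L.posRay.pt n ∈ Q) → {n : ℤ | (a * g j * a⁻¹) ^ n • l 0 ∉ Q}.Finite := by
    intro Q h1 h2
    obtain ⟨N, hN⟩ := eventually_atTop.1 (h1.and h2)
    refine (Set.finite_Icc (-(N : ℤ)) N).subset fun n hn => ?_
    simp only [Set.mem_ofPred_eq, hz] at hn
    by_contra hc
    rw [Set.mem_Icc, not_and_or, not_le, not_le] at hc
    rcases hc with hc | hc
    · obtain ⟨i, hi⟩ := Int.eq_ofNat_of_zero_le (show 0 ≤ -n by omega)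
      refine hn ?_
      have h3 := (hN (i * t) (by nlinarith)).1
      change l (-((i * t : ℕ) : ℤ)) ∈ Q at h3
      convert h3 using 2
      push_cast
      rw [← hi]; ring
    · obtain ⟨i, hi⟩ := Int.eq_ofNat_of_zero_le (show 0 ≤ n by omega)
      refine hn ?_
      have h3 := (hN (i * t) (by nlinarith)).2
      change l ((i * t : ℕ) : ℤ) ∈ Q at h3
      convert h3 using 2
      push_cast
      rw [← hi]
  rcases ray_eventually_const T.isTree hP L.negRay.inj L.negRay.adj with h1 | h1
  · right
    exact key P h1 (hsat.1 h1)
  · left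
    have h2 : ∀ᶠ n in atTop, L.posRay.pt n ∈ Pᶜ := by
      refine (ray_eventually_const T.isTree hP L.posRay.inj L.posRay.adj).resolve_left fun h2 => ?_
      obtain ⟨n, hn, hn'⟩ := ((hsat.2 h2).and h1).exists
      exact hn' hn
    simpa using key Pᶜ h1 h2

end GATree

end Grushko

/-! ### Turns, and admissible cuts lifted to sets of neighbours -/

namespace Grushko

open SimpleGraph

namespace GATree

variable {G : Type u} [Group G] {k : ℕ} {A : Fin k → Subgroup G} {T : GATree A} {m : ℕ}
  {g : Fin m → G} {v : T.V}

/-- A line of the collection passes through `v` from `w` to `w'` or from `w'` to `w`. -/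
def IsTurn (T : GATree A) (g : Fin m → G) (v w w' : T.V) : Prop :=
  ∃ (a : G) (j : Fin m) (l : T.Line) (n : ℤ), T.IsAxis (a * g j * a⁻¹) l ∧ l.pt n = v ∧
    ((l.pt (n - 1) = w ∧ l.pt (n + 1) = w') ∨ (l.pt (n - 1) = w' ∧ l.pt (n + 1) = w))

lemma IsTurn.symm {w w' : T.V} (h : T.IsTurn g v w w') : T.IsTurn g v w' w := by
  obtain ⟨a, j, l, n, hl, hn, h⟩ := h
  exact ⟨a, j, l, n, hl, hn, h.symm⟩

lemma Line.adj_sub (l : T.Line) (n : ℤ) : T.graph.Adj (l.pt n) (l.pt (n - 1)) := by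
  have := (l.adj (n - 1)).symm
  rwa [sub_add_cancel] at this

lemma IsTurn.adj {w w' : T.V} (h : T.IsTurn g v w w') : T.graph.Adj v w := by
  obtain ⟨a, j, l, n, hl, rfl, ⟨rfl, -⟩ | ⟨-, rfl⟩⟩ := h
  · exact l.adj_sub n
  · exact l.adj n

lemma IsTurn.ne {w w' : T.V} (h : T.IsTurn g v w w') : w ≠ w' := by
  obtain ⟨a, j, l, n, hl, rfl, ⟨rfl, rfl⟩ | ⟨rfl, rfl⟩⟩ := h <;>
  · intro h
    have := l.inj h
    omega

lemma Line.mem_side_pos (l : T.Line) (n : ℤ) (i : ℕ) :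
    l.pt (n + 1 + i) ∈ side T.graph (l.pt n) (l.pt (n + 1)) := by
  induction i with
  | zero => simpa using mem_side_self (l.adj n).ne
  | succ i ih =>
    push_cast
    rw [← add_assoc]
    refine side_adj (l.adj _) ih fun h => ?_
    have := l.inj h
    omega

lemma Line.mem_side_neg (l : T.Line) (n : ℤ) (i : ℕ) :
    l.pt (n - 1 - i) ∈ side T.graph (l.pt n) (l.pt (n - 1)) := by
  induction i with
  | zero => simpa using mem_side_self (l.adj_sub n).ne
  | succ i ih =>
    push_cast
    rw [← sub_sub]
    refine side_adj (l.adj_sub _) ih fun h => ?_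
    have := l.inj h
    omega

/-- Translates of lines. -/
def Line.smul (c : G) (l : T.Line) : T.Line where
  pt n := c • l.pt n
  adj n := T.adj_smul c _ _ (l.adj n)
  inj _ _ h := l.inj (smul_left_cancel c h)

lemma IsAxis.smul {a : G} {l : T.Line} (h : T.IsAxis a l) (c : G) :
    T.IsAxis (c * a * c⁻¹) (l.smul c) := by
  obtain ⟨t, ht, h⟩ := h
  refine ⟨t, ht, fun n => ?_⟩
  change (c * a * c⁻¹) • c • l.pt n = c • l.pt (n + t)
  rw [mul_smul, inv_smul_smul, mul_smul, h]

lemma IsTurn.smul {w w' : T.V} (h : T.IsTurn g v w w') (c : G) :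
    T.IsTurn g (c • v) (c • w) (c • w') := by
  obtain ⟨a, j, l, n, hl, hn, h⟩ := h
  refine ⟨c * a, j, l.smul c, n, ?_, by rw [← hn]; rfl, ?_⟩
  · have := hl.smul c
    rwa [show c * (a * g j * a⁻¹) * c⁻¹ = c * a * g j * (c * a)⁻¹ by group] at this
  · rcases h with ⟨rfl, rfl⟩ | ⟨rfl, rfl⟩
    · exact .inl ⟨rfl, rfl⟩
    · exact .inr ⟨rfl, rfl⟩

/-- Between two different directions at `v` a line has to pass through `v`. This turns edges of the
Whitehead graph into turns. -/
lemma isTurn_iff {w w' : T.V} : T.IsTurn g v w w' ↔ T.graph.Adj v w ∧ T.graph.Adj v w' ∧ w ≠ w' ∧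
    ∃ X ∈ T.lines g, (X ∩ T.direction v w).Nonempty ∧ (X ∩ T.direction v w').Nonempty := by
  constructor
  · intro h
    refine ⟨h.adj, h.symm.adj, h.ne, ?_⟩
    have h1 := mem_side_self (Γ := T.graph) h.adj.ne
    have h2 := mem_side_self (Γ := T.graph) h.symm.adj.ne
    obtain ⟨a, j, l, n, hl, -, h⟩ := h
    refine ⟨_, ⟨a, j, l, hl, rfl⟩, ⟨w, ?_, h1⟩, ⟨w', ?_, h2⟩⟩
    · rcases h with ⟨rfl, rfl⟩ | ⟨rfl, rfl⟩ <;> exact ⟨_, rfl⟩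
    · rcases h with ⟨rfl, rfl⟩ | ⟨rfl, rfl⟩ <;> exact ⟨_, rfl⟩
  · rintro ⟨hw, hw', hne, X, ⟨a, j, l, hl, rfl⟩, ⟨_, ⟨i, rfl⟩, hi⟩, ⟨_, ⟨i', rfl⟩, hi'⟩⟩
    have key : ∀ {w w' : T.V} {i i' : ℤ}, T.graph.Adj v w → T.graph.Adj v w' → w ≠ w' → i ≤ i' →
        l.pt i ∈ side T.graph v w → l.pt i' ∈ side T.graph v w' →
        ∃ n, l.pt n = v ∧ l.pt (n - 1) = w ∧ l.pt (n + 1) = w' := by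
      -- The first index after `i` at which the line is outside the direction of `w` is its passage
      -- through `v`.
      intro w w' i i' hw hw' hne hii hi hi'
      have hex : ∃ n : ℕ, l.pt (i + n) ∉ side T.graph v w := by
        obtain ⟨n, rfl⟩ := Int.le.dest hii
        exact ⟨n, fun h => hne (side_unique T.isTree hw hw' h hi')⟩
      classical
      set N := Nat.find hex with hN
      have h1 : l.pt (i + N) ∉ side T.graph v w := Nat.find_spec hex
      have h0 : N ≠ 0 := by
        intro h0
        rw [h0] at h1
        simp [hi] at h1
      have h2 : l.pt (i + N - 1) ∈ side T.graph v w := by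
        by_contra hc
        refine Nat.find_min hex (m := N - 1) (by omega) ?_
        rwa [Nat.cast_sub (by omega), Nat.cast_one, ← add_sub_assoc]
      obtain ⟨h3, h4⟩ := cross_side T.isTree hw (l.adj_sub _) h1 h2
      refine ⟨i + N, h3, h4, ?_⟩
      have hlt : i + N < i' := by
        by_contra hge
        have hlt : i' ≤ i + N - 1 := by
          rcases lt_or_eq_of_le (not_lt.1 hge) with h5 | h5
          · omega
          · rw [h5, h3] at hi'
            exact absurd hi' (not_mem_side _ _)
        obtain ⟨q, hq⟩ := Int.le.dest (show 0 ≤ i' - i by omega)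
        have := Nat.find_min hex (m := q) (by omega)
        rw [not_not, show i + (q : ℤ) = i' by omega] at this
        exact hne (side_unique T.isTree hw hw' this hi')
      obtain ⟨q, hq⟩ := Int.le.dest (show i + N + 1 ≤ i' by omega)
      have h5 := l.mem_side_pos (i + N) q
      rw [hq, h3] at h5
      have h6 := l.adj (i + N)
      rw [h3] at h6
      exact side_unique T.isTree h6 hw' h5 hi'
    rcases le_total i i' with h | h
    · obtain ⟨n, h1, h2⟩ := key hw hw' hne h hi hi'
      exact ⟨a, j, l, n, hl, h1, .inl h2⟩
    · obtain ⟨n, h1, h2⟩ := key hw' hw hne.symm h hi' hi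
      exact ⟨a, j, l, n, hl, h1, .inr h2⟩

/-! ### Cut sets of neighbours -/

/-- A proper set of neighbours of `v` whose translates by the stabilizer are disjoint. -/
structure IsCutSet (T : GATree A) (v : T.V) (C : Set T.V) : Prop where
  adj : ∀ c ∈ C, T.graph.Adj v c
  disjoint : ∀ s : G, s • v = v → ∀ c ∈ C, s • c ∈ C → s = 1
  proper : ∃ w, T.graph.Adj v w ∧ w ∉ C

/-- The lift to the neighbours of `v` of an admissible cut of type i. -/
structure IsTypeOneSet (T : GATree A) (g : Fin m → G) (v : T.V) (C : Set T.V) : Prop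
    extends T.IsCutSet v C where
  nonempty : C.Nonempty
  closed : ∀ c ∈ C, ∀ w, T.IsTurn g v c w → w ∈ C

/-- The lift to the neighbours of `v` of an admissible cut of type ii. -/
structure IsTypeTwoSet (T : GATree A) (g : Fin m → G) (v : T.V) (C : Set T.V) (w₀ : T.V) : Prop
    extends T.IsCutSet v C where
  mem : w₀ ∈ C
  closed : ∀ c ∈ C, c ≠ w₀ → ∀ w, T.IsTurn g v c w → w ∈ C
  exists_turn : ∃ c ∈ C, T.IsTurn g v w₀ c

lemma WhVertex.adj_pref (x : T.WhVertex v) : T.graph.Adj v x.pref :=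
  (Quotient.out (s := T.directionSetoid v) x).2

lemma WhVertex.exists_smul_pref {w : T.V} (hw : T.graph.Adj v w) :
    ∃ (x : T.WhVertex v) (s : MulAction.stabilizer G v), (s : G) • x.pref = w :=
  ⟨Quotient.mk (T.directionSetoid v) ⟨w, hw⟩, Quotient.mk_out (s := T.directionSetoid v) ⟨w, hw⟩⟩

lemma WhVertex.eq_of_smul_pref {x y : T.WhVertex v} {s t : MulAction.stabilizer G v}
    (h : (s : G) • x.pref = (t : G) • y.pref) : x = y := by
  rw [← Quotient.out_eq (s := T.directionSetoid v) x,
    ← Quotient.out_eq (s := T.directionSetoid v) y]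
  refine Quotient.sound (s := T.directionSetoid v) ⟨t⁻¹ * s, ?_⟩
  change ((t⁻¹ * s : MulAction.stabilizer G v) : G) • x.pref = y.pref
  rw [Subgroup.coe_mul, mul_smul, h, ← mul_smul, ← Subgroup.coe_mul]
  simp

lemma WhEdge.isTurn (e : T.WhEdge g v) : T.IsTurn g v e.src.pref ((e.label : G) • e.tgt.pref) := by
  rw [isTurn_iff]
  refine ⟨e.src.adj_pref, ?_, e.distinct, e.line, e.line_mem, e.meets_src, e.meets_tgt⟩
  have := T.adj_smul (e.label : G) _ _ e.tgt.adj_pref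
  rwa [show (e.label : G) • v = v from e.label.2] at this

lemma IsTurn.exists_whEdge {x y : T.WhVertex v} {a : MulAction.stabilizer G v}
    (h : T.IsTurn g v x.pref ((a : G) • y.pref)) :
    ∃ e : T.WhEdge g v, e.src = x ∧ e.tgt = y ∧ e.label = a := by
  obtain ⟨-, -, hne, X, hX, h1, h2⟩ := isTurn_iff.1 h
  exact ⟨⟨x, y, a, X, hX, h1, h2, hne⟩, rfl, rfl, rfl⟩

lemma IsTurn.smul_stabilizer {w w' : T.V} (h : T.IsTurn g v w w') (s : MulAction.stabilizer G v) :
    T.IsTurn g v ((s : G) • w) ((s : G) • w') := by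
  have := h.smul (s : G)
  rwa [show (s : G) • v = v from s.2] at this

/-- The edges of the Whitehead graph that lift to a set `C` of neighbours. -/
def liftEdges (g : Fin m → G) (v : T.V) (C : Set T.V) : Set (T.WhEdge g v) :=
  {e | ∃ s : MulAction.stabilizer G v, (s : G) • e.src.pref ∈ C ∧
    (s : G) • (e.label : G) • e.tgt.pref ∈ C}

/-- The vertices of the Whitehead graph that lift to a set `C` of neighbours. -/
def liftVerts (v : T.V) (C : Set T.V) : Set (T.WhVertex v) :=
  {x | ∃ s : MulAction.stabilizer G v, (s : G) • x.pref ∈ C}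

lemma liftEdges_tgt {C : Set T.V} {e : T.WhEdge g v} {s : MulAction.stabilizer G v}
    (h : (s : G) • e.tgt.pref ∈ C)
    (hC : ∀ w, T.IsTurn g v ((s : G) • e.tgt.pref) w → w ∈ C) : e ∈ liftEdges g v C := by
  refine ⟨s * e.label⁻¹, ?_, ?_⟩
  · refine hC _ ?_
    have := (e.isTurn.smul_stabilizer (s * e.label⁻¹)).symm
    rwa [← mul_smul, ← Subgroup.coe_mul, inv_mul_cancel_right] at this
  · rwa [← mul_smul, ← Subgroup.coe_mul, inv_mul_cancel_right]

lemma liftEdges_reverse {C : Set T.V} {e e' : T.WhEdge g v} (h : e ∈ liftEdges g v C)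
    (hs : e'.src = e.tgt) (ht : e'.tgt = e.src) (hl : e'.label = e.label⁻¹) :
    e' ∈ liftEdges g v C := by
  obtain ⟨s, h1, h2⟩ := h
  refine ⟨s * e.label, ?_, ?_⟩
  · rwa [hs, Subgroup.coe_mul, mul_smul]
  · rw [ht, hl, ← mul_smul, ← Subgroup.coe_mul, mul_inv_cancel_right]
    exact h1

/-- The subgraph of the Whitehead graph given by a set of neighbours. -/
def liftSubgraph (g : Fin m → G) (v : T.V) (C : Set T.V) : T.WhSubgraph g v where
  verts := liftVerts v C
  edges := liftEdges g v C
  src_mem := fun _ ⟨s, h, _⟩ => ⟨s, h⟩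
  tgt_mem := fun e ⟨s, _, h⟩ => ⟨s * e.label, by rwa [Subgroup.coe_mul, mul_smul]⟩
  reverse_mem := fun _ he _ ⟨hs, ht, hl, _⟩ => liftEdges_reverse he hs ht hl

/-- The complementary subgraph, with a prescribed set of vertices. -/
def colliftSubgraph (g : Fin m → G) (v : T.V) (C : Set T.V) (S : Set (T.WhVertex v))
    (h1 : ∀ e ∉ liftEdges g v C, e.src ∈ S) (h2 : ∀ e ∉ liftEdges g v C, e.tgt ∈ S) :
    T.WhSubgraph g v where
  verts := S
  edges := (liftEdges g v C)ᶜ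
  src_mem := h1
  tgt_mem := h2
  reverse_mem := by
    rintro e he e' ⟨hs, ht, hl, -⟩ he'
    exact he (liftEdges_reverse he' ht.symm hs.symm (by rw [hl, inv_inv]))

lemma IsCutSet.eq_of_smul {C : Set T.V} (hC : T.IsCutSet v C) {s t : MulAction.stabilizer G v}
    {w : T.V} (hs : (s : G) • w ∈ C) (ht : (t : G) • w ∈ C) : s = t := by
  have h1 := hC.disjoint ((t * s⁻¹ : MulAction.stabilizer G v) : G) (t * s⁻¹).2 _ hs (by
    rw [← mul_smul, ← Subgroup.coe_mul, inv_mul_cancel_right]; exact ht)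
  have h2 : t * s⁻¹ = 1 := Subtype.ext h1
  exact (mul_inv_eq_one.1 h2).symm

/-- Edge paths lift to `C` with a prescribed start: different translates of `C` are disjoint, so the
lifts of consecutive edges fit together. -/
lemma IsCutSet.path_mem {C : Set T.V} (hC : T.IsCutSet v C) {x y : T.WhVertex v}
    {a : MulAction.stabilizer G v} (h : (liftSubgraph g v C).Path x y a) :
    ∀ s : MulAction.stabilizer G v, (s : G) • x.pref ∈ C → (s : G) • (a : G) • y.pref ∈ C := by
  induction h with
  | nil x hx => intro s hs; simpa using hs
  | cons e he y a _ ih =>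
    intro s hs
    obtain ⟨s', h1, h2⟩ := he
    rw [← hC.eq_of_smul hs h1] at h2
    have := ih (s * e.label) (by rwa [Subgroup.coe_mul, mul_smul])
    rw [Subgroup.coe_mul, mul_smul]
    rwa [Subgroup.coe_mul, mul_smul] at this

/-- The lift of a closed path ends at a translate of its start within `C`, hence at the start
itself. -/
lemma IsCutSet.trivialMonodromy {C : Set T.V} (hC : T.IsCutSet v C) :
    (liftSubgraph g v C).TrivialMonodromy := by
  rintro x ⟨s, hs⟩
  rw [WhSubgraph.monodromy, Subgroup.closure_eq_bot_iff]
  intro a ha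
  have h1 := hC.path_mem ha s hs
  rw [← mul_smul, ← Subgroup.coe_mul] at h1
  have := hC.eq_of_smul hs h1
  simpa using this

/-- Sets of neighbours that are connected by turns. -/
def IsTurnConnected (T : GATree A) (g : Fin m → G) (v : T.V) (C : Set T.V) : Prop :=
  ∀ c ∈ C, ∀ c' ∈ C, Relation.ReflTransGen (fun x y => T.IsTurn g v x y ∧ y ∈ C) c c'

lemma IsCutSet.isConnected {C : Set T.V} (hC : T.IsCutSet v C) (hne : C.Nonempty)
    (hconn : T.IsTurnConnected g v C) : (liftSubgraph g v C).IsConnected := by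
  constructor
  · obtain ⟨c, hc⟩ := hne
    obtain ⟨x, s, hs⟩ := WhVertex.exists_smul_pref (hC.adj c hc)
    exact ⟨x, s, by rwa [hs]⟩
  · rintro x ⟨s, hs⟩ y ⟨t, ht⟩
    obtain ⟨c', hc'⟩ : ∃ c', c' = (t : G) • y.pref := ⟨_, rfl⟩
    obtain ⟨c, hc⟩ : ∃ c, c = (s : G) • x.pref := ⟨_, rfl⟩
    have hcc : Relation.ReflTransGen (fun x y => T.IsTurn g v x y ∧ y ∈ C) c c' :=
      hconn c (hc ▸ hs) c' (hc' ▸ ht)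
    induction hcc using Relation.ReflTransGen.head_induction_on generalizing x s with
    | refl =>
      rw [hc'] at hc
      have := WhVertex.eq_of_smul_pref hc
      subst this
      exact ⟨1, .nil _ ⟨_, hs⟩⟩
    | head h hbc ih =>
      rename_i a b
      obtain ⟨x₁, s₁, h₁⟩ := WhVertex.exists_smul_pref h.1.symm.adj
      obtain ⟨p, hp⟩ := ih x₁ s₁ (by rw [h₁]; exact h.2) h₁.symm
      have hturn := h.1.smul_stabilizer s⁻¹
      have e1 : ((s⁻¹ : MulAction.stabilizer G v) : G) • a = x.pref := by
        rw [hc]; simp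
      rw [e1, ← h₁, ← mul_smul, ← Subgroup.coe_mul] at hturn
      obtain ⟨e, rfl, rfl, hl⟩ := hturn.exists_whEdge
      have he : e ∈ (liftSubgraph g v C).edges := by
        refine ⟨s, hs, ?_⟩
        rw [hl, ← mul_smul, ← Subgroup.coe_mul, mul_inv_cancel_left, h₁]
        exact h.2
      exact ⟨_, .cons e he y p hp⟩

lemma IsCutSet.exists_not_mem_liftVerts {C : Set T.V} (hC : T.IsCutSet v C)
    (hv : MulAction.stabilizer G v = ⊥) : ∃ x : T.WhVertex v, x ∉ liftVerts v C := by
  obtain ⟨w, hw, hwC⟩ := hC.proper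
  obtain ⟨x, s, hs⟩ := WhVertex.exists_smul_pref hw
  refine ⟨x, ?_⟩
  rintro ⟨t, ht⟩
  have h1 : ∀ s : MulAction.stabilizer G v, (s : G) = 1 := fun s =>
    Subgroup.mem_bot.1 (hv.le s.2)
  rw [h1, one_smul] at hs ht
  rw [hs] at ht
  exact hwC ht

lemma IsTypeOneSet.hasTypeOneCut {C : Set T.V} (hC : T.IsTypeOneSet g v C)
    (hconn : T.IsTurnConnected g v C) : T.HasTypeOneCut g v := by
  refine ⟨liftSubgraph g v C, colliftSubgraph g v C (liftVerts v C)ᶜ ?_ ?_, ⟨?_, ?_⟩, ?_, ?_,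
    hC.toIsCutSet.isConnected hC.nonempty hconn, hC.toIsCutSet.trivialMonodromy, ?_⟩
  · rintro e he ⟨s, hs⟩
    exact he ⟨s, hs, hC.closed _ hs _ (e.isTurn.smul_stabilizer s)⟩
  · rintro e he ⟨s, hs⟩
    exact he (liftEdges_tgt hs fun w hw => hC.closed _ hs w hw)
  · exact Set.union_compl_self _
  · exact Set.union_compl_self _
  · exact disjoint_compl_right
  · exact disjoint_compl_right
  · intro hv
    exact hC.toIsCutSet.exists_not_mem_liftVerts hv

/-- The class of `w₀` is the cut vertex. The turn from `w₀` inside `C` supplies a second vertex of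
`U`, because `C` contains no other translate of `w₀`. -/
lemma IsTypeTwoSet.hasTypeTwoCut {C : Set T.V} {w₀ : T.V} (hC : T.IsTypeTwoSet g v C w₀)
    (hconn : T.IsTurnConnected g v C) : T.HasTypeTwoCut g v := by
  obtain ⟨x₀, s₀, hs₀⟩ := WhVertex.exists_smul_pref (hC.adj w₀ hC.mem)
  have hx₀ : x₀ ∈ liftVerts v C := ⟨s₀, by rw [hs₀]; exact hC.mem⟩
  have hw₀ : ∀ (x : T.WhVertex v) (s : MulAction.stabilizer G v), (s : G) • x.pref = w₀ → x = x₀ :=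
    fun x s h => WhVertex.eq_of_smul_pref (h.trans hs₀.symm)
  refine ⟨liftSubgraph g v C, colliftSubgraph g v C ((liftVerts v C)ᶜ ∪ {x₀}) ?_ ?_, x₀,
    ⟨?_, ?_⟩, ?_, ?_, hC.toIsCutSet.isConnected ⟨_, hC.mem⟩ hconn,
    hC.toIsCutSet.trivialMonodromy, ?_, ?_⟩
  · intro e he
    by_contra hc
    simp only [Set.mem_union, Set.mem_compl_iff, not_or, not_not, Set.mem_singleton_iff] at hc
    obtain ⟨⟨s, hs⟩, hne⟩ := hc
    exact he ⟨s, hs, hC.closed _ hs (fun h => hne (hw₀ _ s h)) _ (e.isTurn.smul_stabilizer s)⟩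
  · intro e he
    by_contra hc
    simp only [Set.mem_union, Set.mem_compl_iff, not_or, not_not, Set.mem_singleton_iff] at hc
    obtain ⟨⟨s, hs⟩, hne⟩ := hc
    exact he (liftEdges_tgt hs fun w hw => hC.closed _ hs (fun h => hne (hw₀ _ s h)) w hw)
  · change liftVerts v C ∪ ((liftVerts v C)ᶜ ∪ {x₀}) = Set.univ
    rw [← Set.union_assoc, Set.union_compl_self, Set.univ_union]
  · exact Set.union_compl_self _
  · change liftVerts v C ∩ ((liftVerts v C)ᶜ ∪ {x₀}) = {x₀}
    rw [Set.inter_union_distrib_left, Set.inter_compl_self, Set.empty_union]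
    exact Set.inter_eq_right.2 (by simpa using hx₀)
  · exact disjoint_compl_right
  · obtain ⟨c, hc, hturn⟩ := hC.exists_turn
    obtain ⟨y, t, ht⟩ := WhVertex.exists_smul_pref hturn.symm.adj
    intro h
    have hy : y ∈ ({x₀} : Set (T.WhVertex v)) := h ▸ (⟨t, by rwa [ht]⟩ : y ∈ liftVerts v C)
    rw [Set.mem_singleton_iff] at hy
    subst hy
    have : s₀ = t := hC.toIsCutSet.eq_of_smul (by rw [hs₀]; exact hC.mem) (by rwa [ht])
    subst this
    exact hturn.ne (hs₀.symm.trans ht)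
  · intro hv h
    obtain ⟨x, hx⟩ := hC.toIsCutSet.exists_not_mem_liftVerts hv
    have : x ∈ ({x₀} : Set (T.WhVertex v)) := h ▸ (.inl hx : x ∈ (liftVerts v C)ᶜ ∪ {x₀})
    rw [Set.mem_singleton_iff] at this
    subst this
    exact hx hx₀

end GATree

end Grushko

/-! ### Finite sets of neighbours and admissible cuts -/

namespace Grushko

open SimpleGraph

namespace GATree

variable {G : Type u} [Group G] {k : ℕ} {A : Fin k → Subgroup G} {T : GATree A} {m : ℕ}
  {g : Fin m → G} {v : T.V}

/-- A non-trivial element of a vertex stabilizer has no finite forward orbit of neighbours. -/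
lemma not_forall_pow_smul_mem (hT : T.TrivialEdgeStabilizers)
    (htf : ∀ a : G, a ≠ 1 → ∀ n : ℤ, n ≠ 0 → a ^ n ≠ 1) {s : G} (hs : s • v = v) (hs1 : s ≠ 1)
    {c : T.V} (hc : T.graph.Adj v c) {C : Set T.V} (hC : C.Finite)
    (h : ∀ n : ℕ, s ^ n • c ∈ C) : False := by
  have key : ∀ i j : ℕ, s ^ i • c = s ^ (i + j) • c → j = 0 := by
    intro i j hij
    by_contra hj
    refine htf s hs1 j (by exact_mod_cast hj) ?_
    rw [zpow_natCast]
    refine hT _ v c hc (Subgroup.pow_mem (MulAction.stabilizer G v) hs j) ?_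
    rw [pow_add, mul_smul] at hij
    exact (smul_left_cancel _ hij).symm
  refine Set.infinite_of_injective_forall_mem (f := fun n : ℕ => s ^ n • c) ?_ h hC
  intro i j hij
  rcases le_total i j with hle | hle
  · obtain ⟨n, rfl⟩ := Nat.exists_eq_add_of_le hle
    rw [key i n hij, add_zero]
  · obtain ⟨n, rfl⟩ := Nat.exists_eq_add_of_le hle
    rw [key j n hij.symm, add_zero]

lemma IsTurn.smul_of_fixes {w w' : T.V} (h : T.IsTurn g v w w') {s : G} (hs : s • v = v) :
    T.IsTurn g v (s • w) (s • w') := by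
  have := h.smul s
  rwa [hs] at this

lemma reflTransGen_turn_smul {C : Set T.V} {s : G} (hs : s • v = v) {c c' : T.V}
    (h : Relation.ReflTransGen (fun x y => T.IsTurn g v x y ∧ y ∈ C) c c') {D : Set T.V}
    (hD : ∀ d ∈ C, s • d ∈ D) :
    Relation.ReflTransGen (fun x y => T.IsTurn g v x y ∧ y ∈ D) (s • c) (s • c') :=
  h.lift (fun x => s • x) fun _ _ hxy => ⟨hxy.1.smul_of_fixes hs, hD _ hxy.2⟩

/-- Finite components of the graph of turns. -/
lemma isTypeOneSet_of_finite (hT : T.TrivialEdgeStabilizers)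
    (htf : ∀ a : G, a ≠ 1 → ∀ n : ℤ, n ≠ 0 → a ^ n ≠ 1) {C : Set T.V} (hfin : C.Finite)
    (hne : C.Nonempty) (hadj : ∀ c ∈ C, T.graph.Adj v c)
    (hclosed : ∀ c ∈ C, ∀ w, T.IsTurn g v c w → w ∈ C) (hconn : T.IsTurnConnected g v C)
    (hproper : ∃ w, T.graph.Adj v w ∧ w ∉ C) : T.IsTypeOneSet g v C := by
  refine ⟨⟨hadj, fun s hs c hc hsc => ?_, hproper⟩, hne, hclosed⟩
  by_contra hs1
  -- The translate of `C` is connected and meets the closed set `C`, so it lies in `C`; the powers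
  -- of `s` then have a finite orbit of neighbours.
  have hmap : ∀ d ∈ C, s • d ∈ C := by
    intro d hd
    have h1 := reflTransGen_turn_smul hs (hconn c hc d hd) (D := Set.univ) fun _ _ => trivial
    generalize s • d = z at h1 ⊢
    induction h1 with
    | refl => exact hsc
    | tail _ h2 ih => exact hclosed _ ih _ h2.1
  refine not_forall_pow_smul_mem hT htf hs hs1 (hadj c hc) hfin fun n => ?_
  induction n with
  | zero => simpa using hc
  | succ n ih => rw [pow_succ', mul_smul]; exact hmap _ ih

lemma IsTurnConnected.of_base {C : Set T.V} {c₁ : T.V}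
    (h : ∀ c ∈ C, Relation.ReflTransGen (fun x y => T.IsTurn g v x y ∧ y ∈ C) c₁ c)
    (hc₁ : c₁ ∈ C) : T.IsTurnConnected g v C := by
  have hsymm : ∀ c, Relation.ReflTransGen (fun x y => T.IsTurn g v x y ∧ y ∈ C) c₁ c →
      Relation.ReflTransGen (fun x y => T.IsTurn g v x y ∧ y ∈ C) c c₁ := by
    intro c hc
    have key : Relation.ReflTransGen (fun x y => T.IsTurn g v x y ∧ y ∈ C) c c₁ ∧ c ∈ C := by
      induction hc with
      | refl => exact ⟨.refl, hc₁⟩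
      | tail _ h2 ih => exact ⟨.head ⟨h2.1.symm, ih.2⟩ ih.1, h2.2⟩
    exact key.1
  exact fun c hc c' hc' => (hsymm c (h c hc)).trans (h c' hc')

/-- A finite set of neighbours, from which turns lead only to one further neighbour, gives an
admissible cut. -/
theorem hasCut_of_finite (hT : T.TrivialEdgeStabilizers)
    (htf : ∀ a : G, a ≠ 1 → ∀ n : ℤ, n ≠ 0 → a ^ n ≠ 1) {C₁ E : Set T.V} (hfin : C₁.Finite)
    (hne : C₁.Nonempty) (hadj : ∀ c ∈ C₁, T.graph.Adj v c) (hE : E.Subsingleton)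
    (hCE : Disjoint C₁ E)
    (hclosed : ∀ c ∈ C₁, ∀ w, T.IsTurn g v c w → w ∈ C₁ ∪ E)
    (hproper : ∃ w, T.graph.Adj v w ∧ w ∉ C₁ ∪ E) :
    T.HasTypeOneCut g v ∨ T.HasTypeTwoCut g v := by
  obtain ⟨c₁, hc₁⟩ := hne
  -- `K` is a component of `C₁` for turns that avoid `E`.
  set K : Set T.V := {c | Relation.ReflTransGen (fun x y => T.IsTurn g v x y ∧ y ∉ E) c₁ c} with hK
  have hKC : K ⊆ C₁ := by
    intro c hc
    induction hc with
    | refl => exact hc₁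
    | tail _ h2 ih => exact (hclosed _ ih _ h2.1).resolve_right h2.2
  have hc₁K : c₁ ∈ K := Relation.ReflTransGen.refl
  have hKE : ∀ c ∈ K, c ∉ E := fun c hc hcE => Set.disjoint_left.1 hCE (hKC hc) hcE
  have hKfin : K.Finite := hfin.subset hKC
  have hKclosed : ∀ c ∈ K, ∀ w, T.IsTurn g v c w → w ∈ K ∪ E := by
    intro c hc w hw
    by_cases hwE : w ∈ E
    · exact .inr hwE
    · exact .inl (Relation.ReflTransGen.tail hc ⟨hw, hwE⟩)
  have hKconn' : ∀ D : Set T.V, K ⊆ D → ∀ c ∈ K,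
      Relation.ReflTransGen (fun x y => T.IsTurn g v x y ∧ y ∈ D) c₁ c := by
    intro D hD c hc
    induction hc with
    | refl => exact .refl
    | tail h1 h2 ih => exact .tail ih ⟨h2.1, hD (.tail h1 h2)⟩
  obtain ⟨w₁, hw₁, hw₁'⟩ := hproper
  have hw₁K : w₁ ∉ K ∪ E := fun h => hw₁' (h.imp_left fun h => hKC h)
  by_cases hcase : ∀ c ∈ K, ∀ w, T.IsTurn g v c w → w ∉ E
  · left
    refine (isTypeOneSet_of_finite hT htf hKfin ⟨c₁, hc₁K⟩ (fun c hc => hadj c (hKC hc)) ?_ ?_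
      ⟨w₁, hw₁, fun h => hw₁K (.inl h)⟩).hasTypeOneCut ?_
    · exact fun c hc w hw => (hKclosed c hc w hw).resolve_right (hcase c hc w hw)
    · exact .of_base (hKconn' K le_rfl) hc₁K
    · exact .of_base (hKconn' K le_rfl) hc₁K
  push Not at hcase
  obtain ⟨c₂, hc₂, w₀, hturn, hw₀⟩ := hcase
  have hEw : E = {w₀} := hE.eq_singleton_of_mem hw₀
  subst hEw
  have hw₀adj := hturn.symm.adj
  have hw₀K : w₀ ∉ K := fun h => hKE _ h rfl
  have hKc : T.IsTurnConnected g v K := .of_base (hKconn' K le_rfl) hc₁K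
  -- Turns from `K` lead to `K` or to `w₀`. If `w₀` is not in the connected translate of `K`, this
  -- translate cannot leave `K` once it meets it.
  have hmapK : ∀ s : G, s • v = v → s⁻¹ • w₀ ∉ K → ∀ c ∈ K, s • c ∈ K → ∀ d ∈ K, s • d ∈ K := by
    intro s hs hβ c hc hsc d hd
    have h1 := reflTransGen_turn_smul hs (hKc c hc d hd) (D := {y | s⁻¹ • y ∈ K})
      fun y hy => by simpa using hy
    generalize s • d = z at h1 ⊢
    induction h1 with
    | refl => exact hsc
    | tail _ h2 ih =>
      refine (hKclosed _ ih _ h2.1).resolve_right fun h => hβ ?_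
      rw [← Set.mem_singleton_iff.1 h]
      exact h2.2
  -- Translates of `K ∪ {w₀}` can overlap only if a non-trivial `s` takes `w₀` into `K`. In that
  -- case either the inverse does the same, and `K` with its translate is a finite closed component,
  -- or `s` maps the finite set `K` into itself.
  by_cases hα : ∃ s : G, s • v = v ∧ s ≠ 1 ∧ s • w₀ ∈ K
  · obtain ⟨s, hs, hs1, hsw⟩ := hα
    have hsv' : s⁻¹ • v = v := by rw [inv_smul_eq_iff, hs]
    by_cases hβ : s⁻¹ • w₀ ∈ K
    · -- the component of `w₀` is finite
      left
      set C : Set T.V := K ∪ {y | s⁻¹ • y ∈ K} with hC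
      have hw₀C : w₀ ∈ C := .inr hβ
      have hCfin : C.Finite := hKfin.union (hKfin.preimage (MulAction.injective s⁻¹).injOn)
      have hCadj : ∀ c ∈ C, T.graph.Adj v c := by
        rintro c (hc | hc)
        · exact hadj c (hKC hc)
        · have := T.adj_smul s _ _ (hadj _ (hKC hc))
          rwa [hs, smul_inv_smul] at this
      have hCclosed : ∀ c ∈ C, ∀ w, T.IsTurn g v c w → w ∈ C := by
        rintro c (hc | hc) w hw
        · rcases hKclosed c hc w hw with h | h
          · exact .inl h
          · rw [Set.mem_singleton_iff.1 h]; exact hw₀C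
        · rcases hKclosed _ hc _ (hw.smul_of_fixes hsv') with h | h
          · exact .inr h
          · rw [Set.mem_singleton_iff, inv_smul_eq_iff] at h
            rw [h]; exact .inl hsw
      have hCconn : T.IsTurnConnected g v C := by
        have hw₀path : Relation.ReflTransGen (fun x y => T.IsTurn g v x y ∧ y ∈ C) c₁ w₀ :=
          (hKconn' C Set.subset_union_left c₂ hc₂).tail ⟨hturn, hw₀C⟩
        have hsK : ∀ d ∈ K, s • d ∈ C := fun d hd => .inr (by simpa using hd)
        refine .of_base (c₁ := c₁) ?_ (.inl hc₁K)
        rintro c (hc | hc)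
        · exact hKconn' C Set.subset_union_left c hc
        · refine hw₀path.trans ?_
          have := reflTransGen_turn_smul hs (hKc _ hβ _ hc) hsK
          rwa [smul_inv_smul, smul_inv_smul] at this
      refine (isTypeOneSet_of_finite hT htf hCfin ⟨_, hw₀C⟩ hCadj hCclosed hCconn ?_).hasTypeOneCut
        hCconn
      exact ((T.isFreeGTree hT).infinite_neighbors htf hw₁ hs1 hs).exists_notMem_finite hCfin
    · -- `s` maps `K` into itself
      exfalso
      have hmap := hmapK s hs hβ c₂ hc₂ <|
        (hKclosed _ hsw _ (hturn.symm.smul_of_fixes hs)).resolve_right fun h => by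
          rw [Set.mem_singleton_iff, ← eq_inv_smul_iff] at h
          exact hβ (h ▸ hc₂)
      refine not_forall_pow_smul_mem hT htf hs hs1 (hadj c₁ hc₁) hKfin fun n => ?_
      induction n with
      | zero => simpa using hc₁K
      | succ n ih => rw [pow_succ', mul_smul]; exact hmap _ ih
  · push Not at hα
    right
    have hCconn : T.IsTurnConnected g v (K ∪ {w₀}) := by
      refine .of_base (c₁ := c₁) ?_ (.inl hc₁K)
      rintro c (hc | hc)
      · exact hKconn' _ Set.subset_union_left c hc
      · rw [Set.mem_singleton_iff.1 hc]
        exact (hKconn' _ Set.subset_union_left c₂ hc₂).tail ⟨hturn, .inr rfl⟩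
    refine IsTypeTwoSet.hasTypeTwoCut (w₀ := w₀) (C := K ∪ {w₀})
      ⟨⟨?_, ?_, ⟨w₁, hw₁, hw₁K⟩⟩, .inr rfl, ?_, ⟨c₂, .inl hc₂, hturn.symm⟩⟩ hCconn
    · rintro c (hc | hc)
      · exact hadj c (hKC hc)
      · rw [Set.mem_singleton_iff.1 hc]; exact hw₀adj
    · intro s hs c hc hsc
      by_contra hs1
      have hs' : s⁻¹ • v = v := by rw [inv_smul_eq_iff, hs]
      have hβ := hα s⁻¹ hs' (inv_ne_one.2 hs1)
      rcases hc with hc | hc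
      · rcases hsc with hsc | hsc
        · have hmap := hmapK s hs hβ c hc hsc
          refine not_forall_pow_smul_mem hT htf hs hs1 (hadj c (hKC hc)) hKfin fun n => ?_
          induction n with
          | zero => simpa using hc
          | succ n ih => rw [pow_succ', mul_smul]; exact hmap _ ih
        · rw [Set.mem_singleton_iff, ← eq_inv_smul_iff] at hsc
          exact hβ (hsc ▸ hc)
      · rw [Set.mem_singleton_iff.1 hc] at hsc
        rcases hsc with hsc | hsc
        · exact hα s hs hs1 hsc
        · exact hs1 (hT s v w₀ hw₀adj hs hsc)
    · rintro c (hc | hc) hcw w hw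
      · exact hKclosed c hc w hw
      · exact absurd hc hcw

end GATree

end Grushko

/-! ### Separating sets against admissible cuts -/

namespace Grushko

open SimpleGraph Filter

namespace GATree

variable {G : Type u} [Group G] {k : ℕ} {A : Fin k → Subgroup G} {T : GATree A} {m : ℕ}
  {g : Fin m → G} {v : T.V}

/-- The powers of the conjugated generator push the vertex out along both halves of the axis. Pure
directions of different colours would then contain infinitely many of these points in `P` and
infinitely many outside. -/
lemma IsTurn.not_separated {P : Set T.V} (hP : Separates T.graph g P) {w w' : T.V}
    (h : T.IsTurn g v w w') (h1 : (side T.graph v w ∩ P).Finite)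
    (h2 : (side T.graph v w' ∩ Pᶜ).Finite) : False := by
  obtain ⟨a, j, l, n, ⟨t, ht, hl⟩, rfl, h⟩ := h
  have hz : ∀ i : ℤ, (a * g j * a⁻¹) ^ i • l.pt n = l.pt (n + i * t) := fun i => axis_zpow hl i n
  have hinj : Function.Injective fun i : ℤ => l.pt (n + i * t) := by
    intro i i' hi
    have := l.inj hi
    simp only [add_right_inj, mul_eq_mul_right_iff, Nat.cast_eq_zero] at this
    omega
  have hpos : ∀ {Q : Set T.V}, (side T.graph (l.pt n) (l.pt (n + 1)) ∩ Q).Finite →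
      {i : ℤ | (a * g j * a⁻¹) ^ i • l.pt n ∉ Q}.Finite → False := by
    intro Q hQ hQ'
    have h1 := (hQ.preimage (f := fun i : ℤ => l.pt (n + i * t)) hinj.injOn).union hQ'
    refine Set.infinite_of_injective_forall_mem (f := fun i : ℕ => (i + 1 : ℤ))
      (fun i i' hi => by simp only at hi; omega) (fun i => ?_) h1
    by_cases hi : l.pt (n + (i + 1 : ℤ) * t) ∈ Q
    · refine .inl ⟨?_, hi⟩
      have h3 := l.mem_side_pos n ((i + 1) * t - 1)
      have h4 : 1 ≤ (i + 1) * t := by nlinarith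
      rw [Nat.cast_sub h4] at h3
      convert h3 using 2
      push_cast; ring
    · exact .inr (by rw [Set.mem_ofPred_eq, hz]; exact hi)
  have hneg : ∀ {Q : Set T.V}, (side T.graph (l.pt n) (l.pt (n - 1)) ∩ Q).Finite →
      {i : ℤ | (a * g j * a⁻¹) ^ i • l.pt n ∉ Q}.Finite → False := by
    intro Q hQ hQ'
    have h1 := (hQ.preimage (f := fun i : ℤ => l.pt (n + i * t)) hinj.injOn).union hQ'
    refine Set.infinite_of_injective_forall_mem (f := fun i : ℕ => (-(i + 1) : ℤ))
      (fun i i' hi => by simp only at hi; omega) (fun i => ?_) h1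
    by_cases hi : l.pt (n + (-(i + 1) : ℤ) * t) ∈ Q
    · refine .inl ⟨?_, hi⟩
      have h3 := l.mem_side_neg n ((i + 1) * t - 1)
      have h4 : 1 ≤ (i + 1) * t := by nlinarith
      rw [Nat.cast_sub h4] at h3
      convert h3 using 2
      push_cast; ring
    · exact .inr (by rw [Set.mem_ofPred_eq, hz]; exact hi)
  have hlines := hP.lines a j (l.pt n)
  rcases h with ⟨rfl, rfl⟩ | ⟨rfl, rfl⟩ <;> rcases hlines with h3 | h3
  · exact hpos h2 (by simpa using h3)
  · exact hneg h1 h3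
  · exact hneg h2 (by simpa using h3)
  · exact hpos h1 h3

lemma mem_iff_of_walk {V : Type*} {Γ : SimpleGraph V} {P : Set V} {x y : V} (p : Γ.Walk x y)
    (h : ∀ d ∈ p.darts, (d.fst, d.snd) ∉ coboundary Γ P ∧ (d.snd, d.fst) ∉ coboundary Γ P) :
    x ∈ P ↔ y ∈ P := by
  constructor
  · intro hx
    by_contra hy
    obtain ⟨d, hd, h1, h2⟩ := p.exists_boundary_dart P hx hy
    exact (h d hd).1 ⟨d.adj, h1, h2⟩
  · intro hy
    by_contra hx
    obtain ⟨d, hd, h1, h2⟩ := p.exists_boundary_dart Pᶜ hx (by simpa using hy)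
    exact (h d hd).2 ⟨d.adj.symm, by simpa using h2, h1⟩

lemma mem_iff_of_side {V : Type*} {Γ : SimpleGraph V} {P : Set V} {v w x : V}
    (h : ∀ e ∈ coboundary Γ P, e.1 ∉ side Γ v w ∧ e.2 ∉ side Γ v w) (hx : x ∈ side Γ v w) :
    w ∈ P ↔ x ∈ P := by
  classical
  obtain ⟨p, hp⟩ := hx
  have key : ∀ y ∈ p.support, y ∈ side Γ v w := fun y hy =>
    ⟨p.takeUntil y hy, fun hv => hp (p.support_takeUntil_subset_support hy hv)⟩
  refine mem_iff_of_walk p fun d hd => ⟨fun hc => ?_, fun hc => ?_⟩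
  · exact (h _ hc).1 (key _ (p.dart_fst_mem_support_of_mem_darts hd))
  · exact (h _ hc).2 (key _ (p.dart_fst_mem_support_of_mem_darts hd))

/-- A vertex at which all but at most one of the directions are pure. -/
lemma exists_pure_vertex (T : GATree A) {P : Set T.V} (hinf : P.Infinite) (hinf' : Pᶜ.Infinite)
    (hP : (coboundary T.graph P).Finite) : ∃ (v : T.V) (E : Set T.V), E.Subsingleton ∧
      (∀ w, T.graph.Adj v w → w ∉ E →
        (side T.graph v w ∩ P).Finite ∨ (side T.graph v w ∩ Pᶜ).Finite) ∧
      ({y | ∀ e ∈ E, y ∉ side T.graph v e} ∩ P).Infinite ∧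
      ({y | ∀ e ∈ E, y ∉ side T.graph v e} ∩ Pᶜ).Infinite := by
  by_cases hmix : ∃ a b, T.graph.Adj a b ∧ (side T.graph a b ∩ P).Infinite ∧
      (side T.graph a b ∩ Pᶜ).Infinite
  · obtain ⟨a₀, b₀, hab₀, hmix₀⟩ := hmix
    by_cases hstep : ∀ a b, T.graph.Adj a b →
        ((side T.graph a b ∩ P).Infinite ∧ (side T.graph a b ∩ Pᶜ).Infinite) →
        ∃ c, T.graph.Adj b c ∧ c ≠ a ∧
          ((side T.graph b c ∩ P).Infinite ∧ (side T.graph b c ∩ Pᶜ).Infinite)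
    · exfalso
      obtain ⟨r, -, -, hr, hr2, hR⟩ := exists_ray hstep hab₀ hmix₀
      have h1 : ∀ᶠ n in atTop, ∀ e ∈ coboundary T.graph P,
          e.1 ∉ side T.graph (r n) (r (n + 1)) ∧ e.2 ∉ side T.graph (r n) (r (n + 1)) := by
        refine (Set.Finite.eventually_all hP).2 fun e _ => ?_
        exact (eventually_atTop.2 (eventually_not_mem_side T.isTree r hr hr2 e.1)).and
          (eventually_atTop.2 (eventually_not_mem_side T.isTree r hr hr2 e.2))
      obtain ⟨n, hn⟩ := h1.exists
      obtain ⟨x, hx, hxP⟩ := (hR n).1.nonempty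
      obtain ⟨y, hy, hyP⟩ := (hR n).2.nonempty
      exact hyP ((mem_iff_of_side hn hy).1 ((mem_iff_of_side hn hx).2 hxP))
    -- Beyond the last mixed edge all directions at `b` are pure; only the one back to `a` may fail
    -- to be.
    · push Not at hstep
      obtain ⟨a, b, hab, hm, hc⟩ := hstep
      have hset : {y | ∀ e ∈ ({a} : Set T.V), y ∉ side T.graph b e} = side T.graph a b := by
        ext y
        simp only [Set.mem_singleton_iff, forall_eq, Set.mem_ofPred_eq]
        exact not_mem_side_iff T.isTree hab.symm
      refine ⟨b, {a}, Set.subsingleton_singleton, fun w hw hwa => ?_, ?_⟩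
      · by_cases h1 : (side T.graph b w ∩ P).Finite
        · exact .inl h1
        · exact .inr (hc w hw hwa h1)
      · rw [hset]
        exact hm
  · push Not at hmix
    obtain ⟨v⟩ := T.isTree.1.nonempty
    refine ⟨v, ∅, Set.subsingleton_empty, fun w hw _ => ?_, by simpa using hinf,
      by simpa using hinf'⟩
    by_cases h1 : (side T.graph v w ∩ P).Finite
    · exact .inl h1
    · exact .inr (hmix v w hw h1)

/-- If the lines are separated, then some Whitehead graph has an admissible cut. -/
theorem not_isWhiteheadReduced_of_separates (hT : T.TrivialEdgeStabilizers)
    (htf : ∀ a : G, a ≠ 1 → ∀ n : ℤ, n ≠ 0 → a ^ n ≠ 1) {P : Set T.V}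
    (hP : Separates T.graph g P) : ¬ T.IsWhiteheadReduced g := by
  have h := T.isFreeGTree hT
  obtain ⟨v, E, hE, hpure, hR, hR'⟩ :=
    exists_pure_vertex T hP.infinite hP.infinite_compl hP.finite_coboundary
  intro hred
  refine hred v ?_
  -- the colour of `v` is made to be that of `Q`
  obtain ⟨Q, hQ, hvQ, hpure, hR, hR'⟩ : ∃ Q, Separates T.graph g Q ∧ v ∈ Q ∧
      (∀ w, T.graph.Adj v w → w ∉ E →
        (side T.graph v w ∩ Q).Finite ∨ (side T.graph v w ∩ Qᶜ).Finite) ∧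
      ({y | ∀ e ∈ E, y ∉ side T.graph v e} ∩ Q).Infinite ∧
      ({y | ∀ e ∈ E, y ∉ side T.graph v e} ∩ Qᶜ).Infinite := by
    by_cases hv : v ∈ P
    · exact ⟨P, hP, hv, hpure, hR, hR'⟩
    · exact ⟨Pᶜ, hP.compl, hv, fun w hw hwE => by rw [compl_compl]; exact (hpure w hw hwE).symm,
        hR', by rwa [compl_compl]⟩
  clear hP
  have hside_inf : ∀ w, T.graph.Adj v w → (side T.graph v w).Infinite := fun w hw =>
    (h.infinite_orbit_inter_side T.isMinimalGTree hw v).mono fun y hy => hy.1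
  have hboth : ∀ w, T.graph.Adj v w → (side T.graph v w ∩ Q).Finite →
      (side T.graph v w ∩ Qᶜ).Finite → False := fun w hw h1 h2 => hside_inf w hw
    ((h1.union h2).subset fun y hy => by
      by_cases hyQ : y ∈ Q
      · exact .inl ⟨hy, hyQ⟩
      · exact .inr ⟨hy, hyQ⟩)
  -- Since `v` itself is in `Q`, a direction that is not contained in `Q` contains an end of a
  -- coboundary edge. So there are finitely many of them.
  set bad : Set T.V := {w | T.graph.Adj v w ∧ ∃ y ∈ side T.graph v w, y ∉ Q} with hbad
  have hbadfin : bad.Finite := by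
    have h1 : (⋃ e ∈ coboundary T.graph Q, ({w | T.graph.Adj v w ∧ e.1 ∈ side T.graph v w} ∪
        {w | T.graph.Adj v w ∧ e.2 ∈ side T.graph v w})).Finite := by
      refine hQ.finite_coboundary.biUnion fun e _ => Set.Finite.union ?_ ?_
      · refine Set.Subsingleton.finite ?_
        rintro w ⟨hw, hw'⟩ z ⟨hz, hz'⟩
        exact side_unique T.isTree hw hz hw' hz'
      · refine Set.Subsingleton.finite ?_
        rintro w ⟨hw, hw'⟩ z ⟨hz, hz'⟩
        exact side_unique T.isTree hw hz hw' hz'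
    refine h1.subset ?_
    rintro w ⟨hw, y, hy, hyQ⟩
    by_contra hc
    simp only [Set.mem_iUnion₂, Set.mem_union, Set.mem_ofPred_eq, not_exists, not_or, not_and] at hc
    have h2 : w ∉ Q := fun h3 => hyQ ((mem_iff_of_side
      (fun e he => ⟨(hc e he).1 hw, (hc e he).2 hw⟩) hy).1 h3)
    exact (hc (v, w) ⟨hw, hvQ, h2⟩).2 hw (mem_side_self hw.ne)
  set C₁ : Set T.V := {w | T.graph.Adj v w ∧ w ∉ E ∧ (side T.graph v w ∩ Q).Finite} with hC₁
  have hC₁bad : C₁ ⊆ bad := by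
    rintro w ⟨hw, -, hfin⟩
    refine ⟨hw, ?_⟩
    by_contra! hc
    exact hside_inf w hw (hfin.subset fun y hy => ⟨hy, hc y hy⟩)
  have hC₁fin := hbadfin.subset hC₁bad
  refine hasCut_of_finite hT htf (C₁ := C₁) (E := E) hC₁fin ?_ (fun c hc => hc.1) hE ?_ ?_ ?_
  -- Without directions of the opposite colour, the part outside `E` would meet the complement of
  -- `Q` in a finite set.
  · by_contra hempty
    rw [Set.not_nonempty_iff_eq_empty] at hempty
    have h1 : (⋃ w ∈ bad \ E, (side T.graph v w ∩ Qᶜ)).Finite := by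
      refine (hbadfin.sdiff).biUnion fun w hw => ?_
      refine (hpure w hw.1.1 hw.2).resolve_left fun h2 => ?_
      have : w ∈ C₁ := ⟨hw.1.1, hw.2, h2⟩
      rw [hempty] at this
      exact this
    refine hR' (h1.subset ?_)
    rintro y ⟨hy, hyQ⟩
    have hyv : y ≠ v := by rintro rfl; exact hyQ hvQ
    obtain ⟨w, hw, hyw⟩ := exists_side T.isTree hyv
    exact Set.mem_iUnion₂.2 ⟨w, ⟨⟨hw, y, hyw, hyQ⟩, fun hwE => hy w hwE hyw⟩, hyw, hyQ⟩
  · exact Set.disjoint_left.2 fun w hw hwE => hw.2.1 hwE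
  · intro c hc w hturn
    by_cases hwE : w ∈ E
    · exact .inr hwE
    · refine .inl ⟨hturn.symm.adj, hwE, (hpure w hturn.symm.adj hwE).resolve_right fun h2 => ?_⟩
      exact hturn.not_separated hQ hc.2.2 h2
  -- If all directions outside `E` had the opposite colour, this part would meet `Q` in a finite
  -- set.
  · by_contra! hall
    have h1 : ({v} ∪ ⋃ w ∈ C₁, (side T.graph v w ∩ Q)).Finite :=
      (Set.finite_singleton v).union (hC₁fin.biUnion fun w hw => hw.2.2)
    refine hR (h1.subset ?_)
    rintro y ⟨hy, hyQ⟩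
    by_cases hyv : y = v
    · exact .inl hyv
    · obtain ⟨w, hw, hyw⟩ := exists_side T.isTree hyv
      rcases hall w hw with hw1 | hw1
      · exact .inr (Set.mem_iUnion₂.2 ⟨w, hw1, hyw, hyQ⟩)
      · exact absurd hyw (hy w hw1)

/-! ### Cut sets from admissible cuts -/

namespace WhSubgraph

variable {U : T.WhSubgraph g v}

lemma Path.trans {x y z : T.WhVertex v} {a b : MulAction.stabilizer G v} (h : U.Path x y a)
    (h' : U.Path y z b) : U.Path x z (a * b) := by
  induction h with
  | nil => simpa using h'
  | cons e he y a _ ih => rw [mul_assoc]; exact .cons e he _ _ (ih h')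

lemma Path.tgt_mem {x y : T.WhVertex v} {a : MulAction.stabilizer G v} (h : U.Path x y a) :
    y ∈ U.verts := by
  induction h with
  | nil x hx => exact hx
  | cons e he y a _ ih => exact ih

lemma Path.edge {e : T.WhEdge g v} (he : e ∈ U.edges) : U.Path e.src e.tgt e.label := by
  have := Path.cons e he _ _ (.nil _ (U.tgt_mem e he))
  rwa [mul_one] at this

end WhSubgraph

lemma WhEdge.exists_reverse (e : T.WhEdge g v) : ∃ e' : T.WhEdge g v, e.IsReverse e' := by
  have hs : (e.label : G)⁻¹ • v = v := by
    rw [inv_smul_eq_iff]; exact (show (e.label : G) • v = v from e.label.2).symm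
  have hmem : ∀ {c w y : T.V}, T.graph.Adj v w → y ∈ T.direction v w →
      (e.label : G)⁻¹ • y ∈ T.direction v ((e.label : G)⁻¹ • w) := by
    rintro c w y hw ⟨p, hp⟩
    refine ⟨p.map (⟨fun y => (e.label : G)⁻¹ • y, fun {a b} => T.adj_smul _ a b⟩ :
      T.graph →g T.graph), ?_⟩
    rw [Walk.support_map, List.mem_map]
    rintro ⟨z, hz, hz'⟩
    have hz' : (e.label : G)⁻¹ • z = v := hz'
    rw [inv_smul_eq_iff, show (e.label : G) • v = v from e.label.2] at hz'
    exact hp (hz' ▸ hz)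
  refine ⟨⟨e.tgt, e.src, e.label⁻¹, (fun x => (e.label : G)⁻¹ • x) '' e.line, ?_, ?_, ?_, ?_⟩,
    rfl, rfl, rfl, rfl⟩
  · obtain ⟨a, j, l, hl, hX⟩ := e.line_mem
    refine ⟨(e.label : G)⁻¹ * a, j, l.smul (e.label : G)⁻¹, ?_, ?_⟩
    · have := hl.smul (e.label : G)⁻¹
      rwa [show (e.label : G)⁻¹ * (a * g j * a⁻¹) * (e.label : G)⁻¹⁻¹ =
        (e.label : G)⁻¹ * a * g j * ((e.label : G)⁻¹ * a)⁻¹ by group] at this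
    · rw [hX, ← Set.range_comp]
      rfl
  · obtain ⟨y, hy, hy'⟩ := e.meets_tgt
    refine ⟨_, ⟨y, hy, rfl⟩, ?_⟩
    have := hmem (c := v) e.isTurn.symm.adj hy'
    rwa [inv_smul_smul] at this
  · obtain ⟨y, hy, hy'⟩ := e.meets_src
    exact ⟨_, ⟨y, hy, rfl⟩, hmem (c := v) e.src.adj_pref hy'⟩
  · intro h
    refine e.distinct ?_
    rw [h]
    change e.src.pref = (e.label : G) • (e.label : G)⁻¹ • e.src.pref
    rw [smul_inv_smul]

lemma WhSubgraph.Path.reverse {U : T.WhSubgraph g v} {x y : T.WhVertex v}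
    {a : MulAction.stabilizer G v} (h : U.Path x y a) : U.Path y x a⁻¹ := by
  induction h with
  | nil x hx => rw [inv_one]; exact .nil x hx
  | cons e he y a _ ih =>
    obtain ⟨e', he'⟩ := e.exists_reverse
    have h1 := Path.edge (U.reverse_mem e he e' he')
    rw [he'.1, he'.2.1, he'.2.2.1] at h1
    rw [mul_inv_rev]
    exact ih.trans h1

/-- The lift of a connected subgraph with trivial monodromy. -/
def unfold (U : T.WhSubgraph g v) (x₀ : T.WhVertex v) : Set T.V :=
  {w | ∃ (y : T.WhVertex v) (a : MulAction.stabilizer G v), U.Path x₀ y a ∧ (a : G) • y.pref = w}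

lemma stabilizer_eq_one_of_smul (hT : T.TrivialEdgeStabilizers) {s : MulAction.stabilizer G v}
    {w : T.V} (hw : T.graph.Adj v w) (h : (s : G) • w = w) : s = 1 :=
  Subtype.ext (hT s v w hw s.2 h)

lemma path_of_smul_mem_unfold (hT : T.TrivialEdgeStabilizers) {U : T.WhSubgraph g v}
    {x₀ y : T.WhVertex v} {a : MulAction.stabilizer G v} (h : (a : G) • y.pref ∈ unfold U x₀) :
    U.Path x₀ y a := by
  obtain ⟨y', a', hp, he⟩ := h
  have := WhVertex.eq_of_smul_pref he
  subst this
  have h1 : a⁻¹ * a' = 1 := by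
    refine stabilizer_eq_one_of_smul hT y'.adj_pref ?_
    rw [Subgroup.coe_mul, mul_smul, he, ← mul_smul, ← Subgroup.coe_mul]
    simp
  rw [inv_mul_eq_one] at h1
  rwa [h1]

lemma unfold_adj {U : T.WhSubgraph g v} {x₀ : T.WhVertex v} {c : T.V} (hc : c ∈ unfold U x₀) :
    T.graph.Adj v c := by
  obtain ⟨y, a, -, rfl⟩ := hc
  have := T.adj_smul (a : G) _ _ y.adj_pref
  rwa [show (a : G) • v = v from a.2] at this

/-- A path to a vertex and the inverse of a path to its translate by `s` compose to a closed path
with label `s`, which is trivial by the monodromy condition. -/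
lemma unfold_disjoint (hT : T.TrivialEdgeStabilizers) {U : T.WhSubgraph g v}
    (hU : U.TrivialMonodromy) {x₀ : T.WhVertex v} (hx₀ : x₀ ∈ U.verts) {s : G} (hs : s • v = v)
    {c : T.V} (hc : c ∈ unfold U x₀) (hsc : s • c ∈ unfold U x₀) : s = 1 := by
  obtain ⟨y, a, hp, rfl⟩ := hc
  rw [← mul_smul] at hsc
  have h1 := path_of_smul_mem_unfold hT (a := ⟨s, hs⟩ * a) hsc
  have h2 : (⟨s, hs⟩ : MulAction.stabilizer G v) * a * a⁻¹ ∈ U.monodromy x₀ :=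
    Subgroup.subset_closure (h1.trans hp.reverse)
  rw [hU x₀ hx₀, Subgroup.mem_bot, mul_inv_cancel_right] at h2
  exact congrArg Subtype.val h2

/-- All Whitehead edges at a vertex outside `W` belong to `U`, so a turn from its lift prolongs the
path. -/
lemma unfold_closed {U W : T.WhSubgraph g v} (hcov : U.Covers W) {x₀ y : T.WhVertex v}
    {a : MulAction.stabilizer G v} (hp : U.Path x₀ y a) (hy : y ∉ W.verts) {w : T.V}
    (hturn : T.IsTurn g v ((a : G) • y.pref) w) : w ∈ unfold U x₀ := by
  obtain ⟨z, b, rfl⟩ := WhVertex.exists_smul_pref hturn.symm.adj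
  have h1 := hturn.smul_stabilizer a⁻¹
  have e1 : ((a⁻¹ : MulAction.stabilizer G v) : G) • (a : G) • y.pref = y.pref := by simp
  rw [e1, ← mul_smul, ← Subgroup.coe_mul] at h1
  obtain ⟨e, rfl, rfl, he⟩ := h1.exists_whEdge
  have heU : e ∈ U.edges := by
    have : e ∈ U.edges ∪ W.edges := hcov.2 ▸ Set.mem_univ e
    exact this.resolve_right fun h => hy (W.src_mem e h)
  have h2 := hp.trans (WhSubgraph.Path.edge heU)
  rw [he, mul_inv_cancel_left] at h2
  exact ⟨_, _, h2, rfl⟩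

lemma unfold_proper (hT : T.TrivialEdgeStabilizers) {U : T.WhSubgraph g v}
    (hU : U.TrivialMonodromy) {x₀ : T.WhVertex v} (hx₀ : x₀ ∈ U.verts)
    (h : MulAction.stabilizer G v = ⊥ → ∃ y, y ∉ U.verts) :
    ∃ w, T.graph.Adj v w ∧ w ∉ unfold U x₀ := by
  by_cases hv : MulAction.stabilizer G v = ⊥
  · obtain ⟨y, hy⟩ := h hv
    refine ⟨y.pref, y.adj_pref, fun hmem => hy ?_⟩
    refine (path_of_smul_mem_unfold hT (a := 1) ?_).tgt_mem (U := U) (x := x₀)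
    simpa using hmem
  · obtain ⟨s, hs⟩ := Subgroup.ne_bot_iff_exists_ne_one.1 hv
    refine ⟨(s : G) • x₀.pref, ?_, fun hmem => hs (Subtype.ext ?_)⟩
    · have := T.adj_smul (s : G) _ _ x₀.adj_pref
      rwa [show (s : G) • v = v from s.2] at this
    · exact unfold_disjoint hT hU hx₀ s.2 ⟨x₀, 1, .nil _ hx₀, by simp⟩ hmem

lemma HasTypeOneCut.exists_isTypeOneSet (hT : T.TrivialEdgeStabilizers)
    (h : T.HasTypeOneCut g v) : ∃ C, T.IsTypeOneSet g v C := by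
  obtain ⟨U, W, hcov, hdisj, -, ⟨⟨x₀, hx₀⟩, -⟩, hmon, hW⟩ := h
  refine ⟨unfold U x₀, ⟨fun c hc => unfold_adj hc,
    fun s hs c hc hsc => unfold_disjoint hT hmon hx₀ hs hc hsc, unfold_proper hT hmon hx₀ ?_⟩,
    ⟨x₀.pref, x₀, 1, .nil _ hx₀, by simp⟩, ?_⟩
  · intro hv
    obtain ⟨y, hy⟩ := hW hv
    exact ⟨y, Set.disjoint_right.1 hdisj hy⟩
  · rintro _ ⟨y, a, hp, rfl⟩ w hw
    exact unfold_closed hcov hp (Set.disjoint_left.1 hdisj hp.tgt_mem) hw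

lemma HasTypeTwoCut.exists_isTypeTwoSet (hT : T.TrivialEdgeStabilizers)
    (h : T.HasTypeTwoCut g v) : ∃ C w₀, T.IsTypeTwoSet g v C w₀ := by
  obtain ⟨U, W, x₀, hcov, hinter, -, ⟨-, hconn⟩, hmon, hU, hW⟩ := h
  have hx₀ : x₀ ∈ U.verts ∩ W.verts := by rw [hinter]; rfl
  have hmem : x₀.pref ∈ unfold U x₀ := ⟨x₀, 1, .nil _ hx₀.1, by simp⟩
  refine ⟨unfold U x₀, x₀.pref, ⟨fun c hc => unfold_adj hc,
    fun s hs c hc hsc => unfold_disjoint hT hmon hx₀.1 hs hc hsc, unfold_proper hT hmon hx₀.1 ?_⟩,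
    hmem, ?_, ?_⟩
  · intro hv
    have h1 := hW hv
    obtain ⟨y, hy, hyx⟩ : ∃ y ∈ W.verts, y ≠ x₀ := by
      by_contra! hc
      exact h1 (Set.eq_singleton_iff_unique_mem.2 ⟨hx₀.2, hc⟩)
    refine ⟨y, fun hyU => hyx ?_⟩
    have : y ∈ U.verts ∩ W.verts := ⟨hyU, hy⟩
    rwa [hinter] at this
  · rintro _ ⟨y, a, hp, rfl⟩ hne w hw
    refine unfold_closed hcov hp (fun hy => hne ?_) hw
    -- Only lifts of the cut vertex can be left by turns, and by disjointness its only lift in the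
    -- unfolded set is `x₀.pref`.
    have : y ∈ U.verts ∩ W.verts := ⟨hp.tgt_mem, hy⟩
    rw [hinter, Set.mem_singleton_iff] at this
    subst this
    have h1 := unfold_disjoint hT hmon hx₀.1 a.2 hmem ⟨_, a, hp, rfl⟩
    rw [h1, one_smul]
  · obtain ⟨y, hy, hyx⟩ : ∃ y ∈ U.verts, y ≠ x₀ := by
      by_contra! hc
      exact hU (Set.eq_singleton_iff_unique_mem.2 ⟨hx₀.1, hc⟩)
    obtain ⟨a, hp⟩ := hconn x₀ hx₀.1 y hy
    cases hp with
    | nil => exact absurd rfl hyx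
    | cons e he _ _ _ =>
      exact ⟨_, ⟨_, _, WhSubgraph.Path.edge he, rfl⟩, e.isTurn⟩

end GATree

end Grushko

/-! ### The free splitting given by a type i cut -/

namespace Grushko

open SimpleGraph

section Labels

variable {G : Type*} [Group G] {V : Type*} [MulAction G V]

open Classical in
/-- The translate of `C`, a set of neighbours of `v`, at `p` that contains `q`. -/
noncomputable def cutLabel (G : Type*) [Group G] {V : Type*} [MulAction G V] (v : V) (C : Set V)
    (p q : V) : Option G :=
  if h : ∃ a : G, a • v = p ∧ a⁻¹ • q ∈ C then some h.choose else none

variable {v : V} {C : Set V}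

lemma cutLabel_eq_some (hC : ∀ s : G, s • v = v → ∀ c ∈ C, s • c ∈ C → s = 1) {p q : V} {a : G} :
    cutLabel G v C p q = some a ↔ a • v = p ∧ a⁻¹ • q ∈ C := by
  have huniq : ∀ a b : G, a • v = p ∧ a⁻¹ • q ∈ C → b • v = p ∧ b⁻¹ • q ∈ C → a = b := by
    rintro a b ⟨h1, h2⟩ ⟨h3, h4⟩
    have := hC (b⁻¹ * a) (by rw [mul_smul, h1, ← h3, inv_smul_smul]) _ h2 (by
      rwa [mul_smul, smul_inv_smul])
    rw [inv_mul_eq_one] at this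
    exact this.symm
  unfold cutLabel
  split_ifs with h
  · rw [Option.some_inj]
    constructor
    · rintro rfl; exact h.choose_spec
    · exact fun h' => huniq _ _ h.choose_spec h'
  · simp only [false_iff]
    exact fun h' => h ⟨a, h'⟩

lemma cutLabel_eq_none {p q : V} :
    cutLabel G v C p q = none ↔ ∀ a : G, a • v = p → a⁻¹ • q ∉ C := by
  unfold cutLabel
  split_ifs with h
  · simp only [false_iff]
    push Not
    exact h
  · simp only [true_iff]
    exact fun a ha hq => h ⟨a, ha, hq⟩

lemma cutLabel_smul (hC : ∀ s : G, s • v = v → ∀ c ∈ C, s • c ∈ C → s = 1) (b : G) (p q : V) :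
    cutLabel G v C (b • p) (b • q) = (cutLabel G v C p q).map (b * ·) := by
  cases h : cutLabel G v C p q with
  | none =>
    rw [cutLabel_eq_none] at h
    rw [Option.map_none, cutLabel_eq_none]
    intro a ha hq
    refine h (b⁻¹ * a) (by rw [mul_smul, ha, inv_smul_smul]) ?_
    rwa [mul_inv_rev, inv_inv, mul_smul]
  | some a =>
    rw [cutLabel_eq_some hC] at h
    rw [Option.map_some, cutLabel_eq_some hC]
    refine ⟨by rw [mul_smul, h.1], ?_⟩
    rw [mul_inv_rev, mul_smul, inv_smul_smul]
    exact h.2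

/-- The vertices in the half-trees at `v` that start in `C`. -/
def beyond (Γ : SimpleGraph V) (v : V) (C : Set V) : Set V := {x | ∃ c ∈ C, x ∈ side Γ v c}

lemma not_mem_beyond {Γ : SimpleGraph V} : v ∉ beyond Γ v C := fun ⟨_, _, h⟩ => not_mem_side _ _ h

/-- The disjunction records on which side of the new edge at `v` the `p`-end of the edge lies once
the directions in `C` are pulled off `v`. Both ends of an old edge give the same answer. -/
lemma beyond_adj {Γ : SimpleGraph V} (hΓ : Γ.IsTree) (hC : ∀ c ∈ C, Γ.Adj v c) {p q : V}
    (hpq : Γ.Adj p q) :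
    (p ∈ beyond Γ v C ∨ (p = v ∧ q ∈ C)) → (q ∈ beyond Γ v C ∨ (q = v ∧ p ∈ C)) := by
  rintro (⟨c, hc, hp⟩ | ⟨rfl, hq⟩)
  · by_cases hqv : q = v
    · right
      subst hqv
      refine ⟨rfl, ?_⟩
      rwa [eq_of_mem_side hΓ (hC c hc) hpq.symm hp]
    · exact .inl ⟨c, hc, side_adj hpq hp hqv⟩
  · exact .inl ⟨q, hq, mem_side_self hpq.ne⟩

/-- With no neighbours of `x` besides `t • x` and `t⁻¹ • x`, a connected graph consists of the
translates of `x` by powers of `t`. -/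
lemma exists_zpow_of_neighbors {Γ : SimpleGraph V} (hΓ : Γ.Connected)
    (hsmul : ∀ (a : G) (v w : V), Γ.Adj v w → Γ.Adj (a • v) (a • w)) {x : V} {t : G}
    (hN : ∀ y, Γ.Adj x y → y = t • x ∨ y = t⁻¹ • x) (y : V) : ∃ n : ℤ, y = t ^ n • x := by
  obtain ⟨p⟩ := hΓ.preconnected y x
  induction p with
  | nil => exact ⟨0, by simp⟩
  | @cons y z x hyz _ ih =>
    obtain ⟨n, rfl⟩ := ih hN
    have h1 := hsmul (t ^ n)⁻¹ _ _ hyz.symm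
    rw [inv_smul_smul] at h1
    rcases hN _ h1 with h2 | h2
    · refine ⟨n + 1, ?_⟩
      rw [zpow_add_one, mul_smul, ← h2, smul_inv_smul]
    · refine ⟨n - 1, ?_⟩
      rw [zpow_sub_one, mul_smul, ← h2, smul_inv_smul]

lemma comm_of_forall_zpow {x : V} {t : G} (hfree : ∀ a : G, a • x = x → a = 1)
    (h : ∀ a : G, ∃ n : ℤ, a • x = t ^ n • x) (a b : G) : a * b = b * a := by
  have key : ∀ a : G, ∃ n : ℤ, a = t ^ n := by
    intro a
    obtain ⟨n, hn⟩ := h a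
    refine ⟨n, ?_⟩
    have := hfree ((t ^ n)⁻¹ * a) (by rw [mul_smul, hn, inv_smul_smul])
    rw [inv_mul_eq_one] at this
    exact this.symm
  obtain ⟨n, rfl⟩ := key a
  obtain ⟨n', rfl⟩ := key b
  rw [← zpow_add, ← zpow_add, add_comm]

lemma exists_adj_of_connected_induce {Γ : SimpleGraph V} {S : Set V} (hS : (Γ.induce S).Connected)
    {x y : V} (hx : x ∈ S) (hy : y ∈ S) (hxy : x ≠ y) : ∃ z ∈ S, Γ.Adj x z := by
  obtain ⟨p⟩ := hS.preconnected ⟨x, hx⟩ ⟨y, hy⟩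
  have hnil : ¬ p.Nil := Walk.not_nil_of_ne fun h => hxy (congrArg Subtype.val h)
  exact ⟨p.snd.1, p.snd.2, p.adj_snd hnil⟩

end Labels

namespace GATree

variable {G : Type u} [Group G] {k : ℕ} {A : Fin k → Subgroup G} {T : GATree A} {m : ℕ}
  {g : Fin m → G} {v : T.V} {C : Set T.V}

/-! ### The free splitting given by a cut of type i -/

/-- The initial point of the edge from `p` to `q` in the tree obtained by pulling the directions
in `C` apart from `v`. -/
noncomputable def pulled (v : T.V) (C : Set T.V) (p q : T.V) : T.V ⊕ G :=
  (cutLabel G v C p q).elim (Sum.inl p) Sum.inr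

/-- Ends of the same old edge. -/
def splitRel (v : T.V) (C : Set T.V) (x y : T.V ⊕ G) : Prop :=
  ∃ p q, T.graph.Adj p q ∧ x = pulled v C p q ∧ y = pulled v C q p

/-- The vertices of the splitting: all old edges are collapsed. -/
def SplitVertex (v : T.V) (C : Set T.V) : Type u := Quot (splitRel v C)

/-- One side of the edge of the splitting at `v`. -/
def splitSide (v : T.V) (C : Set T.V) : T.V ⊕ G → Prop :=
  Sum.elim (fun x => x ∈ beyond T.graph v C) (fun b => b = 1 ∨ b • v ∈ beyond T.graph v C)

lemma IsCutSet.pulled_smul (hC : T.IsCutSet v C) (b : G) (p q : T.V) :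
    pulled v C (b • p) (b • q) = b • pulled v C p q := by
  unfold pulled
  rw [cutLabel_smul hC.disjoint]
  cases cutLabel G v C p q <;> rfl

lemma IsCutSet.splitSide_pulled (hC : T.IsCutSet v C) (p q : T.V) :
    splitSide v C (pulled v C p q) ↔ p ∈ beyond T.graph v C ∨ (p = v ∧ q ∈ C) := by
  unfold pulled
  cases h : cutLabel G v C p q with
  | none =>
    rw [cutLabel_eq_none] at h
    simp only [Option.elim, splitSide, Sum.elim_inl]
    refine (or_iff_left ?_).symm
    rintro ⟨rfl, hq⟩
    exact h 1 (one_smul _ _) (by simpa using hq)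
  | some a =>
    have h' := (cutLabel_eq_some hC.disjoint).1 h
    simp only [Option.elim, splitSide, Sum.elim_inr, h'.1]
    rw [or_comm]
    refine or_congr_right ⟨?_, ?_⟩
    · rintro rfl
      simpa [eq_comm] using h'
    · rintro ⟨rfl, hq⟩
      have h1 : cutLabel G p C p q = some 1 := by
        rw [cutLabel_eq_some hC.disjoint]
        simpa using hq
      rw [h1] at h
      exact (Option.some_inj.1 h).symm

/-- The two sides of the edge of the splitting at `a v`. -/
noncomputable def IsCutSet.colour (hC : T.IsCutSet v C) (a : G) : SplitVertex v C → Prop :=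
  Quot.lift (fun x => splitSide v C (a⁻¹ • x)) (by
    rintro _ _ ⟨p, q, hpq, rfl, rfl⟩
    have h1 := T.adj_smul a⁻¹ _ _ hpq
    rw [← hC.pulled_smul, ← hC.pulled_smul, hC.splitSide_pulled, hC.splitSide_pulled]
    exact propext ⟨beyond_adj T.isTree hC.adj h1, beyond_adj T.isTree hC.adj h1.symm⟩)

/-- The vertex of the splitting given by an old vertex. -/
def splitL (v : T.V) (C : Set T.V) (x : T.V) : SplitVertex v C := Quot.mk _ (Sum.inl x)

/-- The vertex of the splitting given by a new vertex. -/
def splitR (v : T.V) (C : Set T.V) (a : G) : SplitVertex v C := Quot.mk _ (Sum.inr a)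

lemma IsCutSet.colour_splitL (hC : T.IsCutSet v C) (a : G) (x : T.V) :
    hC.colour a (splitL v C x) ↔ a⁻¹ • x ∈ beyond T.graph v C := Iff.rfl

lemma IsCutSet.colour_splitR (hC : T.IsCutSet v C) (a b : G) :
    hC.colour a (splitR v C b) ↔ b = a ∨ a⁻¹ • b • v ∈ beyond T.graph v C := by
  change (a⁻¹ * b = 1 ∨ (a⁻¹ * b) • v ∈ beyond T.graph v C) ↔ _
  rw [inv_mul_eq_one, mul_smul, eq_comm]

/-- The colouring with index `a` changes only across the edge with index `a`, and in one direction.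
Acyclicity, trivial edge stabilizers and absence of inversions all come from this. -/
lemma IsCutSet.colour_edge (hC : T.IsCutSet v C) {a b : G} :
    (hC.colour a (splitR v C b) ∧ ¬ hC.colour a (splitL v C (b • v)) ↔ b = a) ∧
      (hC.colour a (splitL v C (b • v)) → hC.colour a (splitR v C b)) := by
  rw [hC.colour_splitR, hC.colour_splitL]
  refine ⟨⟨by tauto, ?_⟩, .inr⟩
  rintro rfl
  rw [inv_smul_smul]
  exact ⟨.inl rfl, not_mem_beyond⟩

/-- The group acts on the vertices of the splitting. -/
@[reducible]
noncomputable def IsCutSet.splitAction (hC : T.IsCutSet v C) : MulAction G (SplitVertex v C) where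
  smul b := Quot.map (fun x => b • x) (by
    rintro _ _ ⟨p, q, hpq, rfl, rfl⟩
    exact ⟨b • p, b • q, T.adj_smul b _ _ hpq, (hC.pulled_smul b p q).symm,
      (hC.pulled_smul b q p).symm⟩)
  one_smul := by
    rintro ⟨x⟩
    exact congrArg (Quot.mk _) (one_smul G x)
  mul_smul := by
    rintro a b ⟨x⟩
    exact congrArg (Quot.mk _) (mul_smul a b x)

/-- The graph of the splitting. -/
def IsCutSet.splitGraph (hC : T.IsCutSet v C) : SimpleGraph (SplitVertex v C) where
  Adj X Y := ∃ a : G, (X = splitL v C (a • v) ∧ Y = splitR v C a) ∨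
    (Y = splitL v C (a • v) ∧ X = splitR v C a)
  symm := ⟨by
    rintro X Y ⟨a, h⟩
    exact ⟨a, h.symm⟩⟩
  loopless := ⟨by
    rintro X ⟨a, ⟨h1, h2⟩ | ⟨h1, h2⟩⟩ <;>
    · have h3 := (hC.colour_edge (a := a) (b := a)).1.2 rfl
      rw [← h1, ← h2] at h3
      exact h3.2 h3.1⟩

/-- Walks of the old tree survive, as old edges are collapsed and new ones reconnect what was pulled
apart; the colourings give acyclicity. -/
lemma IsCutSet.splitGraph_isTree (hC : T.IsCutSet v C) : hC.splitGraph.IsTree := by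
  have hadj : ∀ a : G, hC.splitGraph.Adj (splitL v C (a • v)) (splitR v C a) :=
    fun a => ⟨a, .inl ⟨rfl, rfl⟩⟩
  have hpulled : ∀ p q, hC.splitGraph.Reachable (splitL v C p) (Quot.mk _ (pulled v C p q)) := by
    intro p q
    cases h : cutLabel G v C p q with
    | none => rw [pulled, h]; exact Reachable.refl _
    | some a =>
      rw [pulled, h, ← ((cutLabel_eq_some hC.disjoint).1 h).1]
      exact (hadj a).reachable
  have hL : ∀ x, hC.splitGraph.Reachable (splitL v C v) (splitL v C x) := by
    intro x
    obtain ⟨p⟩ := T.isTree.1.preconnected v x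
    have : ∀ {y x : T.V}, T.graph.Walk y x →
        hC.splitGraph.Reachable (splitL v C y) (splitL v C x) := by
      intro y x p
      induction p with
      | nil => exact Reachable.refl _
      | @cons y z _ hyz _ ih =>
        refine Reachable.trans ?_ ih
        refine (hpulled y z).trans ?_
        have : (Quot.mk _ (pulled v C y z) : SplitVertex v C) = Quot.mk _ (pulled v C z y) :=
          Quot.sound ⟨y, z, hyz, rfl, rfl⟩
        rw [this]
        exact (hpulled z y).symm
    exact this p
  have hall : ∀ X, hC.splitGraph.Reachable (splitL v C v) X := by
    rintro ⟨x | a⟩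
    · exact hL x
    · exact (hL (a • v)).trans (hadj a).reachable
  have : Nonempty (SplitVertex v C) := ⟨splitL v C v⟩
  refine ⟨⟨fun X Y => (hall X).symm.trans (hall Y)⟩, isAcyclic_of_colourings ?_⟩
  rintro X Y ⟨a, ⟨rfl, rfl⟩ | ⟨rfl, rfl⟩⟩
  · obtain ⟨h1, h2⟩ := (hC.colour_edge (a := a) (b := a)).1.2 rfl
    refine ⟨{Z | hC.colour a Z}, h2, h1, ?_⟩
    rintro X Y ⟨b, ⟨rfl, rfl⟩ | ⟨rfl, rfl⟩⟩ hX hY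
    · obtain rfl := (hC.colour_edge (a := a) (b := b)).1.1 ⟨hY, hX⟩
      exact ⟨rfl, rfl⟩
    · exact absurd ((hC.colour_edge (a := a) (b := b)).2 hY) hX
  · obtain ⟨h1, h2⟩ := (hC.colour_edge (a := a) (b := a)).1.2 rfl
    refine ⟨{Z | ¬ hC.colour a Z}, not_not.2 h1, h2, ?_⟩
    rintro X Y ⟨b, ⟨rfl, rfl⟩ | ⟨rfl, rfl⟩⟩ hX hY
    · exact absurd ((hC.colour_edge (a := a) (b := b)).2 (not_not.1 hX)) hY
    · obtain rfl := (hC.colour_edge (a := a) (b := b)).1.1 ⟨not_not.1 hX, hY⟩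
      exact ⟨rfl, rfl⟩

/-- A cut of type i gives a free splitting in which the generators are elliptic. -/
theorem IsTypeOneSet.exists_isFreeSplitting (hT : T.TrivialEdgeStabilizers)
    (hG : (∀ (a : G) (x : T.V), a • x = x → a = 1) → ∃ a b : G, a * b ≠ b * a)
    (hg : ∀ j (x : T.V), g j • x ≠ x) (hC₁ : T.IsTypeOneSet g v C) :
    ∃ S : GATree A, S.IsFreeSplitting ∧ ∀ j, S.IsElliptic (g j) := by
  have hC := hC₁.toIsCutSet
  have h := T.isFreeGTree hT
  let act := hC.splitAction
  have smulL : ∀ (b : G) (x : T.V), b • splitL v C x = splitL v C (b • x) := fun _ _ => rfl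
  have smulR : ∀ (b a : G), b • splitR v C a = splitR v C (b * a) := fun _ _ => rfl
  have htree := hC.splitGraph_isTree
  have hsmul : ∀ (b : G) (X Y : SplitVertex v C), hC.splitGraph.Adj X Y →
      hC.splitGraph.Adj (b • X) (b • Y) := by
    rintro b X Y ⟨a, ⟨rfl, rfl⟩ | ⟨rfl, rfl⟩⟩
    · exact ⟨b * a, .inl ⟨by rw [smulL, mul_smul], rfl⟩⟩
    · exact ⟨b * a, .inr ⟨by rw [smulL, mul_smul], rfl⟩⟩
  have hedge : ∀ (b a : G), b • splitL v C (a • v) = splitL v C (a • v) →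
      b • splitR v C a = splitR v C a → b = 1 := by
    intro b a h1 h2
    rw [smulL, ← mul_smul] at h1
    rw [smulR] at h2
    have h3 := (hC.colour_edge (a := a) (b := a)).1.2 rfl
    rw [← h1, ← h2] at h3
    exact mul_eq_right.1 ((hC.colour_edge (a := a) (b := b * a)).1.1 h3)
  have hfree : ∀ (b : G) (X Y : SplitVertex v C), hC.splitGraph.Adj X Y → b • X = X → b • Y = Y →
      b = 1 := by
    rintro b X Y ⟨a, ⟨rfl, rfl⟩ | ⟨rfl, rfl⟩⟩ h1 h2
    · exact hedge b a h1 h2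
    · exact hedge b a h2 h1
  have hinv : ∀ (b a : G), b • splitL v C (a • v) = splitR v C a →
      b • splitR v C a = splitL v C (a • v) → False := by
    intro b a h1 h2
    rw [smulL, ← mul_smul] at h1
    rw [smulR] at h2
    have h3 := (hC.colour_edge (a := a) (b := a)).1.2 rfl
    rw [← h1, ← h2] at h3
    exact h3.2 ((hC.colour_edge (a := a) (b := b * a)).2 h3.1)
  have horbit : ∀ X : SplitVertex v C, ∃ a : G, X = a • splitL v C v ∨ X = a • splitR v C 1 := by
    intro X
    by_cases hX : X = splitL v C v
    · exact ⟨1, .inl (by rw [hX, one_smul])⟩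
    · obtain ⟨Y, ⟨a, ⟨hY, -⟩ | ⟨-, hY⟩⟩, -⟩ := exists_side htree (Ne.symm hX)
      · exact ⟨a, .inl (by rw [smulL, hY])⟩
      · exact ⟨a, .inr (by rw [smulR, mul_one, hY])⟩
  -- no vertex is fixed by the whole group
  have hnofix : ∀ X : SplitVertex v C, ∃ b : G, b • X ≠ X := by
    have hL : ∃ b : G, b • splitL v C v ≠ splitL v C v := by
      obtain ⟨c, hc⟩ := hC₁.nonempty
      obtain ⟨b, hb⟩ := h.exists_smul_mem_side T.isMinimalGTree (hC.adj c hc) v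
      refine ⟨b, fun heq => ?_⟩
      have h1 : hC.colour 1 (splitL v C (b • v)) := by
        rw [hC.colour_splitL, inv_one, one_smul]
        exact ⟨c, hc, hb⟩
      rw [← smulL, heq, hC.colour_splitL, inv_one, one_smul] at h1
      exact not_mem_beyond h1
    have hR : ∃ b : G, b • splitR v C 1 ≠ splitR v C 1 := by
      obtain ⟨w, hw, hwC⟩ := hC.proper
      obtain ⟨b, hb⟩ := h.exists_smul_mem_side T.isMinimalGTree hw v
      refine ⟨b, fun heq => ?_⟩
      have h1 : hC.colour 1 (splitR v C 1) := (hC.colour_splitR 1 1).2 (.inl rfl)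
      rw [← heq, smulR, mul_one, hC.colour_splitR, inv_one, one_smul] at h1
      rcases h1 with rfl | ⟨c, hc, hbc⟩
      · rw [one_smul] at hb
        exact not_mem_side _ _ hb
      · exact hwC (side_unique T.isTree hw (hC.adj c hc) hb hbc ▸ hc)
    have hconj : ∀ (a : G) (X : SplitVertex v C), (∃ b : G, b • X ≠ X) →
        ∃ b : G, b • a • X ≠ a • X := by
      rintro a X ⟨b, hb⟩
      refine ⟨a * b * a⁻¹, fun heq => hb ?_⟩
      rw [mul_smul, inv_smul_smul, mul_smul] at heq
      exact smul_left_cancel a heq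
    intro X
    obtain ⟨a, rfl | rfl⟩ := horbit X
    · exact hconj a _ hL
    · exact hconj a _ hR
  have hsum : ∀ X Y : SplitVertex v C, hC.splitGraph.Adj X Y → ∃ b : G,
      (b • X = splitL v C v ∧ b • Y = splitR v C 1) ∨
      (b • X = splitR v C 1 ∧ b • Y = splitL v C v) := by
    rintro X Y ⟨a, ⟨rfl, rfl⟩ | ⟨rfl, rfl⟩⟩
    · exact ⟨a⁻¹, .inl ⟨by rw [smulL, inv_smul_smul], by rw [smulR, inv_mul_cancel]⟩⟩
    · exact ⟨a⁻¹, .inr ⟨by rw [smulR, inv_mul_cancel], by rw [smulL, inv_smul_smul]⟩⟩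
  refine ⟨{
    V := SplitVertex v C
    act := act
    graph := hC.splitGraph
    isTree := htree
    len := fun _ => 1
    len_pos := fun _ _ => one_pos
    adj_smul := hsmul
    len_smul := fun _ _ _ _ => rfl
    no_inversion := ?_
    minimal := ?_
    finite_vertices := ?_
    finite_edges := ?_
    peripheral_fixes := ?_
    degree_two := ?_ }, ⟨?_, fun _ _ => rfl, hfree⟩, ?_⟩
  · rintro b X Y ⟨a, ⟨rfl, rfl⟩ | ⟨rfl, rfl⟩⟩ ⟨h1, h2⟩
    · exact hinv b a h1 h2
    · exact hinv b a h2 h1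
  -- An invariant subtree is not a single vertex, so it contains an edge; all edges form one orbit.
  · intro S hS hconn
    obtain ⟨⟨X, hX⟩⟩ := hconn.nonempty
    obtain ⟨b, hb⟩ := hnofix X
    obtain ⟨Y, hY, hXY⟩ := exists_adj_of_connected_induce hconn hX (hS b X hX) hb.symm
    have hLR : splitL v C v ∈ S ∧ splitR v C 1 ∈ S := by
      obtain ⟨b, ⟨h1, h2⟩ | ⟨h1, h2⟩⟩ := hsum X Y hXY
      · exact ⟨h1 ▸ hS b X hX, h2 ▸ hS b Y hY⟩
      · exact ⟨h2 ▸ hS b Y hY, h1 ▸ hS b X hX⟩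
    refine Set.eq_univ_of_forall fun Z => ?_
    obtain ⟨a, rfl | rfl⟩ := horbit Z
    · exact hS a _ hLR.1
    · exact hS a _ hLR.2
  · refine ⟨{splitL v C v, splitR v C 1}, by simp, fun X => ?_⟩
    obtain ⟨a, rfl | rfl⟩ := horbit X
    · exact ⟨a⁻¹, by rw [inv_smul_smul]; exact .inl rfl⟩
    · exact ⟨a⁻¹, by rw [inv_smul_smul]; exact .inr rfl⟩
  · refine ⟨{(splitL v C v, splitR v C 1), (splitR v C 1, splitL v C v)}, by simp,
      fun X Y hXY => ?_⟩
    obtain ⟨b, ⟨h1, h2⟩ | ⟨h1, h2⟩⟩ := hsum X Y hXY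
    · exact ⟨b, by rw [h1, h2]; exact .inl rfl⟩
    · exact ⟨b, by rw [h1, h2]; exact .inr rfl⟩
  · intro H hH
    obtain ⟨x, hx⟩ := T.peripheral_fixes H hH
    exact ⟨splitL v C x, fun a ha => by rw [smulL, hx a ha]⟩
  -- If the two edges are not interchanged, `X` has trivial stabilizer. As there is only one orbit
  -- of edges, the two edges leave `X` in opposite orientations and the splitting is a line of
  -- translates of `X`.
  · intro X w₁ w₂ hne hN
    by_contra hswap
    have hmem : ∀ Y, hC.splitGraph.Adj X Y ↔ Y = w₁ ∨ Y = w₂ := fun Y => by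
      rw [← mem_neighborSet, hN]; rfl
    have hstab : ∀ b : G, b • X = X → b = 1 := by
      intro b hb
      have hmap : ∀ Y, (Y = w₁ ∨ Y = w₂) → (b • Y = w₁ ∨ b • Y = w₂) := fun Y hY => by
        rw [← hmem] at hY ⊢
        have := hsmul b _ _ hY
        rwa [hb] at this
      rcases hmap w₁ (.inl rfl) with h1 | h1
      · exact hfree b X w₁ ((hmem _).2 (.inl rfl)) hb h1
      · rcases hmap w₂ (.inr rfl) with h2 | h2
        · exact absurd ⟨b, hb, h1, h2⟩ hswap
        · exact absurd (smul_left_cancel b (h1.trans h2.symm)) hne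
    have key : ∀ w₁ w₂ : SplitVertex v C, (∀ Y, hC.splitGraph.Adj X Y ↔ Y = w₁ ∨ Y = w₂) →
        ∀ a b : G, X = splitL v C (a • v) → w₁ = splitR v C a → w₂ = splitL v C (b • v) →
        X = splitR v C b → False := by
      intro w₁ w₂ hmem a b h1 h2 h3 h4
      have hN' : ∀ Y, hC.splitGraph.Adj X Y → Y = (a * b⁻¹) • X ∨ Y = (a * b⁻¹)⁻¹ • X := by
        intro Y hY
        rcases (hmem Y).1 hY with rfl | rfl
        · left
          rw [h2, h4, smulR, inv_mul_cancel_right]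
        · right
          rw [h3, h1, smulL, ← mul_smul, mul_inv_rev, inv_inv, inv_mul_cancel_right]
      have hz := exists_zpow_of_neighbors htree.1 hsmul hN'
      have hcomm := comm_of_forall_zpow hstab fun a => hz (a • X)
      -- On a line the group is commutative. An element fixing a vertex of the old tree then fixes
      -- all translates of `X`, so the old action is free and `hG` applies.
      obtain ⟨a₁, b₁, hab⟩ := hG (by
        intro s x hs
        obtain ⟨n, hn⟩ := hz (splitL v C x)
        have h5 : s • splitL v C x = splitL v C x := by rw [smulL, hs]
        rw [hn, ← mul_smul, hcomm, mul_smul] at h5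
        exact hstab s (smul_left_cancel _ h5))
      exact hab (hcomm a₁ b₁)
    obtain ⟨a, ha⟩ := (hmem w₁).2 (.inl rfl)
    obtain ⟨b, hb⟩ := (hmem w₂).2 (.inr rfl)
    rcases ha with ⟨ha1, ha2⟩ | ⟨ha1, ha2⟩ <;> rcases hb with ⟨hb1, hb2⟩ | ⟨hb1, hb2⟩
    · have := hstab (b * a⁻¹) (by
        conv_lhs => rw [ha1]
        rw [smulL, ← mul_smul, inv_mul_cancel_right, ← hb1])
      rw [mul_inv_eq_one] at this
      subst this
      exact hne (ha2.trans hb2.symm)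
    · exact key w₁ w₂ hmem a b ha1 ha2 hb1 hb2
    · exact key w₂ w₁ (fun Y => by rw [hmem, or_comm]) b a hb1 hb2 ha1 ha2
    · have := hstab (b * a⁻¹) (by
        conv_lhs => rw [ha2]
        rw [smulR, inv_mul_cancel_right, ← hb2])
      rw [mul_inv_eq_one] at this
      subst this
      exact hne (ha1.trans hb1.symm)
  · exact ⟨splitL v C v, splitR v C 1, 1, .inl ⟨by rw [one_smul], rfl⟩⟩
  · intro j
    obtain ⟨l, t, ht, hl, hl2, hlt⟩ := h.exists_axis (hg j)
    let L : T.Line := ⟨l, hl, injective_of_locally_injective_int T.isTree hl hl2⟩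
    have hturn : ∀ n, T.IsTurn g (l (n + 1)) (l n) (l (n + 2)) := fun n =>
      ⟨1, j, L, n + 1, by
        rw [one_mul, inv_one, mul_one]
        exact ⟨t, ht, hlt⟩, rfl, .inl ⟨congrArg l (by ring), congrArg l (by ring)⟩⟩
    -- `C` is closed under turns, so both edges of an axis at a vertex are pulled off together or
    -- not at all. Hence the whole axis collapses to one vertex of the splitting.
    have hlabel : ∀ p w w', T.IsTurn g p w w' → ∀ a, cutLabel G v C p w = some a →
        cutLabel G v C p w' = some a := by
      intro p w w' hpw a ha
      rw [cutLabel_eq_some hC.disjoint] at ha ⊢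
      refine ⟨ha.1, hC₁.closed _ ha.2 _ ?_⟩
      have := hpw.smul a⁻¹
      rwa [← ha.1, inv_smul_smul] at this
    have hpulled : ∀ n, pulled v C (l (n + 1)) (l n) = pulled v C (l (n + 1)) (l (n + 2)) := by
      intro n
      unfold pulled
      congr 1
      cases h1 : cutLabel G v C (l (n + 1)) (l n) with
      | some a => exact (hlabel _ _ _ (hturn n) _ h1).symm
      | none =>
        cases h2 : cutLabel G v C (l (n + 1)) (l (n + 2)) with
        | none => rfl
        | some a =>
          rw [hlabel _ _ _ (hturn n).symm _ h2] at h1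
          cases h1
    have hconst : ∀ n, (Quot.mk _ (pulled v C (l n) (l (n + 1))) : SplitVertex v C) =
        Quot.mk _ (pulled v C (l (n + 1)) (l (n + 1 + 1))) := by
      intro n
      rw [show n + 1 + 1 = n + 2 by ring, ← hpulled n]
      exact Quot.sound ⟨_, _, hl n, rfl, rfl⟩
    have hconst' : ∀ n : ℕ, (Quot.mk _ (pulled v C (l 0) (l (0 + 1))) : SplitVertex v C) =
        Quot.mk _ (pulled v C (l n) (l (n + 1))) := by
      intro n
      induction n with
      | zero => rfl
      | succ n ih => rw [ih, hconst]; push_cast; rfl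
    refine ⟨(Quot.mk _ (pulled v C (l 0) (l (0 + 1))) : SplitVertex v C), ?_⟩
    conv_rhs => rw [hconst' t]
    change (Quot.mk _ (g j • pulled v C (l 0) (l (0 + 1))) : SplitVertex v C) = _
    rw [← hC.pulled_smul, hlt, hlt, zero_add, zero_add, add_comm 1 (t : ℤ)]

end GATree

end Grushko

/-! ### Slides and their effect on axes -/

namespace Grushko

open SimpleGraph

section Slides

variable {G : Type*} [Group G] {V : Type*} [MulAction G V] {Γ : SimpleGraph V} {v d : V} {D : Set V}

/-- The data for sliding the edges from `v` to `D` over the edge from `v` to `d`, equivariantly. -/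
structure IsSlide (G : Type*) [Group G] {V : Type*} [MulAction G V] (Γ : SimpleGraph V) (v : V)
    (D : Set V) (d : V) : Prop where
  adj : ∀ c ∈ D, Γ.Adj v c
  disjoint : ∀ s : G, s • v = v → ∀ c ∈ D, s • c ∈ D → s = 1
  mem : d ∈ D
  -- The edge over which one slides is not itself slid at its other end.
  avoid : ∀ a : G, a • d = v → a • v ∉ D

/-- The initial point of the edge from `p` to `q` after the slide. -/
noncomputable def slideOrigin (G : Type*) [Group G] {V : Type*} [MulAction G V] (v : V) (D : Set V)
    (d p q : V) : V :=
  (cutLabel G v D p q).elim p (· • d)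

/-- The ordered pairs in the orbit of `(v, d)`. -/
def InOrbit (G : Type*) [Group G] {V : Type*} [MulAction G V] (v d p q : V) : Prop :=
  ∃ a : G, a • v = p ∧ a • d = q

lemma InOrbit.smul {p q : V} (h : InOrbit G v d p q) (b : G) : InOrbit G v d (b • p) (b • q) := by
  obtain ⟨a, rfl, rfl⟩ := h
  exact ⟨b * a, mul_smul _ _ _, mul_smul _ _ _⟩

lemma inOrbit_smul_iff {p q : V} (b : G) :
    InOrbit G v d (b • p) (b • q) ↔ InOrbit G v d p q :=
  ⟨fun h => by simpa using h.smul b⁻¹, fun h => h.smul b⟩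

/-- The graph after the slide. -/
def slideGraph (G : Type*) [Group G] {V : Type*} [MulAction G V] (Γ : SimpleGraph V) (v : V)
    (D : Set V) (d : V) : SimpleGraph V where
  Adj x y := x ≠ y ∧ ((∃ p q, Γ.Adj p q ∧ ¬ InOrbit G v d p q ∧ ¬ InOrbit G v d q p ∧
    x = slideOrigin G v D d p q ∧ y = slideOrigin G v D d q p) ∨
      InOrbit G v d x y ∨ InOrbit G v d y x)
  symm := ⟨by
    rintro x y ⟨hne, ⟨p, q, hpq, h1, h2, hx, hy⟩ | h | h⟩
    · exact ⟨hne.symm, .inl ⟨q, p, hpq.symm, h2, h1, hy, hx⟩⟩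
    · exact ⟨hne.symm, .inr (.inr h)⟩
    · exact ⟨hne.symm, .inr (.inl h)⟩⟩
  loopless := ⟨fun x h => h.1 rfl⟩

open Classical in
/-- What the edge from `p` to `q` contributes to the new translation length at its end `p`, where
the axis comes from `r`. -/
noncomputable def slideToll (G : Type*) [Group G] {V : Type*} [MulAction G V] (v w₀ : V) (D : Set V)
    (p q r : V) : ℕ :=
  if ∃ a : G, a • v = p ∧ a • w₀ = q ∧ ¬ (w₀ ∈ D ↔ a⁻¹ • r ∈ D) then 1 else 0

lemma slideToll_smul (w₀ : V) (b : G) (p q r : V) :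
    slideToll G v w₀ D (b • p) (b • q) (b • r) = slideToll G v w₀ D p q r := by
  unfold slideToll
  congr 1
  refine propext ⟨?_, ?_⟩
  · rintro ⟨a, h1, h2, h3⟩
    refine ⟨b⁻¹ * a, by rw [mul_smul, h1, inv_smul_smul], by rw [mul_smul, h2, inv_smul_smul], ?_⟩
    rwa [mul_inv_rev, inv_inv, mul_smul]
  · rintro ⟨a, h1, h2, h3⟩
    refine ⟨b * a, by rw [mul_smul, h1], by rw [mul_smul, h2], ?_⟩
    rwa [mul_inv_rev, mul_smul, inv_smul_smul]

namespace IsSlide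

variable (hs : IsSlide G Γ v D d)

include hs

lemma origin_smul (b : G) (p q : V) :
    slideOrigin G v D d (b • p) (b • q) = b • slideOrigin G v D d p q := by
  unfold slideOrigin
  rw [cutLabel_smul hs.disjoint]
  cases cutLabel G v D p q with
  | none => rfl
  | some a => exact mul_smul b a d

lemma origin_of_some {p q : V} {a : G} (ha : a • v = p) (hq : a⁻¹ • q ∈ D) :
    slideOrigin G v D d p q = a • d := by
  rw [slideOrigin, (cutLabel_eq_some hs.disjoint).2 ⟨ha, hq⟩]
  rfl

/-- Together with `origin_right`: the two slid origins of an edge in the orbit of `(v, d)` coincide.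
This is why `slideGraph` adds these edges separately and why an axis can save length on them. -/
lemma origin_left {p q : V} (h : InOrbit G v d p q) : slideOrigin G v D d p q = q := by
  obtain ⟨a, ha, rfl⟩ := h
  exact hs.origin_of_some ha (by rw [inv_smul_smul]; exact hs.mem)

lemma origin_right {p q : V} (h : InOrbit G v d p q) : slideOrigin G v D d q p = q := by
  obtain ⟨a, rfl, rfl⟩ := h
  have : cutLabel G v D (a • d) (a • v) = none := by
    rw [cutLabel_eq_none]
    intro b hb
    rw [← mul_smul]
    refine hs.avoid _ ?_
    rw [mul_smul, ← hb, inv_smul_smul]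
  rw [slideOrigin, this]
  rfl

lemma origin_cases (p q : V) :
    slideOrigin G v D d p q = p ∨ InOrbit G v d p (slideOrigin G v D d p q) := by
  cases h : cutLabel G v D p q with
  | none => left; rw [slideOrigin, h]; rfl
  | some a =>
    right
    refine ⟨a, ((cutLabel_eq_some hs.disjoint).1 h).1, ?_⟩
    rw [slideOrigin, h]
    rfl

/-- Sides of an edge outside the orbit are not affected. -/
lemma origin_mem_side (h : IsFreeGTree G Γ) {p q : V} (hpq : Γ.Adj p q)
    (h1 : ¬ InOrbit G v d p q) (h2 : ¬ InOrbit G v d q p) (p' q' : V) :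
    slideOrigin G v D d p' q' ∈ side Γ p q ↔ p' ∈ side Γ p q := by
  rcases hs.origin_cases p' q' with h3 | h3
  · rw [h3]
  · have hadj : Γ.Adj p' (slideOrigin G v D d p' q') := by
      obtain ⟨a, ha, ha'⟩ := h3
      rw [← ha', ← ha]
      exact h.smul a _ _ (hs.adj d hs.mem)
    constructor
    · intro h4
      by_contra h5
      obtain ⟨e1, e2⟩ := cross_side h.isTree hpq hadj h5 h4
      rw [e2, e1] at h3
      exact h1 h3
    · intro h4
      by_contra h5
      obtain ⟨e1, e2⟩ := cross_side h.isTree hpq hadj.symm h5 h4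
      rw [e1, e2] at h3
      exact h2 h3

/-- Translates of the edge from `v` to `d` do not change sides, except for the edge itself; `avoid`
excludes a translate that enters `D` backwards. -/
lemma beyond_iff (h : IsFreeGTree G Γ) (a : G) :
    a • d ∈ beyond Γ v D ↔ a • v ∈ beyond Γ v D ∨ a = 1 := by
  have hadj := h.smul a _ _ (hs.adj d hs.mem)
  constructor
  · intro h1
    rcases beyond_adj h.isTree hs.adj hadj.symm (.inl h1) with h2 | ⟨h2, h3⟩
    · exact .inl h2
    · exact .inr (hs.disjoint a h2 d hs.mem h3)
  · rintro (h1 | rfl)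
    · rcases beyond_adj h.isTree hs.adj hadj (.inl h1) with h2 | ⟨h2, h3⟩
      · exact h2
      · exact absurd h3 (hs.avoid a h2)
    · rw [one_smul]
      exact ⟨d, hs.mem, mem_side_self (hs.adj d hs.mem).ne⟩

lemma origin_mem_beyond (h : IsFreeGTree G Γ) (p q : V) :
    slideOrigin G v D d p q ∈ beyond Γ v D ↔ p ∈ beyond Γ v D ∨ (p = v ∧ q ∈ D) := by
  cases hl : cutLabel G v D p q with
  | none =>
    rw [slideOrigin, hl]
    rw [cutLabel_eq_none] at hl
    refine (or_iff_left ?_).symm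
    rintro ⟨rfl, hq⟩
    exact hl 1 (one_smul _ _) (by simpa using hq)
  | some a =>
    have h' := (cutLabel_eq_some hs.disjoint).1 hl
    rw [slideOrigin, hl, Option.elim, hs.beyond_iff h, h'.1]
    refine or_congr_right ⟨?_, ?_⟩
    · rintro rfl
      simpa [eq_comm] using h'
    · rintro ⟨rfl, hq⟩
      have h1 : cutLabel G p D p q = some 1 := by
        rw [cutLabel_eq_some hs.disjoint]
        simpa using hq
      rw [h1] at hl
      exact (Option.some_inj.1 hl).symm

lemma origin_mem_beyond_comm (h : IsFreeGTree G Γ) {p q : V} (hpq : Γ.Adj p q) (a : G) :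
    a • slideOrigin G v D d p q ∈ beyond Γ v D ↔ a • slideOrigin G v D d q p ∈ beyond Γ v D := by
  rw [← hs.origin_smul, ← hs.origin_smul, hs.origin_mem_beyond h, hs.origin_mem_beyond h]
  have := h.smul a _ _ hpq
  exact ⟨beyond_adj h.isTree hs.adj this, beyond_adj h.isTree hs.adj this.symm⟩

lemma origin_ne (h : IsFreeGTree G Γ) {p q : V} (hpq : Γ.Adj p q)
    (h1 : ¬ InOrbit G v d p q) (h2 : ¬ InOrbit G v d q p) :
    slideOrigin G v D d p q ≠ slideOrigin G v D d q p := by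
  intro he
  have h3 := hs.origin_mem_side h hpq h1 h2 p q
  rw [he, hs.origin_mem_side h hpq h1 h2] at h3
  exact not_mem_side p q (h3.1 (mem_side_self hpq.ne))

lemma adj_of_inOrbit (h : IsFreeGTree G Γ) {p q : V} (hpq : InOrbit G v d p q) : Γ.Adj p q := by
  obtain ⟨a, rfl, rfl⟩ := hpq
  exact h.smul a _ _ (hs.adj d hs.mem)

lemma graph_adj_of_inOrbit (h : IsFreeGTree G Γ) {p q : V} (hpq : InOrbit G v d p q) :
    (slideGraph G Γ v D d).Adj p q := ⟨(hs.adj_of_inOrbit h hpq).ne, .inr (.inl hpq)⟩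

lemma graph_adj_origin (h : IsFreeGTree G Γ) {p q : V} (hpq : Γ.Adj p q)
    (h1 : ¬ InOrbit G v d p q) (h2 : ¬ InOrbit G v d q p) :
    (slideGraph G Γ v D d).Adj (slideOrigin G v D d p q) (slideOrigin G v D d q p) :=
  ⟨hs.origin_ne h hpq h1 h2, .inl ⟨p, q, hpq, h1, h2, rfl, rfl⟩⟩

lemma graph_dist_origin_le (h : IsFreeGTree G Γ) {p q : V} (hpq : Γ.Adj p q) :
    (slideGraph G Γ v D d).dist (slideOrigin G v D d p q) (slideOrigin G v D d q p) ≤ 1 := by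
  by_cases h1 : InOrbit G v d p q
  · rw [hs.origin_left h1, hs.origin_right h1, SimpleGraph.dist_self]
    exact zero_le_one
  by_cases h2 : InOrbit G v d q p
  · rw [hs.origin_left h2, hs.origin_right h2, SimpleGraph.dist_self]
    exact zero_le_one
  exact (dist_eq_one_iff_adj.2 (hs.graph_adj_origin h hpq h1 h2)).le

lemma graph_smul (h : IsFreeGTree G Γ) (b : G) {x y : V}
    (hxy : (slideGraph G Γ v D d).Adj x y) :
    (slideGraph G Γ v D d).Adj (b • x) (b • y) := by
  obtain ⟨hne, ⟨p, q, hpq, h1, h2, rfl, rfl⟩ | hxy | hxy⟩ := hxy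
  · rw [← hs.origin_smul, ← hs.origin_smul]
    exact hs.graph_adj_origin h (h.smul b _ _ hpq) (fun h3 => h1 ((inOrbit_smul_iff b).1 h3))
      fun h3 => h2 ((inOrbit_smul_iff b).1 h3)
  · exact hs.graph_adj_of_inOrbit h (hxy.smul b)
  · exact (hs.graph_adj_of_inOrbit h (hxy.smul b)).symm

/-- Each new edge that comes from an old one separates the same vertices as the old one. -/
lemma graph_cross_side (h : IsFreeGTree G Γ) {p q : V} (hpq : Γ.Adj p q)
    (h1 : ¬ InOrbit G v d p q) (h2 : ¬ InOrbit G v d q p) {x y : V}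
    (hxy : (slideGraph G Γ v D d).Adj x y)
    (hx : x ∉ side Γ p q) (hy : y ∈ side Γ p q) :
    x = slideOrigin G v D d p q ∧ y = slideOrigin G v D d q p := by
  obtain ⟨hne, ⟨p', q', hpq', h1', h2', rfl, rfl⟩ | hxy | hxy⟩ := hxy
  · rw [hs.origin_mem_side h hpq h1 h2] at hx hy
    obtain ⟨rfl, rfl⟩ := cross_side h.isTree hpq hpq' hx hy
    exact ⟨rfl, rfl⟩
  · obtain ⟨rfl, rfl⟩ := cross_side h.isTree hpq (hs.adj_of_inOrbit h hxy) hx hy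
    exact absurd hxy h1
  · obtain ⟨rfl, rfl⟩ := cross_side h.isTree hpq (hs.adj_of_inOrbit h hxy).symm hx hy
    exact absurd hxy h2

/-- A slid edge has both ends on the same side of each orbit edge, so each orbit edge is the only
one that crosses its own colouring. -/
lemma graph_cross_beyond (h : IsFreeGTree G Γ) (a : G) {x y : V}
    (hxy : (slideGraph G Γ v D d).Adj x y)
    (hx : a⁻¹ • x ∉ beyond Γ v D) (hy : a⁻¹ • y ∈ beyond Γ v D) : x = a • v ∧ y = a • d := by
  obtain ⟨hne, ⟨p', q', hpq', h1', h2', rfl, rfl⟩ | ⟨b, rfl, rfl⟩ | ⟨b, rfl, rfl⟩⟩ := hxy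
  · exact absurd ((hs.origin_mem_beyond_comm h hpq' a⁻¹).2 hy) hx
  · rw [← mul_smul] at hx hy
    rcases (hs.beyond_iff h _).1 hy with h3 | h3
    · exact absurd h3 hx
    · rw [inv_mul_eq_one] at h3
      subst h3
      exact ⟨rfl, rfl⟩
  · rw [← mul_smul] at hx hy
    exact absurd ((hs.beyond_iff h _).2 (.inl hy)) hx

lemma graph_reachable_origin (h : IsFreeGTree G Γ) (p q : V) :
    (slideGraph G Γ v D d).Reachable p (slideOrigin G v D d p q) := by
  rcases hs.origin_cases p q with h1 | h1
  · rw [h1]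
  · exact (hs.graph_adj_of_inOrbit h h1).reachable

lemma graph_connected (h : IsFreeGTree G Γ) : (slideGraph G Γ v D d).Connected := by
  have := h.isTree.1.nonempty
  refine ⟨fun x y => ?_⟩
  obtain ⟨w⟩ := h.isTree.1.preconnected x y
  induction w with
  | nil => exact Reachable.refl _
  | @cons p q _ hpq _ ih =>
    refine Reachable.trans ?_ ih
    by_cases h1 : InOrbit G v d p q
    · exact (hs.graph_adj_of_inOrbit h h1).reachable
    by_cases h2 : InOrbit G v d q p
    · exact (hs.graph_adj_of_inOrbit h h2).symm.reachable
    exact ((hs.graph_reachable_origin h p q).trans (hs.graph_adj_origin h hpq h1 h2).reachable).trans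
      (hs.graph_reachable_origin h q p).symm

lemma graph_isTree (h : IsFreeGTree G Γ) : (slideGraph G Γ v D d).IsTree := by
  refine ⟨hs.graph_connected h, isAcyclic_of_colourings ?_⟩
  have hv : ∀ a : G, a⁻¹ • a • v ∉ beyond Γ v D := fun a => by
    rw [inv_smul_smul]; exact not_mem_beyond
  have hd : ∀ a : G, a⁻¹ • a • d ∈ beyond Γ v D := fun a => by
    rw [inv_smul_smul]; exact ⟨d, hs.mem, mem_side_self (hs.adj d hs.mem).ne⟩
  rintro x y ⟨hne, ⟨p, q, hpq, h1, h2, rfl, rfl⟩ | ⟨a, rfl, rfl⟩ | ⟨a, rfl, rfl⟩⟩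
  · refine ⟨side Γ p q, ?_, ?_, fun x y hxy => hs.graph_cross_side h hpq h1 h2 hxy⟩
    · rw [hs.origin_mem_side h hpq h1 h2]; exact not_mem_side p q
    · rw [hs.origin_mem_side h hpq h1 h2]; exact mem_side_self hpq.ne
  · exact ⟨{x | a⁻¹ • x ∈ beyond Γ v D}, hv a, hd a, fun x y hxy => hs.graph_cross_beyond h a hxy⟩
  · refine ⟨{x | a⁻¹ • x ∉ beyond Γ v D}, not_not.2 (hd a), hv a, fun x y hxy hx hy => ?_⟩
    exact (hs.graph_cross_beyond h a hxy.symm hy (not_not.1 hx)).symm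

theorem graph_isFreeGTree (h : IsFreeGTree G Γ) : IsFreeGTree G (slideGraph G Γ v D d) where
  isTree := hs.graph_isTree h
  smul b _ _ := hs.graph_smul h b
  -- Vertices and action are unchanged, and in the old tree any two different vertices have trivial
  -- common stabilizer.
  free b x y hxy hx hy := h.eq_one_of_fixes hx hy hxy.1
  no_inversion := by
    rintro b x y ⟨hne, ⟨p, q, hpq, h1, h2, rfl, rfl⟩ | hxy | hxy⟩ ⟨hx, hy⟩
    · have h3 := hs.origin_mem_side h hpq h1 h2 (b • q) (b • p)
      have h4 := hs.origin_mem_side h hpq h1 h2 (b • p) (b • q)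
      rw [hs.origin_smul, hy, hs.origin_mem_side h hpq h1 h2] at h3
      rw [hs.origin_smul, hx, hs.origin_mem_side h hpq h1 h2] at h4
      obtain ⟨e1, e2⟩ := cross_side h.isTree hpq (h.smul b _ _ hpq.symm)
        (fun h5 => not_mem_side p q (h3.2 h5)) (h4.1 (mem_side_self hpq.ne))
      exact h.no_inversion b p q hpq ⟨e2, e1⟩
    · exact h.no_inversion b x y (hs.adj_of_inOrbit h hxy) ⟨hx, hy⟩
    · exact h.no_inversion b y x (hs.adj_of_inOrbit h hxy) ⟨hy, hx⟩
  finite_vertices := h.finite_vertices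
  finite_edges := by
    obtain ⟨F, hF, hFe⟩ := h.finite_edges
    refine ⟨(fun e : V × V => (slideOrigin G v D d e.1 e.2, slideOrigin G v D d e.2 e.1)) '' F ∪
      {(v, d), (d, v)}, (hF.image _).union (by simp), ?_⟩
    rintro x y ⟨hne, ⟨p, q, hpq, h1, h2, rfl, rfl⟩ | ⟨a, rfl, rfl⟩ | ⟨a, rfl, rfl⟩⟩
    · obtain ⟨b, hb⟩ := hFe p q hpq
      exact ⟨b, .inl ⟨_, hb, by simp only [hs.origin_smul]⟩⟩
    · exact ⟨a⁻¹, .inr (by rw [inv_smul_smul, inv_smul_smul]; exact .inl rfl)⟩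
    · exact ⟨a⁻¹, .inr (by rw [inv_smul_smul, inv_smul_smul]; exact .inr rfl)⟩

/-- Every label present on one side of the turn only moves an origin over one orbit edge. By `hcut`
such a turn uses the translate of `w₀`, whose edge pays the toll. -/
lemma turn_cost_le (h : IsFreeGTree G Γ) {w₀ : V}
    (hvw : InOrbit G v d v w₀ ∨ InOrbit G v d w₀ v) {p q r : V}
    (hcut : ∀ a : G, a • v = p → ¬ (a⁻¹ • q ∈ D ↔ a⁻¹ • r ∈ D) → a • w₀ = q ∨ a • w₀ = r) :
    (slideGraph G Γ v D d).dist (slideOrigin G v D d p q) (slideOrigin G v D d p r) ≤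
      slideToll G v w₀ D p q r + slideToll G v w₀ D p r q := by
  have hadj : ∀ a : G, (slideGraph G Γ v D d).Adj (a • d) (a • v) := fun a =>
    (hs.graph_adj_of_inOrbit h ⟨a, rfl, rfl⟩).symm
  have hpay : ∀ a : G, a • v = p → ¬ (a⁻¹ • q ∈ D ↔ a⁻¹ • r ∈ D) →
      (slideToll G v w₀ D p q r = 1 ∧ a • w₀ = q) ∨
      (slideToll G v w₀ D p r q = 1 ∧ a • w₀ = r) := by
    intro a hap ha
    rcases hcut a hap ha with rfl | rfl
    · rw [inv_smul_smul] at ha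
      exact .inl ⟨if_pos ⟨a, hap, rfl, ha⟩, rfl⟩
    · rw [inv_smul_smul, iff_comm] at ha
      exact .inr ⟨if_pos ⟨a, hap, rfl, ha⟩, rfl⟩
  have hw : v ≠ w₀ := by
    rcases hvw with hvw | hvw
    · exact (hs.adj_of_inOrbit h hvw).ne
    · exact (hs.adj_of_inOrbit h hvw).ne'
  have hq : ∀ a, cutLabel G v D p q = some a ↔ a • v = p ∧ a⁻¹ • q ∈ D := fun a =>
    cutLabel_eq_some hs.disjoint
  have hr : ∀ a, cutLabel G v D p r = some a ↔ a • v = p ∧ a⁻¹ • r ∈ D := fun a =>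
    cutLabel_eq_some hs.disjoint
  by_cases heq : cutLabel G v D p q = cutLabel G v D p r
  · rw [slideOrigin, slideOrigin, heq, SimpleGraph.dist_self]
    exact zero_le
  have hpq : ∀ a, cutLabel G v D p q = some a → ¬ (a⁻¹ • q ∈ D ↔ a⁻¹ • r ∈ D) := by
    intro a ha hiff
    exact heq (ha.trans ((hr a).2 ⟨((hq a).1 ha).1, hiff.1 ((hq a).1 ha).2⟩).symm)
  have hpr : ∀ a, cutLabel G v D p r = some a → ¬ (a⁻¹ • q ∈ D ↔ a⁻¹ • r ∈ D) := by
    intro a ha hiff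
    exact heq (((hq a).2 ⟨((hr a).1 ha).1, hiff.2 ((hr a).1 ha).2⟩).trans ha.symm)
  cases h1 : cutLabel G v D p q with
  | none =>
    cases h2 : cutLabel G v D p r with
    | none => exact absurd (h1.trans h2.symm) heq
    | some b =>
      have h3 := ((hr b).1 h2).1
      have h4 := hpay b h3 (hpr b h2)
      rw [slideOrigin, slideOrigin, h1, h2]
      simp only [Option.elim]
      rw [← h3, dist_eq_one_iff_adj.2 (hadj b).symm, h3]
      omega
  | some a =>
    have h3 := ((hq a).1 h1).1
    have h4 := hpay a h3 (hpq a h1)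
    cases h2 : cutLabel G v D p r with
    | none =>
      rw [slideOrigin, slideOrigin, h1, h2]
      simp only [Option.elim]
      rw [← h3, dist_eq_one_iff_adj.2 (hadj a), h3]
      omega
    | some b =>
      have h5 := ((hr b).1 h2).1
      have h6 := hpay b h5 (hpr b h2)
      -- Two different labels are paid for by different edges of the turn, which makes the total
      -- distance at most two tolls.
      have hab : ∀ {z : V}, a • w₀ = z → b • w₀ = z → False := by
        intro z hz hz'
        have := h.eq_one_of_fixes (g := b⁻¹ * a) (x := v) (y := w₀)
          (by rw [mul_smul, h3, ← h5, inv_smul_smul]) (by rw [mul_smul, hz, ← hz', inv_smul_smul]) hw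
        rw [inv_mul_eq_one] at this
        exact heq (by rw [h1, h2, this])
      have h7 : slideToll G v w₀ D p q r = 1 ∧ slideToll G v w₀ D p r q = 1 := by
        rcases h4 with h4 | h4 <;> rcases h6 with h6 | h6
        · exact (hab h4.2 h6.2).elim
        · exact ⟨h4.1, h6.1⟩
        · exact ⟨h6.1, h4.1⟩
        · exact (hab h4.2 h6.2).elim
      have h8 := (hs.graph_connected h).dist_triangle (u := a • d) (v := p) (w := b • d)
      have h9 := dist_eq_one_iff_adj.2 (hadj a)
      have h10 := dist_eq_one_iff_adj.2 (hadj b).symm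
      rw [h3] at h9
      rw [h5] at h10
      rw [slideOrigin, slideOrigin, h1, h2]
      simp only [Option.elim]
      omega

/-- Only an edge in the orbit is charged a toll, and it collapses to length zero. It is not charged
at both ends, since this would give an inversion. -/
lemma edge_cost_le (h : IsFreeGTree G Γ) {w₀ : V}
    (hvw : InOrbit G v d v w₀ ∨ InOrbit G v d w₀ v) {p q : V} (hpq : Γ.Adj p q) (r r' : V) :
    (slideGraph G Γ v D d).dist (slideOrigin G v D d p q) (slideOrigin G v D d q p) +
      slideToll G v w₀ D p q r + slideToll G v w₀ D q p r' ≤ 1 := by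
  have horb : ∀ a : G, InOrbit G v d (a • v) (a • w₀) ∨ InOrbit G v d (a • w₀) (a • v) := fun a => by
    rw [inOrbit_smul_iff, inOrbit_smul_iff]
    exact hvw
  have h1 := hs.graph_dist_origin_le h hpq
  have h0 : InOrbit G v d p q ∨ InOrbit G v d q p →
      (slideGraph G Γ v D d).dist (slideOrigin G v D d p q) (slideOrigin G v D d q p) = 0 := by
    rintro (h2 | h2)
    · rw [hs.origin_left h2, hs.origin_right h2, SimpleGraph.dist_self]
    · rw [hs.origin_left h2, hs.origin_right h2, SimpleGraph.dist_self]
  unfold slideToll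
  split_ifs with h2 h3 h3
  · obtain ⟨a, ha, ha', -⟩ := h2
    obtain ⟨b, hb, hb', -⟩ := h3
    refine absurd ⟨?_, ?_⟩ (h.no_inversion (b * a⁻¹) p q hpq)
    · rw [← ha, mul_smul, inv_smul_smul, hb]
    · rw [← ha', mul_smul, inv_smul_smul, hb']
  · obtain ⟨a, rfl, rfl, -⟩ := h2
    rw [h0 (horb a)]
  · obtain ⟨a, rfl, rfl, -⟩ := h3
    rw [h0 (horb a).symm]
  · omega

/-- The slide does not increase translation lengths, if all turns that are cut contain the
direction of `w₀`; and the length drops if some turn with this direction is not cut. -/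
theorem exists_dist_le (h : IsFreeGTree G Γ) {w₀ : V}
    (hvw : InOrbit G v d v w₀ ∨ InOrbit G v d w₀ v) {l : ℤ → V}
    (hl : ∀ n, Γ.Adj (l n) (l (n + 1))) {b : G} {t : ℕ} (ht : 0 < t)
    (hb : ∀ n, b • l n = l (n + t))
    (hcut : ∀ (n : ℤ) (a : G), a • v = l (n + 1) → ¬ (a⁻¹ • l n ∈ D ↔ a⁻¹ • l (n + 2) ∈ D) →
      a • w₀ = l n ∨ a • w₀ = l (n + 2)) :
    (∃ y, (slideGraph G Γ v D d).dist y (b • y) ≤ t) ∧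
    ((∃ (n : ℤ) (a : G), a • v = l (n + 1) ∧ (a • w₀ = l n ∨ a • w₀ = l (n + 2)) ∧
      (a⁻¹ • l n ∈ D ↔ a⁻¹ • l (n + 2) ∈ D)) →
      ∃ y, (slideGraph G Γ v D d).dist y (b • y) < t) := by
  set y : ℤ → V := fun n => slideOrigin G v D d (l n) (l (n + 1)) with hy
  -- `β n` is the toll of the `n`-th edge at its start. It is carried from edge to edge, and being
  -- periodic it cancels over one period of the axis.
  set β : ℤ → ℕ := fun n => slideToll G v w₀ D (l n) (l (n + 1)) (l (n - 1)) with hβ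
  have hyt : ∀ n, y (n + t) = b • y n := by
    intro n
    simp only [hy]
    rw [← hs.origin_smul, hb, hb, add_right_comm]
  have hβt : ∀ n, β (n + t) = β n := by
    intro n
    simp only [hβ]
    rw [show n + t + 1 = n + 1 + t by ring, show n + t - 1 = n - 1 + t by ring, ← hb, ← hb, ← hb,
      slideToll_smul]
  have hstep : ∀ n, (slideGraph G Γ v D d).dist (y n) (y (n + 1)) + β n ≤
      (slideGraph G Γ v D d).dist (slideOrigin G v D d (l n) (l (n + 1)))
        (slideOrigin G v D d (l (n + 1)) (l n)) + slideToll G v w₀ D (l n) (l (n + 1)) (l (n - 1)) +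
        slideToll G v w₀ D (l (n + 1)) (l n) (l (n + 2)) + β (n + 1) := by
    intro n
    have h1 := hs.turn_cost_le h hvw (hcut n)
    have h2 := (hs.graph_connected h).dist_triangle (u := y n)
      (v := slideOrigin G v D d (l (n + 1)) (l n)) (w := y (n + 1))
    simp only [hy, hβ] at h1 h2 ⊢
    rw [add_sub_cancel_right]
    rw [show n + 1 + 1 = n + 2 by ring] at h2 ⊢
    omega
  have hle : ∀ n, (slideGraph G Γ v D d).dist (y n) (y (n + 1)) + β n ≤ 1 + β (n + 1) := fun n =>
    (hstep n).trans (Nat.add_le_add_right (hs.edge_cost_le h hvw (hl n) _ _) _)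
  -- Summation of `hle` over one period; `e` is a unit saved on the first edge.
  have key : ∀ n e, (slideGraph G Γ v D d).dist (y n) (y (n + 1)) + β n + e ≤ 1 + β (n + 1) →
      (slideGraph G Γ v D d).dist (y n) (b • y n) + e ≤ t := by
    intro n e hne
    have : ∀ i : ℕ, (slideGraph G Γ v D d).dist (y n) (y (n + 1 + i)) + β n + e ≤
        1 + i + β (n + 1 + i) := by
      intro i
      induction i with
      | zero => simpa using hne
      | succ i ih =>
        have h1 := hle (n + 1 + i)
        have h2 := (hs.graph_connected h).dist_triangle (u := y n) (v := y (n + 1 + i))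
          (w := y (n + 1 + i + 1))
        push_cast
        rw [← add_assoc]
        omega
    obtain ⟨i, rfl⟩ := Nat.exists_eq_add_of_lt ht
    have h1 := this i
    rw [show n + 1 + (i : ℤ) = n + ((0 + i + 1 : ℕ) : ℤ) by push_cast; ring, hyt, hβt] at h1
    omega
  refine ⟨⟨y 0, key 0 0 (hle 0)⟩, ?_⟩
  -- An orbit edge on the axis that is charged at neither end collapses without compensation and
  -- saves one.
  have hzero : ∀ n, InOrbit G v d (l n) (l (n + 1)) ∨ InOrbit G v d (l (n + 1)) (l n) →
      slideToll G v w₀ D (l n) (l (n + 1)) (l (n - 1)) = 0 →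
      slideToll G v w₀ D (l (n + 1)) (l n) (l (n + 2)) = 0 →
      ∃ y, (slideGraph G Γ v D d).dist y (b • y) < t := by
    intro n h1 h2 h3
    refine ⟨y n, key n 1 ?_⟩
    have h4 := hstep n
    rw [h2, h3] at h4
    have h5 : (slideGraph G Γ v D d).dist (slideOrigin G v D d (l n) (l (n + 1)))
        (slideOrigin G v D d (l (n + 1)) (l n)) = 0 := by
      rcases h1 with h1 | h1
      · rw [hs.origin_left h1, hs.origin_right h1, SimpleGraph.dist_self]
      · rw [hs.origin_left h1, hs.origin_right h1, SimpleGraph.dist_self]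
    omega
  have hw : v ≠ w₀ := by
    rcases hvw with hvw | hvw
    · exact (hs.adj_of_inOrbit h hvw).ne
    · exact (hs.adj_of_inOrbit h hvw).ne'
  have huniq : ∀ {a c : G}, a • v = c • v → a • w₀ = c • w₀ → c = a := by
    intro a c h1 h2
    have := h.eq_one_of_fixes (g := c⁻¹ * a) (x := v) (y := w₀)
      (by rw [mul_smul, h1, inv_smul_smul]) (by rw [mul_smul, h2, inv_smul_smul]) hw
    rwa [inv_mul_eq_one] at this
  have horb : ∀ a : G, InOrbit G v d (a • v) (a • w₀) ∨ InOrbit G v d (a • w₀) (a • v) := fun a => by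
    rw [inOrbit_smul_iff, inOrbit_smul_iff]
    exact hvw
  have hinv : ∀ {a c : G} {p q : V}, Γ.Adj p q → a • v = p → a • w₀ = q → c • v = q → c • w₀ = p →
      False := by
    intro a c p q hpq h1 h2 h3 h4
    refine h.no_inversion (c * a⁻¹) p q hpq ⟨?_, ?_⟩
    · rw [← h1, mul_smul, inv_smul_smul, h3]
    · rw [← h2, mul_smul, inv_smul_smul, h4]
  rintro ⟨n, a, hav, haw | haw, hiff⟩
  · refine hzero n ?_ (if_neg ?_) (if_neg ?_)
    · rw [← hav, ← haw]; exact (horb a).symm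
    · rintro ⟨c, hc, hc', -⟩
      exact hinv (hl n) hc hc' hav haw
    · rintro ⟨c, hc, hc', hne⟩
      obtain rfl := huniq (hc.trans hav.symm) (hc'.trans haw.symm)
      rw [← haw, inv_smul_smul] at hiff
      exact hne hiff
  · have hl' := hl (n + 1)
    have e : n + 1 + 1 = n + 2 := by ring
    refine hzero (n + 1) ?_ (if_neg ?_) (if_neg ?_)
    · rw [e, ← hav, ← haw]; exact horb a
    · rw [e]
      rintro ⟨c, hc, hc', hne⟩
      obtain rfl := huniq (hc.trans hav.symm) (hc'.trans haw.symm)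
      rw [← haw, inv_smul_smul] at hiff
      rw [add_sub_cancel_right] at hne
      exact hne hiff.symm
    · rw [e]
      rw [e] at hl'
      rintro ⟨c, hc, hc', -⟩
      exact hinv hl' hav haw hc hc'

end IsSlide
end Slides
end Grushko

/-! ### Translation lengths and optimal models -/

namespace Grushko

open SimpleGraph

section TranslationLength

variable {G : Type*} [Group G] {V : Type*} [MulAction G V] {Γ : SimpleGraph V}

/-- The minimal displacement of a group element. -/
noncomputable def translationLength (Γ : SimpleGraph V) (b : G) : ℕ :=
  sInf (Set.range fun x => Γ.dist x (b • x))

lemma translationLength_le (b : G) (x : V) : translationLength Γ b ≤ Γ.dist x (b • x) :=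
  Nat.sInf_le ⟨x, rfl⟩

lemma exists_dist_eq_translationLength [Nonempty V] (Γ : SimpleGraph V) (b : G) :
    ∃ x, Γ.dist x (b • x) = translationLength Γ b :=
  Nat.sInf_mem (Set.range_nonempty fun x => Γ.dist x (b • x))

lemma dist_map_le {V' : Type*} {Γ' : SimpleGraph V'} (hΓ : Γ.Connected) (hΓ' : Γ'.Connected)
    {ρ : V → V'} (hρ : ∀ p q, Γ.Adj p q → ρ p = ρ q ∨ Γ'.Adj (ρ p) (ρ q)) (x y : V) :
    Γ'.dist (ρ x) (ρ y) ≤ Γ.dist x y := by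
  obtain ⟨p, hp⟩ := hΓ.exists_walk_length_eq_dist x y
  rw [← hp]
  clear hp
  induction p with
  | nil => simp
  | @cons a b c hab q ih =>
    rw [Walk.length_cons]
    rcases hρ a b hab with h | h
    · rw [h]; omega
    · have h1 := hΓ'.dist_triangle (u := ρ a) (v := ρ b) (w := ρ c)
      rw [dist_eq_one_iff_adj.2 h] at h1
      omega

lemma reachable_map {V' : Type*} {Γ' : SimpleGraph V'} {ρ : V → V'}
    (hρ : ∀ p q, Γ.Adj p q → ρ p = ρ q ∨ Γ'.Adj (ρ p) (ρ q)) {x y : V} (hxy : Γ.Reachable x y) :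
    Γ'.Reachable (ρ x) (ρ y) := by
  obtain ⟨p⟩ := hxy
  induction p with
  | nil => exact Reachable.refl _
  | @cons a b c hab q ih =>
    rcases hρ a b hab with h | h
    · rwa [h]
    · exact h.reachable.trans ih

/-- The number of orbits of vertices. -/
noncomputable def orbitCount (G : Type*) [Group G] (V : Type*) [MulAction G V] : ℕ :=
  sInf {n | ∃ F : Finset V, F.card = n ∧ ∀ v, ∃ a : G, a • v ∈ F}

end TranslationLength

/-- Trees like Grushko trees, but not necessarily minimal and possibly with superfluous vertices of
degree two. -/
structure GrushkoModel {G : Type u} [Group G] {k : ℕ} (A : Fin k → Subgroup G) where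
  /-- the vertices -/
  V : Type u
  /-- the action of the group on the vertices -/
  act : MulAction G V
  /-- the underlying graph -/
  graph : SimpleGraph V
  isFreeGTree : IsFreeGTree G graph
  fixes : ∀ H : Subgroup G, IsPeripheralSubgroup A H → ∃ v : V, ∀ h ∈ H, h • v = v
  elliptic : ∀ (a : G) (v : V), a • v = v → IsPeripheral A a

namespace GrushkoModel

variable {G : Type u} [Group G] {k : ℕ} {A : Fin k → Subgroup G} {m : ℕ} {g : Fin m → G}

instance (P : GrushkoModel A) : MulAction G P.V := P.act

/-- The total translation length of the generators. -/
noncomputable def cost (P : GrushkoModel A) (g : Fin m → G) : ℕ :=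
  ∑ j, translationLength P.graph (g j)

lemma smul_ne (P : GrushkoModel A) {a : G} (ha : ¬ IsPeripheral A a) (x : P.V) : a • x ≠ x :=
  fun h => ha (P.elliptic a x h)

lemma nonempty (P : GrushkoModel A) : Nonempty P.V := P.isFreeGTree.isTree.1.nonempty

/-- The model given by a Grushko tree. -/
def ofGrushko {T : GATree A} (hT : T.IsGrushko) : GrushkoModel A where
  V := T.V
  act := T.act
  graph := T.graph
  isFreeGTree := T.isFreeGTree hT.edges
  fixes := T.peripheral_fixes
  elliptic a v h := hT.elliptic a ⟨v, h⟩

/-- The model after a slide. -/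
def slide (P : GrushkoModel A) {v d : P.V} {D : Set P.V} (hs : IsSlide G P.graph v D d) :
    GrushkoModel A where
  V := P.V
  act := P.act
  graph := slideGraph G P.graph v D d
  isFreeGTree := hs.graph_isFreeGTree P.isFreeGTree
  fixes := P.fixes
  elliptic := P.elliptic

/-- The orbit of a leaf can be removed. -/
theorem exists_of_leaf (P : GrushkoModel A) (g : Fin m → G) {x w : P.V} (hxw : P.graph.Adj x w)
    (hx : ∀ y, P.graph.Adj x y → y = w) :
    ∃ Q : GrushkoModel A, Q.cost g ≤ P.cost g ∧ orbitCount G Q.V < orbitCount G P.V := by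
  classical
  have h := P.isFreeGTree
  have hleaf : ∀ (b : G) y, P.graph.Adj (b • x) y → y = b • w := by
    intro b y hy
    rw [← hx (b⁻¹ • y) (by simpa using h.smul b⁻¹ _ _ hy), smul_inv_smul]
  -- If the neighbour of a leaf were a translate of the leaf, some element would invert the edge.
  have hw : ∀ a b : G, b • w ≠ a • x := by
    intro a b hab
    refine h.no_inversion (b⁻¹ * a) x w hxw ⟨by rw [mul_smul, ← hab, inv_smul_smul], ?_⟩
    have h1 := h.smul b _ _ hxw.symm
    rw [hab] at h1
    rw [mul_smul, ← hleaf a _ h1, inv_smul_smul]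
  have hstab : ∀ a : G, a • x = x → a = 1 := by
    intro a ha
    refine h.free a x w hxw ha (hx _ ?_)
    have := h.smul a _ _ hxw
    rwa [ha] at this
  let S : Set P.V := {y | ∀ a : G, y ≠ a • x}
  have hS : ∀ (b : G), ∀ y ∈ S, b • y ∈ S := by
    intro b y hy a ha
    exact hy (b⁻¹ * a) (by rw [mul_smul, ← ha, inv_smul_smul])
  let act : MulAction G S :=
    { smul := fun b y => ⟨b • y.1, hS b y.1 y.2⟩
      one_smul := fun y => Subtype.ext (one_smul G y.1)
      mul_smul := fun a b y => Subtype.ext (mul_smul a b y.1) }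
  have hcoe : ∀ (b : G) (y : S), (b • y).1 = b • y.1 := fun _ _ => rfl
  -- The equivariant retraction pushes each translate of the leaf to its only neighbour; it does not
  -- increase distances.
  have hret : ∀ y : P.V, ∃ z : S, (y ∈ S → z.1 = y) ∧ ∀ a : G, y = a • x → z.1 = a • w := by
    intro y
    by_cases hy : y ∈ S
    · exact ⟨⟨y, hy⟩, fun _ => rfl, fun a ha => absurd ha (hy a)⟩
    · have hy' : ∃ a : G, y = a • x := by
        by_contra hc
        exact hy fun a ha => hc ⟨a, ha⟩
      obtain ⟨a, rfl⟩ := hy'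
      refine ⟨⟨a • w, fun b => hw b a⟩, fun hc => absurd rfl (hc a), fun b hb => ?_⟩
      have := hstab (b⁻¹ * a) (by rw [mul_smul, hb, inv_smul_smul])
      rw [inv_mul_eq_one] at this
      rw [this]
  choose ρ hρS hρx using hret
  have hcases : ∀ y : P.V, y ∈ S ∨ ∃ a : G, y = a • x := by
    intro y
    by_cases hy : ∃ a : G, y = a • x
    · exact .inr hy
    · exact .inl fun a ha => hy ⟨a, ha⟩
  have hρadj : ∀ p q, P.graph.Adj p q → ρ p = ρ q ∨ (P.graph.induce S).Adj (ρ p) (ρ q) := by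
    have key : ∀ p q, P.graph.Adj p q → (∃ a : G, p = a • x) → ρ p = ρ q := by
      rintro p q hpq ⟨a, rfl⟩
      have hq := hleaf a q hpq
      refine Subtype.ext ?_
      rw [hρx _ a rfl, hρS q (by rw [hq]; exact fun b => hw b a), hq]
    intro p q hpq
    rcases hcases p with hp | hp
    · rcases hcases q with hq | hq
      · right
        rw [SimpleGraph.induce_adj, hρS p hp, hρS q hq]
        exact hpq
      · exact .inl (key q p hpq.symm hq).symm
    · exact .inl (key p q hpq hp)
  have hρsmul : ∀ (b : G) (y : P.V), ρ (b • y) = b • ρ y := by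
    intro b y
    refine Subtype.ext ?_
    rw [hcoe]
    rcases hcases y with hy | ⟨a, rfl⟩
    · rw [hρS y hy, hρS _ (hS b y hy)]
    · rw [hρx _ a rfl, ← mul_smul, hρx _ (b * a) rfl, mul_smul]
  have hwS : w ∈ S := fun a ha => hw a 1 (by rwa [one_smul])
  have hconn : (P.graph.induce S).Connected := by
    have : Nonempty S := ⟨⟨w, hwS⟩⟩
    refine ⟨fun y z => ?_⟩
    have := reachable_map hρadj (h.isTree.1.preconnected y.1 z.1)
    rwa [show ρ y.1 = y from Subtype.ext (hρS _ y.2),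
      show ρ z.1 = z from Subtype.ext (hρS _ z.2)] at this
  refine ⟨{
    V := S
    act := act
    graph := P.graph.induce S
    isFreeGTree := ⟨⟨hconn, h.isTree.2.induce S⟩, fun b y z hyz => h.smul b _ _ hyz,
      fun b y z hyz h1 h2 => h.free b _ _ hyz (congrArg Subtype.val h1) (congrArg Subtype.val h2),
      fun b y z hyz h1 => h.no_inversion b _ _ hyz
        ⟨congrArg Subtype.val h1.1, congrArg Subtype.val h1.2⟩, ?_, ?_⟩
    fixes := ?_
    elliptic := fun a y hy => P.elliptic a y.1 (congrArg Subtype.val hy) }, ?_, ?_⟩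
  · obtain ⟨F, hF, hFv⟩ := h.finite_vertices
    refine ⟨Subtype.val ⁻¹' F, hF.preimage Subtype.val_injective.injOn, fun y => ?_⟩
    exact hFv y.1
  · obtain ⟨F, hF, hFe⟩ := h.finite_edges
    refine ⟨Prod.map Subtype.val Subtype.val ⁻¹' F, hF.preimage
      (Subtype.val_injective.prodMap Subtype.val_injective).injOn, fun y z hyz => ?_⟩
    exact hFe y.1 z.1 hyz
  · intro H hH
    obtain ⟨y, hy⟩ := P.fixes H hH
    exact ⟨ρ y, fun a ha => by rw [← hρsmul, hy a ha]⟩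
  · refine Finset.sum_le_sum fun j _ => ?_
    have := P.nonempty
    obtain ⟨y, hy⟩ := exists_dist_eq_translationLength P.graph (g j)
    rw [← hy]
    refine (translationLength_le (Γ := P.graph.induce S) (g j) (ρ y)).trans ?_
    rw [← hρsmul]
    exact dist_map_le h.isTree.1 hconn hρadj _ _
  · have hne : {n | ∃ F : Finset P.V, F.card = n ∧ ∀ v, ∃ a : G, a • v ∈ F}.Nonempty := by
      obtain ⟨F, hF, hFv⟩ := h.finite_vertices
      exact ⟨_, hF.toFinset, rfl, fun v => by simpa using hFv v⟩
    -- A smallest set of orbit representatives contains a translate of the leaf, which is now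
    -- dispensable.
    obtain ⟨F, hF, hFv⟩ := Nat.sInf_mem hne
    have hlt : (F.subtype (· ∈ S)).card < F.card := by
      rw [Finset.card_subtype]
      obtain ⟨a, ha⟩ := hFv x
      exact Finset.card_lt_card (Finset.filter_ssubset.2 ⟨_, ha, fun hc => hc a rfl⟩)
    refine lt_of_le_of_lt (Nat.sInf_le ⟨F.subtype (· ∈ S), rfl, fun y => ?_⟩) (hlt.trans_eq hF)
    obtain ⟨a, ha⟩ := hFv y.1
    exact ⟨a, Finset.mem_subtype.2 ha⟩

/-- An optimal model has no leaves. -/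
def IsOptimal (P : GrushkoModel A) (g : Fin m → G) : Prop :=
  ∀ Q : GrushkoModel A, P.cost g ≤ Q.cost g ∧
    (Q.cost g ≤ P.cost g → orbitCount G P.V ≤ orbitCount G Q.V)

/-- Cost and number of vertex orbits are minimised lexicographically. -/
lemma exists_isOptimal (P : GrushkoModel A) (g : Fin m → G) :
    ∃ Q : GrushkoModel A, Q.IsOptimal g := by
  obtain ⟨_, ⟨Q, rfl⟩, hQ⟩ := (wellFounded_lt (α := ℕ ×ₗ ℕ)).has_min
    (Set.range fun P : GrushkoModel A => toLex (P.cost g, orbitCount G P.V)) ⟨_, P, rfl⟩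
  refine ⟨Q, fun R => ?_⟩
  have := hQ _ ⟨R, rfl⟩
  rw [Prod.Lex.toLex_lt_toLex] at this
  simp only [not_or, not_and, not_lt] at this
  exact ⟨this.1, fun h => this.2 (le_antisymm h this.1)⟩

lemma IsOptimal.exists_adj_ne {P : GrushkoModel A} (hP : P.IsOptimal g) {x w : P.V}
    (hxw : P.graph.Adj x w) : ∃ y, P.graph.Adj x y ∧ y ≠ w := by
  by_contra! hc
  obtain ⟨Q, h1, h2⟩ := P.exists_of_leaf g hxw hc
  exact absurd ((hP Q).2 h1) (not_le.2 h2)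

/-- As there are finitely many vertex orbits, some vertex is at maximal distance from the invariant
subtree. Outside the subtree it would have a neighbour farther away, because an optimal model has no
leaves. -/
lemma IsOptimal.eq_univ {P : GrushkoModel A} (hP : P.IsOptimal g) {S : Set P.V}
    (hS : ∀ b : G, ∀ v ∈ S, b • v ∈ S) (hconn : (P.graph.induce S).Connected) : S = Set.univ := by
  have h := P.isFreeGTree
  by_contra hne
  obtain ⟨x₀, hx₀⟩ := (Set.ne_univ_iff_exists_notMem S).1 hne
  obtain ⟨⟨s₀, hs₀⟩⟩ := hconn.nonempty
  set δ : P.V → ℕ := fun x => sInf (P.graph.dist x '' S) with hδ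
  have hδmem : ∀ x, ∃ s ∈ S, P.graph.dist x s = δ x := fun x =>
    Nat.sInf_mem (Set.Nonempty.image _ ⟨s₀, hs₀⟩)
  have hδle : ∀ x, ∀ s ∈ S, δ x ≤ P.graph.dist x s := fun x s hs => Nat.sInf_le ⟨s, hs, rfl⟩
  have hδsmul : ∀ (b : G) x, δ x ≤ δ (b • x) := by
    intro b x
    obtain ⟨s, hs, hxs⟩ := hδmem (b • x)
    rw [← hxs, ← h.dist_smul b⁻¹, inv_smul_smul]
    exact hδle x _ (hS _ s hs)
  obtain ⟨F, hF, hFv⟩ := h.finite_vertices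
  have hFne : F.Nonempty := by
    obtain ⟨a, ha⟩ := hFv s₀
    exact ⟨_, ha⟩
  obtain ⟨y, hyF, hy⟩ := Set.exists_max_image F δ hF hFne
  have hmax : ∀ x, δ x ≤ δ y := by
    intro x
    obtain ⟨a, ha⟩ := hFv x
    exact (hδsmul a x).trans (hy _ ha)
  have hyS : y ∉ S := by
    intro hyS
    have h1 : δ x₀ = 0 := by
      have h2 := hδle y y hyS
      have h3 := hmax x₀
      rw [SimpleGraph.dist_self] at h2
      omega
    obtain ⟨s, hs, hxs⟩ := hδmem x₀
    rw [h1] at hxs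
    rw [h.isTree.1.dist_eq_zero_iff] at hxs
    exact hx₀ (hxs ▸ hs)
  obtain ⟨w, hyw, hw⟩ := exists_side h.isTree (v := y) (x := s₀) (by rintro rfl; exact hyS hs₀)
  obtain ⟨z, hyz, hzw⟩ := hP.exists_adj_ne hyw
  have hside : ∀ s ∈ S, s ∈ side P.graph y w := by
    intro s hs
    have key : ∀ {a b : S}, (P.graph.induce S).Walk a b → a.1 ∈ side P.graph y w →
        b.1 ∈ side P.graph y w := by
      intro a b p
      induction p with
      | nil => exact id
      | @cons a b c hab _ ih =>
        exact fun ha => ih (side_adj hab ha fun hby => hyS (hby ▸ b.2))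
    obtain ⟨p⟩ := hconn.preconnected ⟨s₀, hs₀⟩ ⟨s, hs⟩
    exact key p hw
  obtain ⟨s, hs, hzs⟩ := hδmem z
  have h1 : s ∈ side P.graph z y := by
    rw [← not_mem_side_iff h.isTree hyz]
    exact fun hc => hzw (side_unique h.isTree hyz hyw hc (hside s hs))
  have h2 := dist_of_mem_side h.isTree hyz h1
  have h3 := hmax z
  have h4 := hδle y s hs
  rw [← hzs, SimpleGraph.dist_comm] at h3
  rw [SimpleGraph.dist_comm] at h4
  omega

/-- If the two edges are not interchanged, the stabilizer is trivial. If `w₂` is a translate of `v`,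
the tree is a line and the group commutative. Otherwise a slide over the edge to `w₂` turns `v` into
a removable leaf, against optimality. -/
lemma IsOptimal.degree_two {P : GrushkoModel A} (hP : P.IsOptimal g)
    (hg : ∀ j, ¬ IsPeripheral A (g j))
    (hG : (∀ a : G, IsPeripheral A a → a = 1) → ∃ a b : G, a * b ≠ b * a)
    {v w₁ w₂ : P.V} (hN : P.graph.neighborSet v = {w₁, w₂}) :
    ∃ a : G, a • v = v ∧ a • w₁ = w₂ ∧ a • w₂ = w₁ := by
  have h := P.isFreeGTree
  have hmem : ∀ y, P.graph.Adj v y ↔ y = w₁ ∨ y = w₂ := fun y => by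
    rw [← mem_neighborSet, hN]
    rfl
  have h1 := (hmem w₁).2 (.inl rfl)
  have h2 := (hmem w₂).2 (.inr rfl)
  by_contra hswap
  have hstab : ∀ a : G, a • v = v → a = 1 := by
    intro a ha
    have h3 := h.smul a _ _ h1
    have h4 := h.smul a _ _ h2
    rw [ha, hmem] at h3 h4
    rcases h3 with h3 | h3
    · exact h.free a v w₁ h1 ha h3
    · rcases h4 with h4 | h4
      · exact absurd ⟨a, ha, h3, h4⟩ hswap
      · exact h.free a v w₂ h2 ha h4
  by_cases horb : ∃ a : G, a • v = w₂
  · obtain ⟨a, ha⟩ := horb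
    have h3 := h.smul a⁻¹ _ _ h2
    rw [← ha, inv_smul_smul] at h3
    have h4 : a⁻¹ • v = w₁ := by
      rcases (hmem _).1 h3.symm with h4 | h4
      · exact h4
      · refine absurd ⟨ha, ?_⟩ (h.no_inversion a v w₂ h2)
        rw [← h4, smul_inv_smul]
    have hz := exists_zpow_of_neighbors h.isTree.1 h.smul (x := v) (t := a) fun y hy => by
      rw [ha, h4]
      exact ((hmem y).1 hy).symm
    have hcomm := comm_of_forall_zpow hstab fun b => hz (b • v)
    obtain ⟨b, c, hbc⟩ := hG (by
      intro b hb
      rcases hb with rfl | ⟨H, hH, hb⟩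
      · rfl
      · obtain ⟨y, hy⟩ := P.fixes H hH
        obtain ⟨n, rfl⟩ := hz y
        have h5 := hy b hb
        rw [← mul_smul, hcomm, mul_smul] at h5
        exact hstab b (smul_left_cancel _ h5))
    exact hbc (hcomm b c)
  · have hs : IsSlide G P.graph v {w₁, w₂} w₂ :=
      ⟨fun c hc => (hmem c).2 hc, fun s hs _ _ _ => hstab s hs, .inr rfl,
        fun a ha => absurd ⟨a⁻¹, by rw [← ha, inv_smul_smul]⟩ horb⟩
    have hcost : (P.slide hs).cost g ≤ P.cost g := by
      refine Finset.sum_le_sum fun j _ => ?_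
      obtain ⟨l, t, ht, hl, hl2, hlt⟩ := h.exists_axis (P.smul_ne (hg j))
      -- All neighbours of `v` are in the slid set, so no turn is cut and no length increases.
      obtain ⟨y, hy⟩ := (hs.exists_dist_le h (w₀ := w₂) (.inl ⟨1, one_smul _ _, one_smul _ _⟩) hl ht
        hlt fun n a ha hc => by
          refine absurd ?_ hc
          have h3 := h.smul a⁻¹ _ _ (hl n).symm
          have h4 := h.smul a⁻¹ _ _ (hl (n + 1))
          rw [← ha, inv_smul_smul, hmem] at h3 h4
          rw [add_assoc] at h4
          exact iff_of_true h3 h4).1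
      have := P.nonempty
      obtain ⟨x, hx⟩ := exists_dist_eq_translationLength P.graph (g j)
      rw [← hx]
      exact ((translationLength_le (Γ := slideGraph G P.graph v {w₁, w₂} w₂) (g j) y).trans hy).trans
        (h.axis_le_dist hl hl2 hlt x)
    -- No slid edge starts at `v` any more: its own edges were moved to `w₂`, and edges moved
    -- elsewhere arrive at translates of `w₂`.
    obtain ⟨Q, hQ1, hQ2⟩ := (P.slide hs).exists_of_leaf g (x := v) (w := w₂)
      (hs.graph_adj_of_inOrbit h ⟨1, one_smul _ _, one_smul _ _⟩) (by
        have ho : ∀ p q, P.graph.Adj p q → slideOrigin G v {w₁, w₂} w₂ p q ≠ v := by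
          intro p q hpq hv
          rcases hs.origin_cases p q with h3 | ⟨a, -, h3⟩
          · rw [hv] at h3
            subst h3
            have h4 := hs.origin_of_some (p := v) (q := q) (one_smul G v)
              (by rw [inv_one, one_smul]; exact (hmem q).1 hpq)
            rw [hv, one_smul] at h4
            exact h2.ne h4
          · rw [hv] at h3
            exact horb ⟨a⁻¹, by rw [← h3, inv_smul_smul]⟩
        rintro y ⟨-, ⟨p, q, hpq, -, -, hx, -⟩ | ⟨a, ha, rfl⟩ | ⟨a, -, ha⟩⟩
        · exact absurd hx.symm (ho p q hpq)
        · rw [hstab a ha, one_smul]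
        · exact absurd ⟨a⁻¹, by rw [← ha, inv_smul_smul]⟩ horb)
    exact absurd ((hP Q).2 (hQ1.trans hcost)) (not_le.2 hQ2)

/-- The Grushko tree given by an optimal model. -/
def IsOptimal.tree {P : GrushkoModel A} (hP : P.IsOptimal g) (hg : ∀ j, ¬ IsPeripheral A (g j))
    (hG : (∀ a : G, IsPeripheral A a → a = 1) → ∃ a b : G, a * b ≠ b * a) : GATree A where
  V := P.V
  act := P.act
  graph := P.graph
  isTree := P.isFreeGTree.isTree
  len _ := 1
  len_pos _ _ := one_pos
  adj_smul := P.isFreeGTree.smul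
  len_smul _ _ _ _ := rfl
  no_inversion := P.isFreeGTree.no_inversion
  minimal _ hS hconn := hP.eq_univ hS hconn
  finite_vertices := P.isFreeGTree.finite_vertices
  finite_edges := P.isFreeGTree.finite_edges
  peripheral_fixes := P.fixes
  degree_two _ _ _ _ hN := hP.degree_two hg hG hN

end GrushkoModel

/-! ### Shortening slides and the existence of a reduced tree -/

namespace GATree

variable {G : Type u} [Group G] {k : ℕ} {A : Fin k → Subgroup G} {m : ℕ} {g : Fin m → G}
  {T : GATree A}

/-- The cost counts the generators and not their conjugates, so the turn is translated to the axis
of a generator. -/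
lemma exists_axis_through {v w w' : T.V} (hturn : T.IsTurn g v w w') : ∃ (j : Fin m) (l : T.Line)
    (n : ℤ) (c : G), T.IsAxis (g j) l ∧ c • v = l.pt (n + 1) ∧
      ((c • w = l.pt n ∧ c • w' = l.pt (n + 2)) ∨ (c • w' = l.pt n ∧ c • w = l.pt (n + 2))) := by
  obtain ⟨a, j, l, n, hl, rfl, h⟩ := hturn
  refine ⟨j, l.smul a⁻¹, n - 1, a⁻¹, ?_, ?_, ?_⟩
  · have := hl.smul a⁻¹
    rwa [show a⁻¹ * (a * g j * a⁻¹) * a⁻¹⁻¹ = g j by group] at this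
  · rw [sub_add_cancel]; rfl
  · rw [show n - 1 + 2 = n + 1 by ring]
    rcases h with ⟨rfl, rfl⟩ | ⟨rfl, rfl⟩
    · exact .inl ⟨rfl, rfl⟩
    · exact .inr ⟨rfl, rfl⟩

/-- A slide for which all cut turns contain the direction of `w₀`, but not all turns at `w₀` are
cut, reduces the total translation length. -/
theorem cost_slide_lt (hT : T.IsGrushko) {v w₀ d : T.V} {D : Set T.V}
    (hs : IsSlide G T.graph v D d) (hg : ∀ j, ¬ IsPeripheral A (g j))
    (hvw : InOrbit G v d v w₀ ∨ InOrbit G v d w₀ v)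
    (hcut : ∀ p ∈ D, ∀ r ∉ D, T.IsTurn g v p r → p = w₀ ∨ r = w₀) {r : T.V}
    (hr : T.IsTurn g v w₀ r) (hrD : w₀ ∈ D ↔ r ∈ D) :
    ((GrushkoModel.ofGrushko hT).slide hs).cost g < (GrushkoModel.ofGrushko hT).cost g := by
  have h := T.isFreeGTree hT.edges
  have key : ∀ (j : Fin m) (l : T.Line), T.IsAxis (g j) l →
      translationLength (slideGraph G T.graph v D d) (g j) ≤ translationLength T.graph (g j) ∧
      ((∃ (n : ℤ) (a : G), a • v = l.pt (n + 1) ∧ (a • w₀ = l.pt n ∨ a • w₀ = l.pt (n + 2)) ∧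
        (a⁻¹ • l.pt n ∈ D ↔ a⁻¹ • l.pt (n + 2) ∈ D)) →
      translationLength (slideGraph G T.graph v D d) (g j) < translationLength T.graph (g j)) := by
    rintro j l ⟨t, ht, hlt⟩
    have hturn : ∀ n, T.IsTurn g (l.pt (n + 1)) (l.pt n) (l.pt (n + 2)) := fun n =>
      ⟨1, j, l, n + 1, by
        rw [one_mul, inv_one, mul_one]
        exact ⟨t, ht, hlt⟩, rfl, .inl ⟨congrArg l.pt (by ring), congrArg l.pt (by ring)⟩⟩
    have htl : t ≤ translationLength T.graph (g j) := by
      have := T.isTree.1.nonempty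
      obtain ⟨x, hx⟩ := exists_dist_eq_translationLength T.graph (g j)
      rw [← hx]
      exact h.axis_le_dist l.adj (fun n hn => by have := l.inj hn; omega) hlt x
    obtain ⟨⟨y, hy⟩, hstrict⟩ := hs.exists_dist_le h hvw l.adj ht hlt fun n a ha hc => by
      have h1 := (hturn n).smul a⁻¹
      rw [← ha, inv_smul_smul] at h1
      have h2 : a⁻¹ • l.pt n = w₀ ∨ a⁻¹ • l.pt (n + 2) = w₀ := by
        by_cases h3 : a⁻¹ • l.pt n ∈ D
        · exact hcut _ h3 _ (fun h4 => hc (iff_of_true h3 h4)) h1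
        · refine (hcut _ ?_ _ h3 h1.symm).symm
          by_contra h4
          exact hc (iff_of_false h3 h4)
      rwa [inv_smul_eq_iff, inv_smul_eq_iff, eq_comm, eq_comm (b := a • w₀)] at h2
    refine ⟨((translationLength_le _ y).trans hy).trans htl, fun hex => ?_⟩
    obtain ⟨y, hy⟩ := hstrict hex
    exact ((translationLength_le _ y).trans_lt hy).trans_le htl
  obtain ⟨j, l, n, c, hl, hc, hcr⟩ := exists_axis_through hr
  refine Finset.sum_lt_sum (fun i _ => ?_) ⟨j, Finset.mem_univ j, (key j l hl).2 ⟨n, c, hc, ?_⟩⟩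
  · obtain ⟨l, t, ht, hl, hl2, hlt⟩ := h.exists_axis (hT.smul_ne (hg i))
    exact (key i ⟨l, hl, injective_of_locally_injective_int T.isTree hl hl2⟩ ⟨t, ht, hlt⟩).1
  · rcases hcr with ⟨h1, h2⟩ | ⟨h1, h2⟩
    · rw [← h1, ← h2, inv_smul_smul, inv_smul_smul]
      exact ⟨.inl rfl, hrD⟩
    · rw [← h1, ← h2, inv_smul_smul, inv_smul_smul]
      exact ⟨.inr rfl, hrD.symm⟩

/-- A cut of type ii gives a slide that reduces the total translation length, or a cut of type
i. -/
theorem IsTypeTwoSet.exists_cost_lt (hT : T.IsGrushko) (hg : ∀ j, ¬ IsPeripheral A (g j))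
    {v w₀ : T.V} {C : Set T.V} (hC : T.IsTypeTwoSet g v C w₀) :
    (∃ P : GrushkoModel A, P.cost g < (GrushkoModel.ofGrushko hT).cost g) ∨
      ∃ C, T.IsTypeOneSet g v C := by
  obtain ⟨c, hc, hturn⟩ := hC.exists_turn
  -- The natural slide moves `C` over the edge to `w₀`; the turn from `w₀` into `C` is not cut,
  -- which makes it strict. It is impossible only if that edge is also slid at its other end.
  by_cases hav : ∀ a : G, a • w₀ = v → a • v ∉ C
  · left
    have hs : IsSlide G T.graph v C w₀ := ⟨hC.adj, hC.disjoint, hC.mem, hav⟩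
    refine ⟨_, cost_slide_lt hT hs hg (.inl ⟨1, one_smul _ _, one_smul _ _⟩)
      (fun p hp r hr hpr => ?_) hturn (iff_of_true hC.mem hc)⟩
    by_contra! hne
    exact hr (hC.closed p hp hne.1 r hpr)
  · push Not at hav
    obtain ⟨a, ha, hav⟩ := hav
    have hne : a • v ≠ w₀ := fun h =>
      T.no_inversion a v w₀ (hC.adj _ hC.mem) ⟨h, ha⟩
    by_cases hall : ∀ r, T.IsTurn g v w₀ r → r ∈ C
    · refine .inr ⟨C, hC.toIsCutSet, ⟨_, hC.mem⟩, fun p hp r hpr => ?_⟩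
      by_cases hpw : p = w₀
      · exact hall r (hpw ▸ hpr)
      · exact hC.closed p hp hpw r hpr
    · left
      push Not at hall
      obtain ⟨r, hr, hrC⟩ := hall
      -- The orbit edge is used in its other position at `v`, leading to `a • v`. The turn from `w₀`
      -- to `r` avoids the slid set and is not cut.
      have hs : IsSlide G T.graph v (C \ {w₀}) (a • v) := by
        refine ⟨fun c hc => hC.adj c hc.1, fun s hs c hc hsc => hC.disjoint s hs c hc.1 hsc.1,
          ⟨hav, hne⟩, fun b hb hbv => ?_⟩
        have h1 : (b * a) = 1 := by
          refine hC.disjoint _ (by rw [mul_smul, hb]) w₀ hC.mem ?_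
          rw [mul_smul, ha]
          exact hbv.1
        refine hbv.2 ?_
        rw [mul_eq_one_iff_eq_inv.1 h1, ← ha, inv_smul_smul]
        rfl
      refine ⟨_, cost_slide_lt hT hs hg (.inr ⟨a⁻¹, ?_, inv_smul_smul _ _⟩)
        (fun p hp r hr hpr => ?_) hr (iff_of_false (fun h => h.2 rfl) fun h => hrC h.1)⟩
      · rw [← ha, inv_smul_smul]
      · by_contra! hne
        exact hr ⟨hC.closed p hp.1 hne.1 r hpr, hne.2⟩

/-- If the generators are not simultaneously elliptic in a free splitting then there is a reduced
Grushko tree. -/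
theorem exists_isWhiteheadReduced (hT : T.IsGrushko) (hg : ∀ j, ¬ IsPeripheral A (g j))
    (hG : (∀ a : G, IsPeripheral A a → a = 1) → ∃ a b : G, a * b ≠ b * a)
    (hS : ¬ ∃ S : GATree A, S.IsFreeSplitting ∧ ∀ j, S.IsElliptic (g j)) :
    ∃ T' : GATree A, T'.IsGrushko ∧ T'.IsWhiteheadReduced g := by
  obtain ⟨P, hP⟩ := (GrushkoModel.ofGrushko hT).exists_isOptimal g
  have hT' : (hP.tree hg hG).IsGrushko :=
    ⟨fun a ⟨v, hv⟩ => P.elliptic a v hv, P.isFreeGTree.free⟩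
  have hone : ∀ v C, ¬ (hP.tree hg hG).IsTypeOneSet g v C := by
    intro v C hC
    refine hS (hC.exists_isFreeSplitting hT'.edges (fun hfree => hG fun a ha => ?_)
      fun j => hT'.smul_ne (hg j))
    rcases ha with rfl | ⟨H, hH, ha⟩
    · rfl
    · obtain ⟨y, hy⟩ := P.fixes H hH
      exact hfree a y (hy a ha)
  refine ⟨_, hT', fun v hv => ?_⟩
  rcases hv with hv | hv
  · obtain ⟨C, hC⟩ := hv.exists_isTypeOneSet hT'.edges
    exact hone v C hC
  · obtain ⟨C, w₀, hC⟩ := hv.exists_isTypeTwoSet hT'.edges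
    rcases hC.exists_cost_lt hT' hg with ⟨Q, hQ⟩ | ⟨C', hC'⟩
    · exact absurd (hP Q).1 (not_le.2 hQ)
    · exact hone v C' hC'

end GATree

end Grushko

/-! ### Input from the free product, and the conclusion -/

namespace Grushko

lemma exists_freeGroup_mul_ne {N : ℕ} (hN : 2 ≤ N) : ∃ a b : FreeGroup (Fin N), a * b ≠ b * a := by
  have h0 : (⟨0, by omega⟩ : Fin N) ≠ ⟨1, by omega⟩ := by simp
  refine ⟨FreeGroup.of ⟨0, by omega⟩, FreeGroup.of ⟨1, by omega⟩, fun h => ?_⟩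
  -- Two generators are sent to transpositions of three points that do not commute.
  have h1 := congrArg (FreeGroup.lift fun i : Fin N =>
    if i = ⟨0, by omega⟩ then Equiv.swap (0 : Fin 3) 1 else Equiv.swap (1 : Fin 3) 2) h
  rw [map_mul, map_mul, FreeGroup.lift_apply_of, FreeGroup.lift_apply_of, if_pos rfl,
    if_neg h0.symm] at h1
  exact absurd h1 (by decide)

section

variable {G : Type u} [Group G] {k N : ℕ} {A : Fin k → Subgroup G}

/-- A factor would contain non-trivial peripheral elements, so there are none; then the complexity
bound gives a free group of rank at least two. -/
lemma IsTorsionFreeFreeProduct.exists_mul_ne (hA : IsTorsionFreeFreeProduct A N)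
    (hξ : 3 ≤ complexity k N) (htriv : ∀ a : G, IsPeripheral A a → a = 1) :
    ∃ a b : G, a * b ≠ b * a := by
  obtain ⟨φ, hφ⟩ := hA.freeProduct
  rcases Nat.eq_zero_or_pos k with rfl | hk
  · obtain ⟨a, b, hab⟩ := exists_freeGroup_mul_ne (N := N) (by unfold complexity at hξ; omega)
    have hinj : Function.Injective φ := by
      intro a b hab
      apply Monoid.Coprod.inr_injective (M := Monoid.CoprodI fun i => A i)
      apply hφ.1
      simpa using hab
    exact ⟨φ a, φ b, fun h => hab (hinj (by rw [map_mul, map_mul, h]))⟩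
  · have := hA.infinite ⟨0, hk⟩
    obtain ⟨a, ha⟩ := exists_ne (1 : A ⟨0, hk⟩)
    refine absurd (htriv a (.inr ⟨A ⟨0, hk⟩, ⟨⟨0, hk⟩, 1, fun h hh => by simpa using hh⟩, a.2⟩))
      fun h => ha (Subtype.ext h)

lemma IsTorsionFreeFreeProduct.nontrivial (hA : IsTorsionFreeFreeProduct A N)
    (hξ : 3 ≤ complexity k N) : Nontrivial G := by
  by_contra hG
  rw [not_nontrivial_iff_subsingleton] at hG
  obtain ⟨a, b, hab⟩ := hA.exists_mul_ne hξ fun a _ => Subsingleton.elim _ _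
  exact hab (Subsingleton.elim _ _)

/-- Peripheral elements are conjugate into torsion-free factors, and the others translate an axis in
the Grushko tree. -/
lemma IsTorsionFreeFreeProduct.zpow_ne_one (hA : IsTorsionFreeFreeProduct A N) {T : GATree A}
    (hT : T.IsGrushko) (a : G) (ha : a ≠ 1) (n : ℤ) (hn : n ≠ 0) : a ^ n ≠ 1 := by
  by_cases hp : IsPeripheral A a
  · rcases hp with rfl | ⟨H, ⟨i, b, hb⟩, haH⟩
    · exact absurd rfl ha
    · intro h
      refine hA.torsionFree i _ (hb a haH) (fun h1 => ha ?_)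
        (isOfFinOrder_iff_zpow_eq_one.2 ⟨n, hn, ?_⟩)
      · rwa [mul_eq_one_iff_eq_inv, inv_mul_eq_iff_eq_mul, mul_inv_cancel] at h1
      · have := conj_zpow (a := b⁻¹) (b := a) (i := n)
        rwa [inv_inv, h, mul_one, inv_mul_cancel] at this
  · exact (T.isFreeGTree hT.edges).pow_ne_one (hT.smul_ne hp) hn

/-- The three conditions on the generators: a reduced Grushko tree exists, the decomposition space
is connected, and the generators are not simultaneously elliptic in a free splitting. -/
theorem GATree.IsGrushko.tfae (hA : IsTorsionFreeFreeProduct A N) (hξ : 3 ≤ complexity k N)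
    {T₀ : GATree A} (hT₀ : T₀.IsGrushko) {m : ℕ} {g : Fin m → G}
    (hg : ∀ j, ¬ IsPeripheral A (g j)) :
    [∃ T : GATree A, T.IsGrushko ∧ T.IsWhiteheadReduced g,
      ConnectedSpace (T₀.DecompositionSpace g),
      ¬ ∃ S : GATree A, S.IsFreeSplitting ∧ ∀ j, S.IsElliptic (g j)].TFAE := by
  tfae_have 1 → 2 := by
    rintro ⟨T, hT, hred⟩
    by_contra hcon
    have := hA.nontrivial hξ
    obtain ⟨P, hP⟩ := GATree.exists_separates_of_not_connectedSpace hT₀.edges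
      (hA.zpow_ne_one hT₀) (fun j => hT₀.smul_ne (hg j)) hcon
    obtain ⟨Q, hQ⟩ := hT.exists_separates_of_separates hT₀ hP
    exact GATree.not_isWhiteheadReduced_of_separates hT.edges (hA.zpow_ne_one hT₀) hQ hred
  tfae_have 2 → 3 := by
    rintro hcon ⟨S, hS, hgS⟩
    obtain ⟨P, hP⟩ := hT₀.exists_separates hS hg hgS
    exact GATree.not_connectedSpace_of_separates hT₀.edges hP hcon
  tfae_have 3 → 1 := GATree.exists_isWhiteheadReduced hT₀ hg (hA.exists_mul_ne hξ)
  tfae_finish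

end

end Grushko

theorem proposition6p3 {G : Type u} [Group G] {k N : ℕ} (A : Fin k → Subgroup G)
    (hA : Grushko.IsTorsionFreeFreeProduct A N) (hξ : 3 ≤ Grushko.complexity k N)
    (T₀ : Grushko.GATree A) (hT₀ : T₀.IsGrushko) :
    (∀ (m : ℕ) (g : Fin m → G), (∀ j, ¬ Grushko.IsPeripheral A (g j)) →
      ((∃ T : Grushko.GATree A, T.IsGrushko ∧ T.IsWhiteheadReduced g) ↔
        ConnectedSpace (T₀.DecompositionSpace g))) ∧
    (∀ g : G, ¬ Grushko.IsPeripheral A g →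
      (¬ Grushko.IsSimple A g ↔
        ConnectedSpace (T₀.DecompositionSpace (fun _ : Fin 1 => g)))) := by
  refine ⟨fun m g hg => (hT₀.tfae hA hξ hg).out 0 1, fun g hg => ?_⟩
  have h := (hT₀.tfae hA hξ (g := fun _ : Fin 1 => g) fun _ => hg).out 2 1
  rw [← h, Grushko.IsSimple]
  simp only [forall_const]
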